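/- Let $k$ be a field of characteristic zero and $\mathcal O$ a (unital) cyclic operad of $k$-vector spaces. For a finite set $S$ with $n+1$ elements put $\mathcal O((S))=\bigl(\bigoplus_{L:S\cong\{0,\dots,n\}}\mathcal O(n)\bigr)_{S_{n+1}}$. Graphs are finite, possibly disconnected or empty, with multiple edges and loops allowed, and all vertices have valence $\ge 3$. An orientation of a graph is an ordering of its vertices together with a direction of each edge, modulo even changes (a transposition of two vertices and the reversal of one edge are odd). An $\mathcal O$-labelling of a graph is a choice of an element of $\mathcal O((H(v)))$ for each vertex $v$, where $H(v)$ is the set of half-edges at $v$. The graph complex $\mathcal G^{\mathcal O}$ is the $k$-vector space spanned by oriented $\mathcal O$-labelled graphs, modulo isomorphism, the relation $(G,or)=-(G,-or)$ and multilinearity in the labels. It is graded by the number of vertices. For a non-loop edge $e$ of $G$, let $G_e$ be the contraction of $e$, where the two operad elements at its ends are composed along $e$; the orientation is represented such that $e$ is directed from the first to the second vertex, and the new vertex becomes the first one. For a loop, $G_e=0$. The boundary is $\partial_G(G)=\sum_e G_e$, and $\partial_G$ is extended to the graded symmetric power $S^n\mathcal G^{\mathcal O}$ as a derivation: $\partial_G(x_1\odot\cdots\odot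 x_n)=\sum_i(-1)^{|x_1|+\cdots+|x_{i-1}|}x_1\odot\cdots\odot\partial_G x_i\odot\cdots\odot x_n$. Let $n\ge 1$. For directed edges $e_1,\dots,e_n$ lying in distinct graphs among $G_1,\dots,G_n$, let $(G_1\cdots G_n)\langle e_1,\dots,e_n\rangle$ be the graph obtained from the disjoint union $G_1\cdots G_n$ (with the vertices of $G_1$ first, then those of $G_2$, and so on) by gluing a $2n$-gon along $e_1,\dots,e_n$ in this cyclic order and deleting these edges. That is, for each $i$ modulo $n$ the edges $e_i$ are replaced by new edges joining the head of $e_i$ to the tail of $e_{i+1}$, each directed from the tail of $e_{i+1}$ to the head of $e_i$; here the orientation of $G_1\cdots G_n$ is represented such that each $e_i$ has its given direction. Define $$\varphi_n(G_1\odot\cdots\odot G_n)=\tfrac12\sum_{(e_1,\dots,e_n)}\bigl((G_1\cdots G_n)\langle e_1,\dots,e_n\rangle\bigr)_{e},\qquad \mu_n(G_1\odot\cdots\odot G_n)=\tfrac1{2n}\sum_{(e_1,\dots,e_n)}(G_1\cdots G_n)\langle e_1,\dots,e_n\rangle ,$$ where the sums are over all $n$-tuples of directed edges lying in distinct graphs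 $G_i$ (in any order), and $e$ is the new edge joining the head of $e_1$ to the tail of $e_2$ (indices modulo $n$). So each gluing of a $2n$-gon, with one marked new edge for $\varphi_n$ and without for $\mu_n$, is counted once. Proposition. These formulas give well-defined linear maps $\partial_G:\mathcal G^{\mathcal O}\to\mathcal G^{\mathcal O}$, $\partial_G:S^n\mathcal G^{\mathcal O}\to S^n\mathcal G^{\mathcal O}$ and $\varphi_n,\mu_n:S^n\mathcal G^{\mathcal O}\to\mathcal G^{\mathcal O}$. Both maps $\partial_G$ have square zero, $\varphi_1=\partial_G$, and $$\partial_G\circ\varphi_n+\varphi_n\circ\partial_G=0,\qquad \varphi_n=\partial_G\circ\mu_n-\mu_n\circ\partial_G .$$ In particular, $\varphi_n(x_1\odot\cdots\odot x_n)=\partial_G\,\mu_n(x_1\odot\cdots\odot x_n)$ if $\partial_Gx_i=0$ for all $i$, and the map $H(S^n\mathcal G^{\mathcal O})\to H(\mathcal G^{\mathcal O})$ induced by $\varphi_n$ is well defined and zero. -/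

import Mathlib

open scoped TensorProduct DirectSum

/-! ### Cyclic operads -/

/-- Elements of arity `m` are thought of as trees whose root is labelled `0` and whose leaves are
labelled `1, …, m`.  When the root of a tree of arity `n` is grafted onto the leaf `i + 1` of a tree
of arity `m`, the remaining external edge `x ≠ i + 1` of the lower tree gets this label. -/
def outerLabel {m n p : ℕ} (h : m + n = p + 1) (i : Fin m) (x : Fin (m + 1)) : Fin (p + 1) :=
  ⟨if (x : ℕ) ≤ i then x else x + n - 1, by split_ifs <;> omega⟩

/-- The label which the leaf `y ≠ 0` of the upper tree gets in the grafting described in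
`outerLabel`. -/
def innerLabel {m n p : ℕ} (h : m + n = p + 1) (i : Fin m) (y : Fin (n + 1)) : Fin (p + 1) :=
  ⟨i + y, by omega⟩

/-- A (unital) cyclic operad of `k`-modules: spaces `O(n)`, with an action of the permutations of
the root (labelled `0`) and the leaves (labelled `1, …, n`), and partial compositions `a ∘ᵢ b`
grafting the root of `b` onto a leaf of `a`.  The leaf `i : Fin m` has the label `i.succ`. -/
structure CyclicOperad (k : Type*) [CommRing k] where
  obj : ℕ → Type*
  [addCommGroup : ∀ n, AddCommGroup (obj n)]
  [module : ∀ n, Module k (obj n)]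
  /-- The action of the symmetric group on `n + 1` letters: `act σ a` is `a` with the label `x`
  replaced by `σ x`. -/
  act : ∀ n, Representation k (Equiv.Perm (Fin (n + 1))) (obj n)
  one : obj 1
  /-- `comp h i a b` is `a ∘ᵢ b`. -/
  comp : ∀ {m n p : ℕ}, m + n = p + 1 → Fin m → obj m →ₗ[k] obj n →ₗ[k] obj p
  one_comp : ∀ {n : ℕ} (h : 1 + n = n + 1) (b : obj n), comp h 0 one b = b
  comp_one : ∀ {m : ℕ} (h : m + 1 = m + 1) (i : Fin m) (a : obj m), comp h i a one = a
  act_one : ∀ σ : Equiv.Perm (Fin (1 + 1)), act 1 σ one = one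
  /-- Sequential associativity. -/
  comp_assoc : ∀ {m n l p q r : ℕ} (h₁ : m + n = p + 1) (h₂ : p + l = r + 1) (h₃ : n + l = q + 1)
    (h₄ : m + q = r + 1) (i : Fin m) (j : Fin n) (j' : Fin p) (a : obj m) (b : obj n) (c : obj l),
    (j' : ℕ) = i + j → comp h₂ j' (comp h₁ i a b) c = comp h₄ i a (comp h₃ j b c)
  /-- Parallel associativity. -/
  comp_comm : ∀ {m n l p q r : ℕ} (h₁ : m + n = p + 1) (h₂ : p + l = r + 1) (h₃ : m + l = q + 1)
    (h₄ : q + n = r + 1) (i j : Fin m) (i' : Fin q) (j' : Fin p) (a : obj m) (b : obj n)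
    (c : obj l), i < j → (i' : ℕ) = i → (j' : ℕ) + 1 = j + n →
    comp h₂ j' (comp h₁ i a b) c = comp h₄ i' (comp h₃ j a c) b
  /-- Equivariance, for relabellings in which the grafting remains one of the root of `b` onto a
  leaf of `a`.  (The root of `a` may be moved.) -/
  comp_equivariant : ∀ {m n p : ℕ} (h : m + n = p + 1) (i i' : Fin m)
    (σ : Equiv.Perm (Fin (m + 1))) (τ : Equiv.Perm (Fin (n + 1))) (ρ : Equiv.Perm (Fin (p + 1))),
    σ i.succ = i'.succ → τ 0 = 0 →
    (∀ x, x ≠ i.succ → ρ (outerLabel h i x) = outerLabel h i' (σ x)) →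
    (∀ y, y ≠ 0 → ρ (innerLabel h i y) = innerLabel h i' (τ y)) →
    ∀ a b, comp h i' (act m σ a) (act n τ b) = act p ρ (comp h i a b)
  /-- Equivariance, for relabellings which exchange the roles of the two ends of the grafted
  edge. -/
  comp_swap : ∀ {m n p : ℕ} (h : m + n = p + 1) (h' : n + m = p + 1) (i : Fin m) (j : Fin n)
    (σ : Equiv.Perm (Fin (m + 1))) (τ : Equiv.Perm (Fin (n + 1))) (ρ : Equiv.Perm (Fin (p + 1))),
    σ i.succ = 0 → τ 0 = j.succ →
    (∀ x, x ≠ i.succ → ρ (outerLabel h i x) = innerLabel h' j (σ x)) →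
    (∀ y, y ≠ 0 → ρ (innerLabel h i y) = outerLabel h' j (τ y)) →
    ∀ a b, comp h' j (act n τ b) (act m σ a) = act p ρ (comp h i a b)

attribute [instance] CyclicOperad.addCommGroup CyclicOperad.module

namespace CyclicOperad

section

variable {k : Type*} [CommRing k] (O : CyclicOperad k)

/-- The relations `(σ · o)_{σ · L} = o_L` defining the coinvariants in `O((S))`. -/
def coinvRel (S : Type) :
    Submodule k (⨁ L : (Σ n, S ≃ Fin (n + 1)), O.obj L.1) :=
  Submodule.span k {z | ∃ (n : ℕ) (L : S ≃ Fin (n + 1)) (σ : Equiv.Perm (Fin (n + 1)))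
    (o : O.obj n), z =
      open Classical in
      DirectSum.lof k (Σ n, S ≃ Fin (n + 1)) (fun L => O.obj L.1) ⟨n, L.trans σ⟩ (O.act n σ o) -
      DirectSum.lof k (Σ n, S ≃ Fin (n + 1)) (fun L => O.obj L.1) ⟨n, L⟩ o}

/-- The space `O((S))`: the coinvariants of the direct sum of copies of `O(n)`, one for each
labelling `L` of `S` by `0, …, n` (so `n + 1` is the number of elements of `S`). -/
abbrev Dec (S : Type) : Type _ :=
  (⨁ L : (Σ n, S ≃ Fin (n + 1)), O.obj L.1) ⧸ O.coinvRel S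

variable {O}

/-- The class of `o_L` in `O((S))`. -/
noncomputable def Dec.mk {S : Type} {n : ℕ} (L : S ≃ Fin (n + 1)) : O.obj n →ₗ[k] O.Dec S :=
  open Classical in
  (O.coinvRel S).mkQ ∘ₗ
    DirectSum.lof k (Σ n, S ≃ Fin (n + 1)) (fun L => O.obj L.1) ⟨n, L⟩

theorem Dec.mk_act {S : Type} {n : ℕ} (L : S ≃ Fin (n + 1)) (σ : Equiv.Perm (Fin (n + 1)))
    (o : O.obj n) : Dec.mk (L.trans σ) (O.act n σ o) = Dec.mk L o := by
  classical
  refine (Submodule.Quotient.eq _).2 (Submodule.subset_span ⟨n, L, σ, o, ?_⟩)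
  congr

/-- Transport of `O((S))` along a bijection. -/
noncomputable def Dec.map {S T : Type} (e : S ≃ T) : O.Dec S →ₗ[k] O.Dec T :=
  open Classical in
  (O.coinvRel S).liftQ
    (DirectSum.toModule k (Σ n, S ≃ Fin (n + 1)) (O.Dec T) fun L => Dec.mk (e.symm.trans L.2))
    (by
      refine Submodule.span_le.2 ?_
      rintro _ ⟨n, L, σ, o, rfl⟩
      rw [SetLike.mem_coe, LinearMap.mem_ker, map_sub, sub_eq_zero]
      erw [DirectSum.toModule_lof, DirectSum.toModule_lof]
      exact Dec.mk_act (e.symm.trans L) σ o)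

theorem Dec.map_mk {S T : Type} (e : S ≃ T) {n : ℕ} (L : S ≃ Fin (n + 1)) (o : O.obj n) :
    Dec.map e (Dec.mk L o) = Dec.mk (e.symm.trans L) o := by
  classical
  simp only [Dec.map, Dec.mk, LinearMap.comp_apply, Submodule.mkQ_apply, Submodule.liftQ_apply]
  rw [DirectSum.toModule_lof]
  congr

/-- The action of a bijection of label sets. -/
noncomputable def relabel (O : CyclicOperad k) {m n : ℕ} (τ : Fin (m + 1) ≃ Fin (n + 1)) :
    O.obj m →ₗ[k] O.obj n := by
  obtain rfl : m = n := by simpa using Fintype.card_congr τ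
  exact O.act m τ

/-- The coordinate `O((S)) → O(n)` in the labelling `L`, the inverse of `Dec.mk L`. -/
noncomputable def Dec.coord {S : Type} {n : ℕ} (L : S ≃ Fin (n + 1)) : O.Dec S →ₗ[k] O.obj n :=
  open Classical in
  (O.coinvRel S).liftQ
    (DirectSum.toModule k (Σ n, S ≃ Fin (n + 1)) (O.obj n) fun L' =>
      O.relabel (L'.2.symm.trans L))
    (by
      refine Submodule.span_le.2 ?_
      rintro _ ⟨m, L', σ, o, rfl⟩
      obtain rfl : m = n := by simpa using Fintype.card_congr (L'.symm.trans L)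
      rw [SetLike.mem_coe, LinearMap.mem_ker, map_sub, sub_eq_zero]
      erw [DirectSum.toModule_lof, DirectSum.toModule_lof]
      change O.act m ((L'.trans σ).symm.trans L) (O.act m σ o) = O.act m (L'.symm.trans L) o
      rw [← Module.End.mul_apply, ← map_mul]
      congr 2
      ext x
      simp [Equiv.Perm.mul_apply])

theorem Dec.coord_mk {S : Type} {n : ℕ} (L : S ≃ Fin (n + 1)) (o : O.obj n) :
    Dec.coord L (Dec.mk L o) = o := by
  classical
  simp only [Dec.coord, Dec.mk, LinearMap.comp_apply, Submodule.mkQ_apply]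
  erw [Submodule.liftQ_apply, DirectSum.toModule_lof]
  change O.act n (L.symm.trans L) o = o
  rw [Equiv.symm_trans_self]
  exact congrArg (fun f => f o) (map_one (O.act n))

theorem Dec.mk_coord {S : Type} {n : ℕ} (L : S ≃ Fin (n + 1)) (x : O.Dec S) :
    Dec.mk L (Dec.coord L x) = x := by
  classical
  have key : (Dec.mk L ∘ₗ Dec.coord L : O.Dec S →ₗ[k] O.Dec S) = LinearMap.id := by
    refine Submodule.linearMap_qext _ (DirectSum.linearMap_ext _ fun L' => ?_)
    obtain ⟨m, L'⟩ := L'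
    obtain rfl : m = n := by simpa using Fintype.card_congr (L'.symm.trans L)
    ext o
    have h1 : Dec.mk L' o = Dec.mk L (O.act m (L'.symm.trans L) o) := by
      rw [← Dec.mk_act L' (L'.symm.trans L) o]
      congr 1
      congr 1
      ext x
      simp
    change Dec.mk L (Dec.coord L (Dec.mk L' o)) = Dec.mk L' o
    rw [h1, Dec.coord_mk]
  exact congrArg (fun f => f x) key

/-- Labellings of `S` and `T` for which grafting along `s` and `t` is a partial composition of the
operad: `t` is the root of `T`, and `s` is a leaf of `S`. -/
structure GraftLabelling {S T : Type} (s : S) (t : T) where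
  m : ℕ
  n : ℕ
  p : ℕ
  h : m + n = p + 1
  L : S ≃ Fin (m + 1)
  M : T ≃ Fin (n + 1)
  i : Fin m
  hi : L s = i.succ
  ht : M t = 0

theorem GraftLabelling.nonempty {S T : Type} [Finite S] [Finite T] (s : S) (t : T)
    (hS : 2 ≤ Nat.card S) : Nonempty (GraftLabelling s t) := by
  have hT : 0 < Nat.card T := Nat.card_pos_iff.2 ⟨⟨t⟩, inferInstance⟩
  obtain ⟨m, hm⟩ := Nat.exists_eq_add_of_le' hS
  obtain ⟨n, hn⟩ := Nat.exists_eq_add_of_le' hT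
  let L := Finite.equivFinOfCardEq hm
  let M := Finite.equivFinOfCardEq hn
  exact ⟨⟨m + 1, n, m + n, by omega, L.trans (Equiv.swap (L s) (Fin.succ 0)),
    M.trans (Equiv.swap (M t) 0), 0, by simp, by simp⟩⟩

/-- The labelling, by the rule `outerLabel` and `innerLabel`, of what remains of `S` and `T`. -/
noncomputable def GraftLabelling.result {S T : Type} {s : S} {t : T} (G : GraftLabelling s t) :
    {x : S // x ≠ s} ⊕ {y : T // y ≠ t} ≃ Fin (G.p + 1) :=
  Equiv.ofBijective
    (Sum.elim (fun x => outerLabel G.h G.i (G.L x)) (fun y => innerLabel G.h G.i (G.M y))) (by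
    obtain ⟨m, n, p, h, L, M, i, hi, ht⟩ := G
    have hx : ∀ x : {x : S // x ≠ s}, (L x : ℕ) ≠ i + 1 := fun x hx =>
      x.2 (L.injective (by rw [hi]; exact Fin.ext (by simpa using hx)))
    have hy : ∀ y : {y : T // y ≠ t}, (M y : ℕ) ≠ 0 := fun y hy =>
      y.2 (M.injective (by rw [ht]; exact Fin.ext (by simpa using hy)))
    constructor
    · rintro (x | y) (x' | y') hxy <;>
        simp only [Sum.elim_inl, Sum.elim_inr, outerLabel, innerLabel, Fin.mk.injEq] at hxy
      · have h1 := hx x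
        have h2 := hx x'
        congr 1
        refine Subtype.ext (L.injective (Fin.ext ?_))
        split_ifs at hxy <;> omega
      · have h1 := hx x
        have h2 := hy y'
        have h3 := (M y').2
        split_ifs at hxy <;> omega
      · have h1 := hx x'
        have h2 := hy y
        have h3 := (M y).2
        split_ifs at hxy <;> omega
      · congr 1
        refine Subtype.ext (M.injective (Fin.ext ?_))
        omega
    · intro z
      have hz : (z : ℕ) < p + 1 := z.2
      have outer : ∀ w : Fin (m + 1), w ≠ i.succ → outerLabel h i w = z →
          ∃ a, Sum.elim (fun x : {x : S // x ≠ s} => outerLabel h i (L x))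
            (fun y : {y : T // y ≠ t} => innerLabel h i (M y)) a = z := by
        intro w hw hwz
        refine ⟨Sum.inl ⟨L.symm w, fun e => hw ?_⟩, by simpa using hwz⟩
        rw [← hi, ← e, Equiv.apply_symm_apply]
      by_cases h1 : (z : ℕ) ≤ i
      · refine outer ⟨z, by omega⟩ (fun e => ?_) (Fin.ext ?_)
        · have := congrArg Fin.val e
          simp at this
          omega
        · simp [outerLabel, h1]
      · by_cases h2 : (z : ℕ) ≤ i + n
        · refine ⟨Sum.inr ⟨M.symm ⟨z - i, by omega⟩, fun e => ?_⟩, Fin.ext ?_⟩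
          · have := congrArg M e
            rw [ht, Equiv.apply_symm_apply] at this
            have := congrArg Fin.val this
            simp at this
            omega
          · simp [innerLabel]
            omega
        · refine outer ⟨z + 1 - n, by omega⟩ (fun e => ?_) (Fin.ext ?_)
          · have := congrArg Fin.val e
            simp at this
            omega
          · simp only [outerLabel]
            split_ifs <;> omega)

/-- The composition `O((S)) × O((T)) → O((U))` along `s ∈ S` and `t ∈ T`, where `U` is identified
with what remains of `S` and `T` by `e`.  It is computed in an arbitrary labelling for which it is a
partial composition of the operad; by equivariance the result does not depend on this choice. -/
noncomputable def graft {S T U : Type} [Finite S] [Finite T] (s : S) (t : T) (hS : 2 ≤ Nat.card S)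
    (e : {x : S // x ≠ s} ⊕ {y : T // y ≠ t} ≃ U) (x : O.Dec S) (y : O.Dec T) : O.Dec U :=
  let G : GraftLabelling s t := Classical.choice (GraftLabelling.nonempty s t hS)
  Dec.mk (e.symm.trans G.result) (O.comp G.h G.i (Dec.coord G.L x) (Dec.coord G.M y))

end

end CyclicOperad

/-! ### Oriented labelled graphs -/

section

universe u w

variable {k : Type u} [CommRing k]

/-- An oriented `O`-labelled graph with vertices of valence at least three.  A graph is given by
finite sets of vertices and of half-edges, the vertex `att h` of each half-edge `h`, and a
fixed-point free involution `inv` whose orbits are the edges.  A representative of an orientation is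
an ordering of the vertices together with a direction of each edge: `out h = true` if the edge of
`h` is directed away from `h`, that is from `att h` to `att (inv h)`. -/
structure LabelledGraph (O : CyclicOperad.{u, w} k) where
  V : Type
  H : Type
  [fintypeV : Fintype V]
  [linearOrderV : LinearOrder V]
  [fintypeH : Fintype H]
  [decidableEqH : DecidableEq H]
  att : H → V
  inv : H → H
  inv_inv : ∀ h, inv (inv h) = h
  inv_ne : ∀ h, inv h ≠ h
  out : H → Bool
  out_inv : ∀ h, out (inv h) = !out h
  valence : ∀ v, 3 ≤ Nat.card {h : H // att h = v}
  lab : ∀ v, O.Dec {h : H // att h = v}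

namespace LabelledGraph

attribute [instance] fintypeV linearOrderV fintypeH decidableEqH

variable {O : CyclicOperad.{u, w} k}

/-- An isomorphism of labelled graphs, which need not preserve the orientations. -/
structure Iso (Γ Δ : LabelledGraph O) where
  vert : Γ.V ≃ Δ.V
  half : Γ.H ≃ Δ.H
  att_half : ∀ h, Δ.att (half h) = vert (Γ.att h)
  inv_half : ∀ h, Δ.inv (half h) = half (Γ.inv h)
  lab_vert : ∀ v, Δ.lab (vert v) =
    CyclicOperad.Dec.map (half.subtypeEquiv fun h => by simp [att_half]) (Γ.lab v)

/-- `1` or `-1`, according to whether the isomorphism preserves or reverses the orientations: the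
sign of the permutation of the ordered vertices, times `-1` for each edge whose direction is not
preserved. -/
def Iso.sign {Γ Δ : LabelledGraph O} (f : Iso Γ Δ) : ℤ :=
  (∏ x : Γ.V, ∏ y : Γ.V, if x < y ∧ f.vert y < f.vert x then -1 else 1) *
    ∏ h : Γ.H, if Γ.out h = true ∧ Δ.out (f.half h) = false then -1 else 1

/-- The graph with the label of the vertex `v` replaced by `x`. -/
def setLab (Γ : LabelledGraph O) (v : Γ.V) (x : O.Dec {h : Γ.H // Γ.att h = v}) :
    LabelledGraph O :=
  { Γ with lab := Function.update Γ.lab v x }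

end LabelledGraph

open LabelledGraph

/-- The relations of the graph complex: isomorphic graphs are identified up to the sign relating
their orientations (in particular `(G, or) = - (G, -or)`), and the labels are multilinear. -/
noncomputable def graphRel (O : CyclicOperad.{u, w} k) : Submodule k (LabelledGraph O →₀ k) :=
  Submodule.span k
    ({z | ∃ (Γ Δ : LabelledGraph O) (f : Iso Γ Δ),
        z = Finsupp.single Γ 1 - f.sign • Finsupp.single Δ 1} ∪
     {z | ∃ (Γ : LabelledGraph O) (v : Γ.V) (x y : O.Dec {h : Γ.H // Γ.att h = v}),
        z = Finsupp.single (Γ.setLab v (x + y)) 1 -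
          (Finsupp.single (Γ.setLab v x) 1 + Finsupp.single (Γ.setLab v y) 1)} ∪
     {z | ∃ (Γ : LabelledGraph O) (v : Γ.V) (c : k) (x : O.Dec {h : Γ.H // Γ.att h = v}),
        z = Finsupp.single (Γ.setLab v (c • x)) 1 - c • Finsupp.single (Γ.setLab v x) 1})

/-- The graph complex `𝒢^O`. -/
abbrev GraphComplex (O : CyclicOperad.{u, w} k) : Type _ :=
  (LabelledGraph O →₀ k) ⧸ graphRel O

/-- The class in the graph complex of an oriented labelled graph. -/
noncomputable def LabelledGraph.cls {O : CyclicOperad.{u, w} k} (Γ : LabelledGraph O) :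
    GraphComplex O :=
  (graphRel O).mkQ (Finsupp.single Γ 1)

/-- The part of the graph complex spanned by the graphs with `v` vertices. -/
noncomputable def graphDegree (O : CyclicOperad.{u, w} k) (v : ℕ) : Submodule k (GraphComplex O) :=
  Submodule.span k {x | ∃ Γ : LabelledGraph O, Fintype.card Γ.V = v ∧ x = Γ.cls}

namespace LabelledGraph

variable {O : CyclicOperad.{u, w} k}

/-! ### Contraction of an edge -/

/-- After the contraction of the edge `{t, inv t}`, the half-edges at the new vertex are the
remaining half-edges at the two endpoints. -/
def contractHalves (Γ : LabelledGraph O) (t : Γ.H) (ht : Γ.att t ≠ Γ.att (Γ.inv t)) :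
    {x : {h : Γ.H // Γ.att h = Γ.att t} // x ≠ ⟨t, rfl⟩} ⊕
      {y : {h : Γ.H // Γ.att h = Γ.att (Γ.inv t)} // y ≠ ⟨Γ.inv t, rfl⟩} ≃
    {h : {h : Γ.H // h ≠ t ∧ h ≠ Γ.inv t} //
      Γ.att h = Γ.att t ∨ Γ.att h = Γ.att (Γ.inv t)} where
  toFun := Sum.elim
    (fun x => ⟨⟨x.1.1, fun e => x.2 (Subtype.ext e), fun e => ht (x.1.2.symm.trans (congrArg Γ.att e))⟩,
      Or.inl x.1.2⟩)
    (fun y => ⟨⟨y.1.1, fun e => ht ((congrArg Γ.att e).symm.trans y.1.2), fun e => y.2 (Subtype.ext e)⟩,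
      Or.inr y.1.2⟩)
  invFun h :=
    if e : Γ.att h.1.1 = Γ.att t then
      Sum.inl ⟨⟨h.1.1, e⟩, fun e' => h.1.2.1 (congrArg Subtype.val e')⟩
    else Sum.inr ⟨⟨h.1.1, h.2.resolve_left e⟩, fun e' => h.1.2.2 (congrArg Subtype.val e')⟩
  left_inv := by
    rintro (⟨⟨x, hx⟩, hx'⟩ | ⟨⟨y, hy⟩, hy'⟩)
    · simp [hx]
    · simp [hy, ht.symm]
  right_inv := by
    rintro ⟨⟨h, h1⟩, h2⟩
    by_cases e : Γ.att h = Γ.att t <;> simp [e]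

/-- The vertices after the contraction of the edge `{t, inv t}`: the new vertex `⊥`, which comes
first, and the vertices which are not endpoints of the edge, in their old order. -/
abbrev ContractV (Γ : LabelledGraph O) (t : Γ.H) : Type :=
  WithBot {v : Γ.V // v ≠ Γ.att t ∧ v ≠ Γ.att (Γ.inv t)}

/-- The half-edges after the contraction of the edge `{t, inv t}`. -/
abbrev ContractH (Γ : LabelledGraph O) (t : Γ.H) : Type :=
  {h : Γ.H // h ≠ t ∧ h ≠ Γ.inv t}

/-- The vertex of a half-edge after the contraction of the edge `{t, inv t}`. -/
def contractAtt (Γ : LabelledGraph O) (t : Γ.H) (h : Γ.ContractH t) : Γ.ContractV t :=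
  if e : Γ.att h ≠ Γ.att t ∧ Γ.att h ≠ Γ.att (Γ.inv t) then
    ((⟨Γ.att h, e⟩ : {v : Γ.V // v ≠ Γ.att t ∧ v ≠ Γ.att (Γ.inv t)}) : Γ.ContractV t)
  else ⊥

theorem contractAtt_eq_bot (Γ : LabelledGraph O) (t : Γ.H) (h : Γ.ContractH t) :
    Γ.contractAtt t h = ⊥ ↔ Γ.att h = Γ.att t ∨ Γ.att h = Γ.att (Γ.inv t) := by
  unfold contractAtt
  split_ifs with e
  · simp [e.1, e.2]
  · simp only [true_iff]
    tauto

theorem contractAtt_eq_coe (Γ : LabelledGraph O) (t : Γ.H) (h : Γ.ContractH t)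
    (v : {v : Γ.V // v ≠ Γ.att t ∧ v ≠ Γ.att (Γ.inv t)}) :
    Γ.contractAtt t h = (v : Γ.ContractV t) ↔ Γ.att h = v := by
  unfold contractAtt
  split_ifs with e
  · rw [WithBot.coe_inj, Subtype.ext_iff]
  · simp only [false_iff, WithBot.bot_ne_coe]
    exact fun e' => e (e' ▸ v.2)

/-- The half-edges at the new vertex. -/
def contractBot (Γ : LabelledGraph O) (t : Γ.H) (ht : Γ.att t ≠ Γ.att (Γ.inv t)) :
    {x : {h : Γ.H // Γ.att h = Γ.att t} // x ≠ ⟨t, rfl⟩} ⊕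
      {y : {h : Γ.H // Γ.att h = Γ.att (Γ.inv t)} // y ≠ ⟨Γ.inv t, rfl⟩} ≃
    {h : Γ.ContractH t // Γ.contractAtt t h = ⊥} :=
  (Γ.contractHalves t ht).trans
    (Equiv.subtypeEquivRight fun h => (Γ.contractAtt_eq_bot t h).symm)

/-- The half-edges at an old vertex are not affected by the contraction. -/
def contractCoe (Γ : LabelledGraph O) (t : Γ.H)
    (v : {v : Γ.V // v ≠ Γ.att t ∧ v ≠ Γ.att (Γ.inv t)}) :
    {h : Γ.H // Γ.att h = v} ≃ {h : Γ.ContractH t // Γ.contractAtt t h = (v : Γ.ContractV t)} where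
  toFun h := ⟨⟨h.1, fun e => v.2.1 (by rw [← h.2, e]), fun e => v.2.2 (by rw [← h.2, e])⟩,
    (Γ.contractAtt_eq_coe t _ v).2 h.2⟩
  invFun h := ⟨h.1.1, (Γ.contractAtt_eq_coe t _ v).1 h.2⟩
  left_inv _ := rfl
  right_inv _ := rfl

/-- The contraction of the edge `{t, inv t}`, which is not a loop: the operad elements at its two
endpoints are composed along it. -/
noncomputable def contract (Γ : LabelledGraph O) (t : Γ.H) (ht : Γ.att t ≠ Γ.att (Γ.inv t)) :
    LabelledGraph O where
  V := Γ.ContractV t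
  H := Γ.ContractH t
  fintypeV := inferInstanceAs (Fintype (Option _))
  att := Γ.contractAtt t
  inv h := ⟨Γ.inv h, fun e => h.2.2 ((Γ.inv_inv h).symm.trans (congrArg Γ.inv e)),
    fun e => h.2.1 ((Γ.inv_inv h).symm.trans ((congrArg Γ.inv e).trans (Γ.inv_inv t)))⟩
  inv_inv h := Subtype.ext (Γ.inv_inv h)
  inv_ne h e := Γ.inv_ne h (congrArg Subtype.val e)
  out h := Γ.out h
  out_inv h := Γ.out_inv h
  valence v := by
    cases v using WithBot.recBotCoe with
    | bot =>
      have h1 := Γ.valence (Γ.att t)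
      have h2 := Γ.valence (Γ.att (Γ.inv t))
      rw [← Nat.card_congr (Γ.contractBot t ht), Nat.card_sum]
      rw [Nat.card_eq_fintype_card] at h1 h2 ⊢
      rw [Nat.card_eq_fintype_card, Fintype.card_subtype_compl, Fintype.card_subtype_compl,
        Fintype.card_subtype_eq, Fintype.card_subtype_eq]
      omega
    | coe v =>
      rw [← Nat.card_congr (Γ.contractCoe t v)]
      exact Γ.valence v
  lab v := WithBot.recBotCoe (C := fun v => O.Dec {h // Γ.contractAtt t h = v})
    (CyclicOperad.graft _ _ ((by norm_num : 2 ≤ 3).trans (Γ.valence _)) (Γ.contractBot t ht)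
      (Γ.lab (Γ.att t)) (Γ.lab (Γ.att (Γ.inv t))))
    (fun v => CyclicOperad.Dec.map (Γ.contractCoe t v) (Γ.lab v)) v

/-- The sign of the permutation which moves the vertex `a` to the first place and the vertex `b` to
the second one, and leaves the order of the other vertices unchanged. -/
def frontSign (Γ : LabelledGraph O) (a b : Γ.V) : ℤ :=
  (-1) ^ (Finset.univ.filter fun v => v < a).card *
    (-1) ^ (Finset.univ.filter fun v => v < b ∧ v ≠ a).card

/-- The class of `(G, or)_e` in the graph complex, where `e` is an edge directed from the vertex of
the half-edge `t` to that of `inv t` (so that `out t = true`).  It is zero for a loop.  Otherwise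
the vertices are reordered such that `e` is directed from the first vertex to the second one; the
new vertex is then the first one. -/
noncomputable def contractCls (Γ : LabelledGraph O) (t : Γ.H) : GraphComplex O :=
  if ht : Γ.att t ≠ Γ.att (Γ.inv t) then
    Γ.frontSign (Γ.att t) (Γ.att (Γ.inv t)) • (Γ.contract t ht).cls
  else 0

/-! ### Disjoint unions and gluing of a polygon -/

variable {n : ℕ}

/-- The half-edges of a disjoint union at one of its vertices. -/
def unionHalves (Γ : Fin n → LabelledGraph O) (v : Lex (Σ i, (Γ i).V)) :
    {h : (Γ (ofLex v).1).H // (Γ (ofLex v).1).att h = (ofLex v).2} ≃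
      {h : Σ i, (Γ i).H // toLex (⟨h.1, (Γ h.1).att h.2⟩ : Σ i, (Γ i).V) = v} where
  toFun h := ⟨⟨(ofLex v).1, h.1⟩, congrArg toLex (Sigma.ext rfl (heq_of_eq h.2))⟩
  invFun h := ⟨(congrArg (fun v => (ofLex v).1) h.2 : h.1.1 = (ofLex v).1) ▸ h.1.2, by
    obtain ⟨h, rfl⟩ := h
    rfl⟩
  left_inv _ := rfl
  right_inv h := by
    obtain ⟨h, rfl⟩ := h
    rfl

/-- The disjoint union `Γ₁ · … · Γₙ`.  The vertices of `Γ₁` come first, then those of `Γ₂`, and so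
on. -/
noncomputable def union (Γ : Fin n → LabelledGraph O) : LabelledGraph O where
  V := Lex (Σ i, (Γ i).V)
  H := Σ i, (Γ i).H
  fintypeV := inferInstanceAs (Fintype (Lex (Σ i, (Γ i).V)))
  linearOrderV := Sigma.Lex.linearOrder
  att h := toLex ⟨h.1, (Γ h.1).att h.2⟩
  inv h := ⟨h.1, (Γ h.1).inv h.2⟩
  inv_inv h := by simp [(Γ h.1).inv_inv]
  inv_ne h e := (Γ h.1).inv_ne h.2 (by
    obtain ⟨i, h⟩ := h
    simpa using e)
  out h := (Γ h.1).out h.2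
  out_inv h := (Γ h.1).out_inv h.2
  valence v := by
    rw [← Nat.card_congr (unionHalves Γ v)]
    exact (Γ (ofLex v).1).valence _
  lab v := CyclicOperad.Dec.map (unionHalves Γ v) ((Γ (ofLex v).1).lab (ofLex v).2)

/-- The directed edges `eᵢ` of `Γᵢ` are given by their tails `t i`; the head is `inv (t i)`.  A
`2n`-gon is glued to the edges `eᵢ`, in the cyclic order `i, c i, c (c i), …`, and the edges `eᵢ`
are deleted.  So the head of `eᵢ` is joined to the tail of `e_{c i}` by a new edge.
This map is the new involution on half-edges. -/
def glueInv (Γ : Fin n → LabelledGraph O) (t : ∀ i, (Γ i).H) (c : Equiv.Perm (Fin n))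
    (h : Σ i, (Γ i).H) : Σ i, (Γ i).H :=
  if h.2 = t h.1 then ⟨c.symm h.1, (Γ (c.symm h.1)).inv (t (c.symm h.1))⟩
  else if h.2 = (Γ h.1).inv (t h.1) then ⟨c h.1, t (c h.1)⟩
  else ⟨h.1, (Γ h.1).inv h.2⟩

/-- The new directions of the edges.  Along the boundary of the polygon a new edge runs from the
head of `eᵢ` to the tail of `e_{c i}`; this is reversed, so the new edge is directed from the
half-edge `t (c i)` to the half-edge `inv (t i)`. -/
def glueOut (Γ : Fin n → LabelledGraph O) (t : ∀ i, (Γ i).H) (h : Σ i, (Γ i).H) : Bool :=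
  if h.2 = t h.1 then true
  else if h.2 = (Γ h.1).inv (t h.1) then false
  else (Γ h.1).out h.2

theorem glueInv_tail (Γ : Fin n → LabelledGraph O) (t : ∀ i, (Γ i).H) (c : Equiv.Perm (Fin n))
    (i : Fin n) : glueInv Γ t c ⟨i, t i⟩ = ⟨c.symm i, (Γ (c.symm i)).inv (t (c.symm i))⟩ := by
  simp [glueInv]

theorem glueInv_head (Γ : Fin n → LabelledGraph O) (t : ∀ i, (Γ i).H) (c : Equiv.Perm (Fin n))
    (i : Fin n) : glueInv Γ t c ⟨i, (Γ i).inv (t i)⟩ = ⟨c i, t (c i)⟩ := by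
  simp [glueInv, (Γ i).inv_ne]

theorem glueInv_other (Γ : Fin n → LabelledGraph O) (t : ∀ i, (Γ i).H) (c : Equiv.Perm (Fin n))
    (i : Fin n) (h : (Γ i).H) (h1 : h ≠ t i) (h2 : h ≠ (Γ i).inv (t i)) :
    glueInv Γ t c ⟨i, h⟩ = ⟨i, (Γ i).inv h⟩ := by
  simp [glueInv, h1, h2]

theorem inv_other {Γ : LabelledGraph O} {h t : Γ.H} (h1 : h ≠ t) (h2 : h ≠ Γ.inv t) :
    Γ.inv h ≠ t ∧ Γ.inv h ≠ Γ.inv t :=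
  ⟨fun e => h2 (by rw [← e, Γ.inv_inv]), fun e => h1 (by rw [← Γ.inv_inv h, e, Γ.inv_inv])⟩

/-- The graph `(Γ₁ · … · Γₙ)⟨…⟩` obtained by gluing a `2n`-gon to the directed edges with tails
`t i`, in the cyclic order `c`.  The operad elements at the vertices do not change.  The orientation
is the right one if the given directions of the edges agree with the orientations of the `Γᵢ`. -/
noncomputable def glue (Γ : Fin n → LabelledGraph O) (t : ∀ i, (Γ i).H) (c : Equiv.Perm (Fin n)) :
    LabelledGraph O :=
  { union Γ with
    inv := glueInv Γ t c
    inv_inv := by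
      rintro ⟨i, h⟩
      by_cases h1 : h = t i
      · subst h1
        rw [glueInv_tail, glueInv_head, Equiv.apply_symm_apply]
      · by_cases h2 : h = (Γ i).inv (t i)
        · subst h2
          rw [glueInv_head, glueInv_tail, Equiv.symm_apply_apply]
        · obtain ⟨h3, h4⟩ := inv_other h1 h2
          rw [glueInv_other Γ t c i h h1 h2, glueInv_other Γ t c i _ h3 h4, (Γ i).inv_inv]
    inv_ne := by
      rintro ⟨i, h⟩ e
      by_cases h1 : h = t i
      · subst h1
        rw [glueInv_tail] at e
        have e1 : c.symm i = i := congrArg Sigma.fst e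
        rw [e1] at e
        exact (Γ i).inv_ne _ (eq_of_heq (Sigma.mk.inj e).2)
      · by_cases h2 : h = (Γ i).inv (t i)
        · subst h2
          rw [glueInv_head] at e
          have e1 : c i = i := congrArg Sigma.fst e
          rw [e1] at e
          exact (Γ i).inv_ne _ (eq_of_heq (Sigma.mk.inj e).2).symm
        · rw [glueInv_other Γ t c i h h1 h2] at e
          exact (Γ i).inv_ne _ (eq_of_heq (Sigma.mk.inj e).2)
    out := glueOut Γ t
    out_inv := by
      rintro ⟨i, h⟩
      by_cases h1 : h = t i
      · subst h1
        rw [glueInv_tail]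
        simp [glueOut, (Γ _).inv_ne]
      · by_cases h2 : h = (Γ i).inv (t i)
        · subst h2
          rw [glueInv_head]
          simp [glueOut, (Γ _).inv_ne]
        · obtain ⟨h3, h4⟩ := inv_other h1 h2
          rw [glueInv_other Γ t c i h h1 h2]
          simp [glueOut, h1, h2, h3, h4, (Γ i).out_inv] }

/-- The sign relating the orientations of the `Γᵢ` to orientations in which the edges are directed
as the chosen directed edges: `-1` for each `i` for which the two directions differ. -/
def dirSign (Γ : Fin n → LabelledGraph O) (t : ∀ i, (Γ i).H) : ℤ :=
  ∏ i, if (Γ i).out (t i) = true then 1 else -1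

/-- The cyclic order `s 0, s 1, …, s (n - 1)`: the element `s j` is followed by `s (j + 1)`. -/
def cyclicOrder (s : Equiv.Perm (Fin n)) : Equiv.Perm (Fin n) :=
  s * finRotate n * s⁻¹

end LabelledGraph

/-! ### Graded symmetric powers and homology -/

/-- The relations `x₁ ⊗ … ⊗ xₙ = (-1)^{|xᵢ| |xᵢ₊₁|} x₁ ⊗ … ⊗ xᵢ₊₁ ⊗ xᵢ ⊗ … ⊗ xₙ` for homogeneous
elements of a module `M` with homogeneous parts `A d`. -/
def symRel {M : Type*} [AddCommGroup M] [Module k M] (A : ℕ → Submodule k M) (n : ℕ) :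
    Submodule k (⨂[k] _ : Fin n, M) :=
  Submodule.span k {z | ∃ (x : Fin n → M) (deg : Fin n → ℕ) (i j : Fin n),
    (∀ l, x l ∈ A (deg l)) ∧ (j : ℕ) = i + 1 ∧
    z = PiTensorProduct.tprod k x -
      (-1 : ℤ) ^ (deg i * deg j) • PiTensorProduct.tprod k (x ∘ Equiv.swap i j)}

/-- The `n`-th graded symmetric power of a graded module. -/
abbrev SymPower {M : Type*} [AddCommGroup M] [Module k M] (A : ℕ → Submodule k M) (n : ℕ) :
    Type _ :=
  (⨂[k] _ : Fin n, M) ⧸ symRel A n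

/-- The graded symmetric tensor `x₁ ⊙ … ⊙ xₙ`. -/
noncomputable def symTensor {M : Type*} [AddCommGroup M] [Module k M] (A : ℕ → Submodule k M)
    {n : ℕ} (x : Fin n → M) : SymPower A n :=
  (symRel A n).mkQ (PiTensorProduct.tprod k x)

/-- `D` is the extension of the map `d`, of odd degree, to the `n`-th graded symmetric power as a
derivation:
`D (x₁ ⊙ … ⊙ xₙ) = ∑ᵢ (-1)^{|x₁| + … + |xᵢ₋₁|} x₁ ⊙ … ⊙ d xᵢ ⊙ … ⊙ xₙ`. -/
def IsDerivationExtension {M : Type*} [AddCommGroup M] [Module k M] (A : ℕ → Submodule k M)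
    {n : ℕ} (d : M →ₗ[k] M) (D : SymPower A n →ₗ[k] SymPower A n) : Prop :=
  ∀ (x : Fin n → M) (deg : Fin n → ℕ), (∀ l, x l ∈ A (deg l)) →
    D (symTensor A x) = ∑ i : Fin n, (-1 : ℤ) ^ (∑ j ∈ Finset.Iio i, deg j) •
      symTensor A (Function.update x i (d (x i)))

/-- The homology `ker d / im d` of a module with a differential `d`. -/
abbrev Homology {M : Type*} [AddCommGroup M] [Module k M] (d : M →ₗ[k] M) : Type _ :=
  LinearMap.ker d ⧸ (LinearMap.range d).submoduleOf (LinearMap.ker d)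

/-! ### The boundary operator, the fusion operations and the gluing maps -/

/-- `S^n 𝒢^O`, where the degree of a graph is its number of vertices. -/
abbrev GraphSym (O : CyclicOperad.{u, w} k) (n : ℕ) : Type _ :=
  SymPower (graphDegree O) n

/-- `d` is the boundary operator: on a graph, it is the sum of the contractions of all edges. -/
def IsBoundary (O : CyclicOperad.{u, w} k) (d : GraphComplex O →ₗ[k] GraphComplex O) : Prop :=
  ∀ Γ : LabelledGraph O, d Γ.cls = ∑ h : {h : Γ.H // Γ.out h = true}, Γ.contractCls h

/-- `φ` is the fusion operation `φₙ`: on graphs `Γ₁, …, Γₙ`, it is the sum over all ways of gluing a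
`2n`-gon with one marked new edge to the graphs, and contracting the marked edge.  The gluings are
described by `n`-tuples of directed edges lying in distinct graphs: the `j`-th one is the directed
edge of `Γ_{s j}` with tail `t (s j)`, and the marked edge joins the head of the first one to the
tail of the second one.  An `n`-tuple and the tuple of the reversed edges in the reversed cyclic
order describe the same gluing, whence the factor `1 / 2`. -/
def IsFusion {k : Type u} [Field k] (O : CyclicOperad.{u, w} k) (n : ℕ) [NeZero n]
    (φ : GraphSym O n →ₗ[k] GraphComplex O) : Prop :=
  ∀ Γ : Fin n → LabelledGraph O, φ (symTensor (graphDegree O) fun i => (Γ i).cls) =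
    (1 / 2 : k) • ∑ s : Equiv.Perm (Fin n), ∑ t : (∀ i, (Γ i).H),
      dirSign Γ t •
        (glue Γ t (cyclicOrder s)).contractCls ⟨s (finRotate n 0), t (s (finRotate n 0))⟩

/-- `μ` is the gluing map `μₙ`: on graphs `Γ₁, …, Γₙ`, it is the sum over all ways of gluing a
`2n`-gon to the graphs, without contracting an edge.  Each of them is described by `2n` tuples of
directed edges, which differ by rotations and reflections of the polygon. -/
def IsGluing {k : Type u} [Field k] (O : CyclicOperad.{u, w} k) (n : ℕ)
    (μ : GraphSym O n →ₗ[k] GraphComplex O) : Prop :=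
  ∀ Γ : Fin n → LabelledGraph O, μ (symTensor (graphDegree O) fun i => (Γ i).cls) =
    (1 / (2 * n) : k) • ∑ s : Equiv.Perm (Fin n), ∑ t : (∀ i, (Γ i).H),
      dirSign Γ t • (glue Γ t (cyclicOrder s)).cls

end

/-! ### Grafting of cyclic operad elements -/

namespace CyclicOperad

variable {k : Type*} [CommRing k] {O : CyclicOperad k}

/-! The edges of a graph obtained by gluing a polygon are of two kinds: old edges of the graphs `Γ
i` and the new edges coming from the polygon. In `∂ μ`, contracting an old edge is the same as
contracting it before the gluing, and these terms make up `μ ∂`. Contracting a new edge gives the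
fusion terms. Hence `φ = ∂ μ - μ ∂`, and everything else is formal: `∂² = 0` gives `∂ φ + φ ∂ = -∂ μ
∂ + ∂ μ ∂ = 0`, and on cycles `φ` agrees with `∂ μ`, so it is zero on homology. The identity also
shows that `φ` is well defined, so only `∂` and `μ` have to be constructed by hand.

Signs are handled half-edge by half-edge. To a half-edge `h` belongs `signedContraction h`, the
contraction of its edge directed away from `h`, multiplied by the sign comparing this direction with
the orientation. It is natural under isomorphisms (`Iso.signedContraction_eq`) and does not change
when the edge is reversed (`signedContraction_inv`): the change of direction and the exchange of the
two endpoints cancel, and grafting is symmetric by `graft_comm`. So `∂` is half the sum of the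
signed contractions of all half-edges, with no choice of directions.

For `∂² = 0` it is shown that `doubleContraction` is antisymmetric in its two edges. If the edges
are parallel, both orders produce a loop. If they are disjoint, the two results differ by the
exchange of the two new vertices (`exists_iso_contract_disjoint`). If they share one vertex, the
results agree by sequential associativity of the operad (`exists_iso_contract_shared`), and the sign
comes from moving vertices to the front.

The Koszul signs on symmetric powers are absorbed into the involution `ε = (-1)^degree`: the
extension of `∂` to the symmetric power is a sum of terms having `∂` in one place and `ε` in all
earlier ones (`derivationTerm`). For graphs, the same sign is that of moving the new vertex past the
vertices of the earlier graphs (`exists_iso_contract_glue`).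

The numerical factors come from counting. `gluingSum` counts each gluing `2n` times, a polygon has
`n` new edges which can be rotated into each other (`sum_sum_cyclicOrder`), and each of them has two
half-edges. -/

theorem Dec.exists_mk {S : Type} {n : ℕ} (L : S ≃ Fin (n + 1)) (x : O.Dec S) :
    ∃ o, Dec.mk L o = x :=
  ⟨_, Dec.mk_coord L x⟩

theorem Dec.coord_trans {S : Type} {n : ℕ} (L : S ≃ Fin (n + 1)) (σ : Equiv.Perm (Fin (n + 1)))
    (x : O.Dec S) : Dec.coord (L.trans σ) x = O.act n σ (Dec.coord L x) := by
  obtain ⟨o, rfl⟩ := Dec.exists_mk L x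
  rw [Dec.coord_mk, ← Dec.mk_act L σ o, Dec.coord_mk]

theorem Dec.exists_labelling {S : Type} [Finite S] [Nonempty S] (x : O.Dec S) :
    ∃ (n : ℕ) (L : S ≃ Fin (n + 1)) (o : O.obj n), Dec.mk L o = x := by
  obtain ⟨n, hn⟩ := Nat.exists_eq_add_of_le' (Nat.card_pos (α := S))
  exact ⟨n, Finite.equivFinOfCardEq hn, Dec.exists_mk _ x⟩

theorem Dec.map_map {S T U : Type} [Finite S] [Nonempty S] (e : S ≃ T) (f : T ≃ U) (x : O.Dec S) :
    Dec.map f (Dec.map e x) = Dec.map (e.trans f) x := by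
  obtain ⟨n, L, o, rfl⟩ := Dec.exists_labelling x
  rw [Dec.map_mk, Dec.map_mk, Dec.map_mk]
  rfl

theorem Dec.map_refl {S : Type} [Finite S] [Nonempty S] (x : O.Dec S) :
    Dec.map (Equiv.refl S) x = x := by
  obtain ⟨n, L, o, rfl⟩ := Dec.exists_labelling x
  rw [Dec.map_mk]
  rfl

section graft

variable {S T U : Type} {s : S} {t : T}

theorem exists_result {m n p : ℕ} (h : m + n = p + 1) (L : S ≃ Fin (m + 1)) (M : T ≃ Fin (n + 1))
    (i : Fin m) (hi : L s = i.succ) (ht : M t = 0)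
    (e : {x : S // x ≠ s} ⊕ {y : T // y ≠ t} ≃ U) :
    ∃ R : U ≃ Fin (p + 1), (∀ x, R (e (Sum.inl x)) = outerLabel h i (L x)) ∧
      ∀ y, R (e (Sum.inr y)) = innerLabel h i (M y) :=
  ⟨e.symm.trans (GraftLabelling.result ⟨m, n, p, h, L, M, i, hi, ht⟩),
    fun _ => congrArg (GraftLabelling.result ⟨m, n, p, h, L, M, i, hi, ht⟩) (e.symm_apply_apply _),
    fun _ => congrArg (GraftLabelling.result ⟨m, n, p, h, L, M, i, hi, ht⟩) (e.symm_apply_apply _)⟩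

variable [Finite S] [Finite T]

/-- The grafting can be computed in any labelling. -/
theorem graft_mk (hS : 2 ≤ Nat.card S) (e : {x : S // x ≠ s} ⊕ {y : T // y ≠ t} ≃ U)
    {m n p : ℕ} (h : m + n = p + 1) (L : S ≃ Fin (m + 1)) (M : T ≃ Fin (n + 1))
    (i : Fin m) (hi : L s = i.succ) (ht : M t = 0) (R : U ≃ Fin (p + 1))
    (hl : ∀ x, R (e (Sum.inl x)) = outerLabel h i (L x))
    (hr : ∀ y, R (e (Sum.inr y)) = innerLabel h i (M y)) (a : O.obj m) (b : O.obj n) :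
    graft s t hS e (Dec.mk L a) (Dec.mk M b) = Dec.mk R (O.comp h i a b) := by
  -- The labelling chosen in the definition of `graft` is only known to exist. It is given names
  -- here, so that its arities can be identified with the given ones by substitution.
  obtain ⟨m', n', p', h', L', M', i', hi', ht', hG⟩ : ∃ (m' n' p' : ℕ) (h' : m' + n' = p' + 1)
      (L' : S ≃ Fin (m' + 1)) (M' : T ≃ Fin (n' + 1)) (i' : Fin m') (hi' : L' s = i'.succ)
      (ht' : M' t = 0), graft s t hS e (Dec.mk L a) (Dec.mk M b) = Dec.mk
        (e.symm.trans (GraftLabelling.result ⟨m', n', p', h', L', M', i', hi', ht'⟩))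
        (O.comp h' i' (Dec.coord L' (Dec.mk L a)) (Dec.coord M' (Dec.mk M b))) :=
    let G : GraftLabelling s t := Classical.choice (GraftLabelling.nonempty s t hS)
    ⟨G.m, G.n, G.p, G.h, G.L, G.M, G.i, G.hi, G.ht, rfl⟩
  rw [hG]
  obtain rfl : m = m' := by simpa using Fintype.card_congr (L.symm.trans L')
  obtain rfl : n = n' := by simpa using Fintype.card_congr (M.symm.trans M')
  obtain rfl : p = p' := by omega
  obtain ⟨R', hl', hr', hR'⟩ : ∃ R' : U ≃ Fin (p + 1),
      (∀ x, R' (e (Sum.inl x)) = outerLabel h i' (L' x)) ∧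
      (∀ y, R' (e (Sum.inr y)) = innerLabel h i' (M' y)) ∧
      R' = e.symm.trans (GraftLabelling.result ⟨m, n, p, h', L', M', i', hi', ht'⟩) :=
    ⟨_, fun x => congrArg (GraftLabelling.result ⟨m, n, p, h', L', M', i', hi', ht'⟩)
      (e.symm_apply_apply _), fun x => congrArg
      (GraftLabelling.result ⟨m, n, p, h', L', M', i', hi', ht'⟩) (e.symm_apply_apply _), rfl⟩
  rw [← hR']
  -- The changes of labelling on the two factors send the grafted leaf to the grafted leaf and fix
  -- the root of the upper tree, which is the case of equivariance covered by this axiom.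
  have key := O.comp_equivariant h i' i (L'.symm.trans L) (M'.symm.trans M) (R'.symm.trans R)
    (by rw [← hi']; simp [hi]) (by simp [M'.symm_apply_eq.2 ht'.symm, ht])
    (fun z hz => by
      have hz' : L'.symm z ≠ s := fun e => hz (by rw [← hi', ← e, Equiv.apply_symm_apply])
      have h1 : outerLabel h i' z = R' (e (Sum.inl ⟨L'.symm z, hz'⟩)) := by rw [hl']; simp
      rw [h1, Equiv.trans_apply, Equiv.symm_apply_apply, hl]
      rfl)
    (fun z hz => by
      have hz' : M'.symm z ≠ t := fun e => hz (by rw [← ht', ← e, Equiv.apply_symm_apply])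
      have h1 : innerLabel h i' z = R' (e (Sum.inr ⟨M'.symm z, hz'⟩)) := by rw [hr']; simp
      rw [h1, Equiv.trans_apply, Equiv.symm_apply_apply, hr]
      rfl)
    (Dec.coord L' (Dec.mk L a)) (Dec.coord M' (Dec.mk M b))
  rw [← Dec.coord_trans, ← Dec.coord_trans, ← Equiv.trans_assoc, ← Equiv.trans_assoc,
    Equiv.self_trans_symm, Equiv.self_trans_symm, Equiv.refl_trans, Equiv.refl_trans,
    Dec.coord_mk, Dec.coord_mk] at key
  rw [key, ← Dec.mk_act R' (R'.symm.trans R)]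
  congr 2
  ext z
  simp

theorem exists_labels (hS : 2 ≤ Nat.card S) (s : S) (t : T) (x : O.Dec S) (y : O.Dec T) :
    ∃ (m n p : ℕ) (_ : m + n = p + 1) (L : S ≃ Fin (m + 1)) (M : T ≃ Fin (n + 1)) (i : Fin m)
      (a : O.obj m) (b : O.obj n),
      L s = i.succ ∧ M t = 0 ∧ Dec.mk L a = x ∧ Dec.mk M b = y := by
  obtain ⟨⟨m, n, p, h, L, M, i, hi, ht⟩⟩ := GraftLabelling.nonempty s t hS
  exact ⟨m, n, p, h, L, M, i, _, _, hi, ht, Dec.mk_coord L x, Dec.mk_coord M y⟩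

theorem graft_add_left (hS : 2 ≤ Nat.card S) (e : {x : S // x ≠ s} ⊕ {y : T // y ≠ t} ≃ U)
    (x x' : O.Dec S) (y : O.Dec T) :
    graft s t hS e (x + x') y = graft s t hS e x y + graft s t hS e x' y := by
  simp [graft]

theorem graft_add_right (hS : 2 ≤ Nat.card S) (e : {x : S // x ≠ s} ⊕ {y : T // y ≠ t} ≃ U)
    (x : O.Dec S) (y y' : O.Dec T) :
    graft s t hS e x (y + y') = graft s t hS e x y + graft s t hS e x y' := by
  simp [graft]

theorem graft_smul_left (hS : 2 ≤ Nat.card S) (e : {x : S // x ≠ s} ⊕ {y : T // y ≠ t} ≃ U)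
    (c : k) (x : O.Dec S) (y : O.Dec T) :
    graft s t hS e (c • x) y = c • graft s t hS e x y := by
  simp [graft]

theorem graft_smul_right (hS : 2 ≤ Nat.card S) (e : {x : S // x ≠ s} ⊕ {y : T // y ≠ t} ≃ U)
    (c : k) (x : O.Dec S) (y : O.Dec T) :
    graft s t hS e x (c • y) = c • graft s t hS e x y := by
  simp [graft]

/-- Naturality of grafting. -/
theorem graft_map {S' T' U' : Type} [Finite S'] [Finite T'] {s' : S'} {t' : T'}
    (f : S ≃ S') (g : T ≃ T') (h : U ≃ U') (hs : f s = s') (ht : g t = t')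
    (hS : 2 ≤ Nat.card S) (hS' : 2 ≤ Nat.card S')
    (e : {x : S // x ≠ s} ⊕ {y : T // y ≠ t} ≃ U)
    (e' : {x : S' // x ≠ s'} ⊕ {y : T' // y ≠ t'} ≃ U')
    (hl : ∀ x hx hx', e' (Sum.inl ⟨f x, hx'⟩) = h (e (Sum.inl ⟨x, hx⟩)))
    (hr : ∀ y hy hy', e' (Sum.inr ⟨g y, hy'⟩) = h (e (Sum.inr ⟨y, hy⟩)))
    (x : O.Dec S) (y : O.Dec T) :
    graft s' t' hS' e' (Dec.map f x) (Dec.map g y) = Dec.map h (graft s t hS e x y) := by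
  obtain ⟨m, n, p, H, L, M, i, a, b, hi, hM, rfl, rfl⟩ := exists_labels hS s t x y
  obtain ⟨R, h1, h2⟩ := exists_result H L M i hi hM e
  rw [graft_mk hS e H L M i hi hM R h1 h2, Dec.map_mk, Dec.map_mk, Dec.map_mk]
  subst hs ht
  refine graft_mk hS' e' H _ _ i (by simpa using hi) (by simpa using hM) _ ?_ ?_ a b
  · rintro ⟨z, hz⟩
    obtain ⟨z, rfl⟩ := f.surjective z
    rw [hl z (by simpa using hz)]
    simp [h1]
  · rintro ⟨z, hz⟩
    obtain ⟨z, rfl⟩ := g.surjective z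
    rw [hr z (by simpa using hz)]
    simp [h2]

/-- Grafting does not depend on the direction of the grafted edge. -/
theorem graft_comm (hS : 2 ≤ Nat.card S) (hT : 2 ≤ Nat.card T)
    (e : {x : S // x ≠ s} ⊕ {y : T // y ≠ t} ≃ U) (e' : {y : T // y ≠ t} ⊕ {x : S // x ≠ s} ≃ U)
    (hl : ∀ x, e' (Sum.inr x) = e (Sum.inl x)) (hr : ∀ y, e' (Sum.inl y) = e (Sum.inr y))
    (x : O.Dec S) (y : O.Dec T) : graft t s hT e' y x = graft s t hS e x y := by
  obtain ⟨m, n, p, h, L, M, i, a, b, hi, hM, rfl, rfl⟩ := exists_labels hS s t x y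
  obtain ⟨R, h1, h2⟩ := exists_result h L M i hi hM e
  rw [graft_mk hS e h L M i hi hM R h1 h2]
  -- A second pair of labellings, with the roles of the two ends exchanged: now `s` is the root and
  -- `t` is a leaf.
  obtain ⟨n', m', p', h', M', L', j, b', a', hj, hL, hb, ha⟩ :=
    exists_labels hT t s (Dec.mk M b) (Dec.mk L a)
  obtain rfl : m = m' := by simpa using Fintype.card_congr (L.symm.trans L')
  obtain rfl : n = n' := by simpa using Fintype.card_congr (M.symm.trans M')
  obtain rfl : p = p' := by omega
  obtain ⟨R', h1', h2'⟩ := exists_result h' M' L' j hj hL e'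
  rw [← ha, ← hb, graft_mk hT e' h' M' L' j hj hL R' h1' h2']
  -- The change of labelling takes the leaf `s` to the root and the root `t` to a leaf, as the
  -- second equivariance axiom requires.
  have key := O.comp_swap h h' i j (L.symm.trans L') (M.symm.trans M') (R.symm.trans R')
    (by rw [← hi]; simp [hL]) (by rw [← hM]; simp [hj])
    (fun z hz => by
      have hz' : L.symm z ≠ s := fun e => hz (by rw [← hi, ← e, Equiv.apply_symm_apply])
      have h3 : outerLabel h i z = R (e (Sum.inl ⟨L.symm z, hz'⟩)) := by rw [h1]; simp
      rw [h3, Equiv.trans_apply, Equiv.symm_apply_apply, ← hl, h2']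
      rfl)
    (fun z hz => by
      have hz' : M.symm z ≠ t := fun e => hz (by rw [← hM, ← e, Equiv.apply_symm_apply])
      have h3 : innerLabel h i z = R (e (Sum.inr ⟨M.symm z, hz'⟩)) := by rw [h2]; simp
      rw [h3, Equiv.trans_apply, Equiv.symm_apply_apply, ← hr, h1']
      rfl)
    (Dec.coord L (Dec.mk L a)) (Dec.coord M (Dec.mk M b))
  rw [← Dec.coord_trans, ← Dec.coord_trans, ← Equiv.trans_assoc, ← Equiv.trans_assoc,
    Equiv.self_trans_symm, Equiv.self_trans_symm, Equiv.refl_trans, Equiv.refl_trans,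
    Dec.coord_mk, Dec.coord_mk, ← ha, ← hb, Dec.coord_mk, Dec.coord_mk] at key
  rw [key, ← Dec.mk_act R (R.symm.trans R')]
  congr 2
  ext z
  simp

/-- Sequential associativity of grafting. -/
theorem graft_assoc {A B C W : Type} [Finite A] [Finite C] [Finite W] {u : T} {w : W}
    {u' : A} {t' : C}
    (hS : 2 ≤ Nat.card S) (hT : 2 ≤ Nat.card T) (hA : 2 ≤ Nat.card A) (htu : t ≠ u)
    (e₁ : {x : S // x ≠ s} ⊕ {y : T // y ≠ t} ≃ A) (e₂ : {x : A // x ≠ u'} ⊕ {y : W // y ≠ w} ≃ B)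
    (e₃ : {x : T // x ≠ u} ⊕ {y : W // y ≠ w} ≃ C) (e₄ : {x : S // x ≠ s} ⊕ {y : C // y ≠ t'} ≃ B)
    (hu : e₁ (Sum.inr ⟨u, htu.symm⟩) = u') (ht : e₃ (Sum.inl ⟨t, htu⟩) = t')
    (h₁ : ∀ x hx, e₂ (Sum.inl ⟨e₁ (Sum.inl x), hx⟩) = e₄ (Sum.inl x))
    (h₂ : ∀ y hy hy' h3 h4, e₂ (Sum.inl ⟨e₁ (Sum.inr ⟨y, hy⟩), h3⟩) =
      e₄ (Sum.inr ⟨e₃ (Sum.inl ⟨y, hy'⟩), h4⟩))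
    (h₃ : ∀ z hz, e₂ (Sum.inr z) = e₄ (Sum.inr ⟨e₃ (Sum.inr z), hz⟩))
    (x : O.Dec S) (y : O.Dec T) (z : O.Dec W) :
    graft u' w hA e₂ (graft s t hS e₁ x y) z = graft s t' hS e₄ x (graft u w hT e₃ y z) := by
  obtain ⟨m, n, p, h, L, M, i, a, b, hi, hM, rfl, rfl⟩ := exists_labels hS s t x y
  -- Only the labelling `N` of `W`, with root `w`, is new. On `T` the labelling `M` with root `t`
  -- must be kept, and `u ≠ t` makes `u` one of its leaves.
  obtain ⟨-, l, -, -, -, N, -, -, c, -, hN, -, rfl⟩ := exists_labels hT u w (Dec.mk M b) z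
  obtain ⟨j, hj⟩ : ∃ j : Fin n, M u = j.succ := by
    rw [Nat.card_congr M, Nat.card_eq_fintype_card, Fintype.card_fin] at hT
    obtain ⟨n, rfl⟩ := Nat.exists_eq_add_of_le' (show 1 ≤ n by omega)
    obtain ⟨j, hj⟩ := Fin.exists_succ_eq.2 (fun e => htu (M.injective (by rw [hM, e])) : M u ≠ 0)
    exact ⟨j, hj.symm⟩
  have hj' := j.2
  have hi' := i.2
  -- The truncated subtractions are genuine, because the leaves `j : Fin n` and `i : Fin m` force
  -- `n` and `m` to be positive.
  obtain ⟨q, hq⟩ : ∃ q, n + l = q + 1 := ⟨n + l - 1, by omega⟩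
  obtain ⟨r, hr⟩ : ∃ r, m + q = r + 1 := ⟨m + q - 1, by omega⟩
  have hpl : p + l = r + 1 := by omega
  obtain ⟨R₁, hl₁, hr₁⟩ := exists_result h L M i hi hM e₁
  obtain ⟨R₃, hl₃, hr₃⟩ := exists_result hq M N j hj hN e₃
  -- The leaf `j` of the second tree becomes the leaf `i + j` of the composite, as in the axiom of
  -- sequential associativity.
  have hu' : R₁ u' = (⟨i + j, by omega⟩ : Fin p).succ := by
    rw [← hu, hr₁]
    refine Fin.ext ?_
    simp only [hj, innerLabel, Fin.val_succ]
    omega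
  have ht' : R₃ t' = 0 := by
    rw [← ht, hl₃]
    refine Fin.ext ?_
    simp [hM, outerLabel]
  obtain ⟨R₂, hl₂, hr₂⟩ := exists_result hpl R₁ N _ hu' hN e₂
  obtain ⟨R₄, hl₄, hr₄⟩ := exists_result hr L R₃ i hi ht' e₄
  rw [graft_mk hS e₁ h L M i hi hM R₁ hl₁ hr₁, graft_mk hT e₃ hq M N j hj hN R₃ hl₃ hr₃,
    graft_mk hA e₂ hpl R₁ N _ hu' hN R₂ hl₂ hr₂, graft_mk hS e₄ hr L R₃ i hi ht' R₄ hl₄ hr₄,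
    O.comp_assoc h hpl hq hr i j _ _ _ _ rfl]
  congr 1
  congr 1
  -- The two final labellings are compared on the remaining elements of `S`, of `T` and of `W`
  -- separately.
  refine Equiv.ext fun v => ?_
  obtain ⟨v, rfl⟩ := e₂.surjective v
  rcases v with ⟨v, hv⟩ | v
  · obtain ⟨v, rfl⟩ := e₁.surjective v
    rcases v with v | ⟨v, hv'⟩
    · rw [hl₂, h₁, hl₄]
      dsimp only
      rw [hl₁]
      refine Fin.ext ?_
      simp only [outerLabel]
      have h5 : (L v : ℕ) ≠ i + 1 := fun e =>
        v.2 (L.injective (Fin.ext (by rw [hi, e, Fin.val_succ])))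
      split_ifs <;> omega
    · have h5 : v ≠ u := by
        rintro rfl
        exact hv hu
      have h6 : e₃ (Sum.inl ⟨v, h5⟩) ≠ t' := fun e => hv' (by
        rw [← ht, e₃.apply_eq_iff_eq] at e
        simpa using e)
      rw [hl₂, h₂ v hv' h5 hv h6, hr₄]
      dsimp only
      rw [hr₁, hl₃]
      refine Fin.ext ?_
      simp only [outerLabel, innerLabel]
      have h7 : (M v : ℕ) ≠ j + 1 := fun e =>
        h5 (M.injective (Fin.ext (by rw [hj, e, Fin.val_succ])))
      have h8 : (M v : ℕ) ≠ 0 := fun e => hv' (M.injective (Fin.ext (by rw [hM, e]; rfl)))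
      rcases le_or_gt (M v : ℕ) j with h9 | h9
      · rw [if_pos h9]
        exact if_pos (by omega)
      · rw [if_neg (by omega)]
        exact (if_neg (by omega)).trans (by omega)
  · have h5 : e₃ (Sum.inr v) ≠ t' := fun e => by
      rw [← ht, e₃.apply_eq_iff_eq] at e
      simp at e
    rw [hr₂, h₃ v h5, hr₄]
    dsimp only
    rw [hr₃]
    refine Fin.ext ?_
    simp only [innerLabel]
    omega

end graft

end CyclicOperad

/-! ### Signs of bijections of ordered sets -/

section OrderSigns

variable {V W : Type*} [LinearOrder V] [LinearOrder W]

/-- The sign of moving `b` in front of `a`, if `a < b`. -/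
def ltSign (a b : V) : ℤ := if a < b then -1 else 1

theorem ltSign_mul_self (a b : V) : ltSign a b * ltSign a b = 1 := by
  unfold ltSign; split_ifs <;> rfl

theorem ltSign_self (a : V) : ltSign a a = 1 := if_neg (lt_irrefl a)

theorem ltSign_swap {a b : V} (h : a ≠ b) : ltSign b a = -ltSign a b := by
  unfold ltSign
  rcases lt_or_gt_of_ne h with h | h <;> simp [h, h.not_gt]

/-- The sign of moving `a` to the first place. -/
def firstSign [Fintype V] (a : V) : ℤ := ∏ v, ltSign v a

theorem firstSign_mul_self [Fintype V] (a : V) : firstSign a * firstSign a = 1 := by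
  simp [firstSign, ← Finset.prod_mul_distrib, ltSign_mul_self]

/-- `-1` if the pair `(x, y)` is inverted by `p`. -/
def invSign (p : V → W) (x y : V) : ℤ := if x < y ∧ p y < p x then -1 else 1

theorem invSign_mul_self (p : V → W) (x y : V) : invSign p x y * invSign p x y = 1 := by
  unfold invSign; split_ifs <;> rfl

theorem invSign_self (p : V → W) (x : V) : invSign p x x = 1 := by simp [invSign]

/-- Both sides are `-1` exactly when `p` changes the relative order of the pair. On the right,
`invSign` sees the inversion in just one of the two orders of its arguments. -/
theorem ltSign_mul_ltSign {p : V → W} (hp : p.Injective) (x y : V) :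
    ltSign x y * ltSign (p x) (p y) = invSign p x y * invSign p y x := by
  unfold ltSign invSign
  rcases lt_trichotomy x y with h | rfl | h
  · rcases lt_or_gt_of_ne (hp.ne h.ne) with h' | h' <;> simp [h, h', h.not_gt, h'.not_gt]
  · simp
  · rcases lt_or_gt_of_ne (hp.ne h.ne) with h' | h' <;> simp [h, h', h.not_gt, h'.not_gt]

/-- The sign of a bijection of ordered sets. -/
def orderSign [Fintype V] (p : V → W) : ℤ := ∏ x, ∏ y, invSign p x y

theorem orderSign_of_strictMono [Fintype V] {p : V → W} (hp : StrictMono p) : orderSign p = 1 := by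
  refine Finset.prod_eq_one fun x _ => Finset.prod_eq_one fun y _ => if_neg ?_
  rintro ⟨h1, h2⟩
  exact (hp h1).not_gt h2

theorem neg_one_pow_card_filter {ι : Type*} [Fintype ι] (p : ι → Prop) [DecidablePred p] :
    (-1 : ℤ) ^ (Finset.univ.filter p).card = ∏ x, if p x then -1 else 1 := by
  rw [← Finset.prod_filter, Finset.prod_const]

theorem Fintype.prod_withBot {R M : Type*} [CommMonoid M] [Fintype R] [inst : Fintype (WithBot R)]
    (g : WithBot R → M) : ∏ v, g v = g ⊥ * ∏ r : R, g r := by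
  obtain rfl : inst = inferInstanceAs (Fintype (Option R)) := Subsingleton.elim _ _
  exact Fintype.prod_option _

theorem prod_eq_mul_mul_prod_subtype {M : Type*} [CommMonoid M] {V : Type*} [DecidableEq V]
    [Fintype V] {a b : V} (hab : a ≠ b)
    (g : V → M) : ∏ v, g v = g a * g b * ∏ r : {v // v ≠ a ∧ v ≠ b}, g r := by
  rw [← Finset.prod_subtype (Finset.univ.filter fun v => v ≠ a ∧ v ≠ b) (by simp) g,
    ← Finset.prod_pair hab, ← Finset.prod_sdiff (Finset.subset_univ {a, b}), mul_comm]
  congr 1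
  refine Finset.prod_congr ?_ fun _ _ => rfl
  ext v
  simp

/-- The signs of moving `a` and `b` to the first two places are compatible with bijections. -/
theorem orderSign_rest [Fintype V] [Fintype W] (p : V ≃ W) {a b : V} (hab : a ≠ b) :
    firstSign a * firstSign b * ltSign a b * orderSign (fun r : {v // v ≠ a ∧ v ≠ b} => p r) =
      orderSign p * (firstSign (p a) * firstSign (p b) * ltSign (p a) (p b)) := by
  -- The signs of moving `c` and `p c` to the front differ by the number of inversions which involve
  -- `c`.
  have hf : ∀ c, firstSign c * firstSign (p c) = ∏ v, invSign p v c * invSign p c v := fun c => by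
    rw [firstSign, firstSign, ← p.prod_comp, ← Finset.prod_mul_distrib]
    exact Finset.prod_congr rfl fun v _ => ltSign_mul_ltSign p.injective v c
  have ha := hf a
  have hb := hf b
  have hl := ltSign_mul_ltSign p.injective a b
  have hr : orderSign (fun r : {v // v ≠ a ∧ v ≠ b} => p r) =
    ∏ x : {v // v ≠ a ∧ v ≠ b}, ∏ y : {v // v ≠ a ∧ v ≠ b}, invSign p (x : V) y := rfl
  have hp : orderSign p = ∏ x, ∏ y, invSign p x y := rfl
  -- All products are split into the contributions of `a`, of `b` and of the other elements. What
  -- remains is an identity between signs, all of which square to one.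
  simp only [prod_eq_mul_mul_prod_subtype hab, Finset.prod_mul_distrib, invSign_self] at ha hb hp
  rw [← hr] at hp
  rw [hp]
  have s1 := invSign_mul_self p a b
  have s2 := invSign_mul_self p b a
  have t1 := firstSign_mul_self (p a)
  have t2 := firstSign_mul_self (p b)
  have t3 := ltSign_mul_self (p a) (p b)
  generalize invSign p a b = Fab at *
  generalize invSign p b a = Fba at *
  generalize orderSign (fun r : {v // v ≠ a ∧ v ≠ b} => p r) = R at *
  generalize ∏ x : {v // v ≠ a ∧ v ≠ b}, invSign p a x = A at *
  generalize ∏ x : {v // v ≠ a ∧ v ≠ b}, invSign p b x = B at *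
  generalize ∏ x : {v // v ≠ a ∧ v ≠ b}, invSign p x a = A' at *
  generalize ∏ x : {v // v ≠ a ∧ v ≠ b}, invSign p x b = B' at *
  calc _ = firstSign a * firstSign b * ltSign a b * R * (firstSign (p a) * firstSign (p a)) *
        (firstSign (p b) * firstSign (p b)) * (ltSign (p a) (p b) * ltSign (p a) (p b)) := by
        rw [t1, t2, t3]; ring
    _ = (firstSign a * firstSign (p a)) * (firstSign b * firstSign (p b)) *
        (ltSign a b * ltSign (p a) (p b)) * R *
        (firstSign (p a) * firstSign (p b) * ltSign (p a) (p b)) := by ring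
    _ = (Fab * Fab) * (Fba * Fba) * (Fab * A * (Fba * B) * (A' * B' * R)) *
        (firstSign (p a) * firstSign (p b) * ltSign (p a) (p b)) := by
        rw [ha, hb, hl]; ring
    _ = _ := by rw [s1, s2]; ring

/-- The least element is fixed, so it takes part in no inversion. -/
theorem orderSign_withBot {R S : Type*} [LinearOrder R] [LinearOrder S] [Fintype R]
    [Fintype (WithBot R)] {p : WithBot R → WithBot S} {q : R → S} (h0 : p ⊥ = ⊥)
    (h : ∀ r : R, p r = q r) : orderSign p = orderSign q := by
  rw [orderSign, Fintype.prod_withBot, orderSign]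
  have h1 : ∏ y, invSign p ⊥ y = 1 := Finset.prod_eq_one fun y _ => by simp [invSign, h0]
  rw [h1, one_mul]
  refine Finset.prod_congr rfl fun x _ => ?_
  rw [Fintype.prod_withBot]
  simp [invSign, h]

theorem orderSign_subtype {R : Type*} [LinearOrder R] [Fintype R] {P : W → Prop}
    (q : R → {w // P w}) : orderSign q = orderSign fun r => (q r : W) := rfl

theorem firstSign_bot {R : Type*} [LinearOrder R] [Fintype (WithBot R)] :
    firstSign (⊥ : WithBot R) = 1 :=
  Finset.prod_eq_one fun v _ => by simp [ltSign]

theorem ltSign_bot_coe {R : Type*} [LinearOrder R] (r : R) :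
    ltSign (⊥ : WithBot R) r = -1 := by simp [ltSign]

theorem ltSign_coe_bot {R : Type*} [LinearOrder R] (r : R) :
    ltSign (r : WithBot R) ⊥ = 1 := by simp [ltSign]

theorem ltSign_coe_coe {R : Type*} [LinearOrder R] (r s : R) :
    ltSign (r : WithBot R) s = ltSign r s := by simp [ltSign]

/-- In the contracted graph, `c` must pass the new first vertex, which gives the minus sign, but no
longer has to pass `a` and `b`. -/
theorem firstSign_coe [Fintype V] {a b : V} (hab : a ≠ b)
    [Fintype (WithBot {v // v ≠ a ∧ v ≠ b})] (c : {v // v ≠ a ∧ v ≠ b}) :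
    firstSign (c : WithBot {v // v ≠ a ∧ v ≠ b}) =
      -(firstSign (c : V) * ltSign a c * ltSign b c) := by
  rw [firstSign, Fintype.prod_withBot, firstSign, prod_eq_mul_mul_prod_subtype hab, ltSign_bot_coe]
  simp only [ltSign_coe_coe]
  have h1 := ltSign_mul_self a (c : V)
  have h2 := ltSign_mul_self b (c : V)
  have h3 : ∀ r : {v // v ≠ a ∧ v ≠ b}, ltSign r c = ltSign (r : V) c := fun r => rfl
  simp only [h3]
  generalize ∏ r : {v // v ≠ a ∧ v ≠ b}, ltSign (r : V) c = X
  calc _ = -((ltSign a (c : V) * ltSign a (c : V)) * (ltSign b (c : V) * ltSign b (c : V)) * X) := by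
        rw [h1, h2]; ring
    _ = _ := by ring

end OrderSigns

namespace LabelledGraph

universe u w

variable {k : Type u} [CommRing k] {O : CyclicOperad.{u, w} k}

/-- Moving `b` to the second place does not take it past `a`; the factor `ltSign a b` removes the
contribution of `a` to `firstSign b`. In this form the sign is visibly antisymmetric up to
`ltSign_swap`. -/
theorem frontSign_eq (Γ : LabelledGraph O) {a b : Γ.V} (hab : a ≠ b) :
    Γ.frontSign a b = firstSign a * firstSign b * ltSign a b := by
  rw [frontSign, neg_one_pow_card_filter, neg_one_pow_card_filter, mul_assoc]
  congr 1
  have h1 : ∀ v, (if v < b ∧ v ≠ a then -1 else 1 : ℤ) =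
      ltSign v b * if v = a then ltSign a b else 1 := fun v => by
    by_cases h : v = a
    · subst h
      simp [ltSign_mul_self]
    · simp [h, ltSign]
  simp only [h1, Finset.prod_mul_distrib]
  simp [firstSign]

theorem frontSign_swap (Γ : LabelledGraph O) {a b : Γ.V} (hab : a ≠ b) :
    Γ.frontSign b a = -Γ.frontSign a b := by
  rw [frontSign_eq Γ hab, frontSign_eq Γ hab.symm, ltSign_swap hab]
  ring

end LabelledGraph

theorem CyclicOperad.map_graft {k : Type*} [CommRing k] {O : CyclicOperad k} {S T U U' : Type}
    [Finite S] [Finite T] {s : S} {t : T} (hS : 2 ≤ Nat.card S)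
    (e : {x : S // x ≠ s} ⊕ {y : T // y ≠ t} ≃ U) (h : U ≃ U') (x : O.Dec S) (y : O.Dec T) :
    Dec.map h (graft s t hS e x y) = graft s t hS (e.trans h) x y := by
  dsimp only [graft]
  rw [Dec.map_mk]
  rfl

namespace LabelledGraph

universe u w

variable {k : Type u} [CommRing k] {O : CyclicOperad.{u, w} k}

/-! ### Isomorphisms of labelled graphs -/

instance nonempty_halves (Γ : LabelledGraph O) (v : Γ.V) : Nonempty {h : Γ.H // Γ.att h = v} := by
  have h := Γ.valence v
  exact (Nat.card_pos_iff.1 (by omega)).1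

theorem two_le_card (Γ : LabelledGraph O) (v : Γ.V) : 2 ≤ Nat.card {h : Γ.H // Γ.att h = v} :=
  (by norm_num : 2 ≤ 3).trans (Γ.valence v)

/-- As every vertex carries a half-edge, an isomorphism is determined by its effect on half-edges.
-/
theorem att_surjective (Γ : LabelledGraph O) (v : Γ.V) : ∃ h, Γ.att h = v :=
  let ⟨h⟩ := Γ.nonempty_halves v
  ⟨h.1, h.2⟩

theorem Iso.cls_eq {Γ Δ : LabelledGraph O} (f : Iso Γ Δ) : Γ.cls = f.sign • Δ.cls := by
  rw [cls, cls, ← map_zsmul, ← sub_eq_zero, ← map_sub]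
  exact (Submodule.Quotient.mk_eq_zero _).2
    (Submodule.subset_span (Or.inl (Or.inl ⟨Γ, Δ, f, rfl⟩)))

/-- The sign `1` or `-1` according to the direction of the edge of `h` in the orientation. -/
def dir (Γ : LabelledGraph O) (h : Γ.H) : ℤ := if Γ.out h = true then 1 else -1

theorem dir_inv (Γ : LabelledGraph O) (h : Γ.H) : Γ.dir (Γ.inv h) = -Γ.dir h := by
  unfold dir
  rw [Γ.out_inv]
  cases Γ.out h <;> simp

/-- `-1` if the edge of `h` is directed away from `h`, and `f` reverses this direction. -/
def edgeSign (Γ Δ : LabelledGraph O) (f : Γ.H → Δ.H) (h : Γ.H) : ℤ :=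
  if Γ.out h = true ∧ Δ.out (f h) = false then -1 else 1

theorem Iso.sign_eq {Γ Δ : LabelledGraph O} (f : Iso Γ Δ) :
    f.sign = orderSign f.vert * ∏ h, edgeSign Γ Δ f.half h := rfl

/-- Only the outgoing half-edge of an edge can contribute to the sign, so the product over both
half-edges compares the two directions of the edge. -/
theorem edgeSign_mul_inv {Γ Δ : LabelledGraph O} (f : Γ.H → Δ.H) (h : Γ.H)
    (hf : Δ.inv (f h) = f (Γ.inv h)) :
    edgeSign Γ Δ f h * edgeSign Γ Δ f (Γ.inv h) = Γ.dir h * Δ.dir (f h) := by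
  unfold edgeSign dir
  rw [← hf, Γ.out_inv, Δ.out_inv]
  cases Γ.out h <;> cases Δ.out (f h) <;> simp

/-- An isomorphism given by a bijection of half-edges and a compatible injection of vertices. -/
noncomputable def Iso.ofInjective {Γ Δ : LabelledGraph O} (half : Γ.H ≃ Δ.H) (vert : Γ.V → Δ.V)
    (hvert : vert.Injective) (att_half : ∀ h, Δ.att (half h) = vert (Γ.att h))
    (inv_half : ∀ h, Δ.inv (half h) = half (Γ.inv h))
    (hlab : ∀ v (e : {h // Γ.att h = v} ≃ {h // Δ.att h = vert v}), (∀ x, (e x : Δ.H) = half x) →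
      Δ.lab (vert v) = CyclicOperad.Dec.map e (Γ.lab v)) : Iso Γ Δ where
  vert := Equiv.ofBijective vert ⟨hvert, fun v => by
    obtain ⟨h, rfl⟩ := Δ.att_surjective v
    obtain ⟨h, rfl⟩ := half.surjective h
    exact ⟨_, (att_half h).symm⟩⟩
  half := half
  att_half := att_half
  inv_half := inv_half
  lab_vert v := hlab v _ fun _ => rfl

/-- The target vertex and the bijection of half-edges are arbitrary here, so that no transport along
an equality of vertices is needed in applications. -/
theorem Iso.lab_eq {Γ Δ : LabelledGraph O} (f : Iso Γ Δ) {v : Γ.V} {w : Δ.V} (hw : f.vert v = w)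
    (e : {h // Γ.att h = v} ≃ {h // Δ.att h = w}) (he : ∀ x, (e x : Δ.H) = f.half x) :
    Δ.lab w = CyclicOperad.Dec.map e (Γ.lab v) := by
  subst hw
  rw [f.lab_vert]
  congr 1
  congr 1
  ext x
  exact (he x).symm

/-- A criterion for a graph `Δ` to be isomorphic to the contraction of an edge of `Γ`. -/
theorem exists_iso_contract (Γ : LabelledGraph O) (t : Γ.H) (ht : Γ.att t ≠ Γ.att (Γ.inv t))
    (Δ : LabelledGraph O) (ι : Δ.H → Γ.H) (hι : ι.Injective)
    (hne : ∀ h, ι h ≠ t ∧ ι h ≠ Γ.inv t) (hsurj : ∀ h, h ≠ t → h ≠ Γ.inv t → ∃ h', ι h' = h)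
    (hinv : ∀ h, ι (Δ.inv h) = Γ.inv (ι h))
    (κ : Δ.V → Γ.ContractV t) (hκ : κ.Injective)
    (hatt : ∀ h, Γ.contractAtt t ⟨ι h, hne h⟩ = κ (Δ.att h))
    (hcoe : ∀ v (w : {v // v ≠ Γ.att t ∧ v ≠ Γ.att (Γ.inv t)}), κ v = (w : Γ.ContractV t) →
      ∀ e : {h // Γ.att h = w.1} ≃ {h // Δ.att h = v},
      (∀ x, ι (e x) = x) → Δ.lab v = CyclicOperad.Dec.map e (Γ.lab w))
    (hbot : ∀ v, κ v = ⊥ → ∀ e : {x : {h : Γ.H // Γ.att h = Γ.att t} // x ≠ ⟨t, rfl⟩} ⊕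
      {y : {h : Γ.H // Γ.att h = Γ.att (Γ.inv t)} // y ≠ ⟨Γ.inv t, rfl⟩} ≃ {h // Δ.att h = v},
      (∀ x, ι (e (Sum.inl x)) = x) → (∀ y, ι (e (Sum.inr y)) = y) →
      Δ.lab v = CyclicOperad.graft _ _ (Γ.two_le_card _) e
        (Γ.lab (Γ.att t)) (Γ.lab (Γ.att (Γ.inv t)))) :
    ∃ f : Iso Δ (Γ.contract t ht), (∀ v, f.vert v = κ v) ∧ ∀ h, (f.half h).1 = ι h := by
  have hlab : ∀ v z, κ v = z → ∀ e : {h // Δ.att h = v} ≃ {h // Γ.contractAtt t h = z},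
      (∀ x, ((e x).1.1 : Γ.H) = ι x) →
      (Γ.contract t ht).lab z = CyclicOperad.Dec.map e (Δ.lab v) := by
    intro v z hz e he
    have he' : ∀ x, ι (e.symm x) = x.1.1 := fun x => by rw [← he, Equiv.apply_symm_apply]
    cases z using WithBot.recBotCoe with
    | bot =>
      rw [hbot v hz ((Γ.contractBot t ht).trans e.symm) (fun x => he' _) (fun x => he' _),
        CyclicOperad.map_graft, Equiv.trans_assoc, Equiv.symm_trans_self, Equiv.trans_refl]
      rfl
    | coe w =>
      rw [hcoe v w hz ((Γ.contractCoe t w).trans e.symm) (fun x => he' _),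
        CyclicOperad.Dec.map_map, Equiv.trans_assoc, Equiv.symm_trans_self, Equiv.trans_refl]
      rfl
  let half : Δ.H ≃ Γ.ContractH t := Equiv.ofBijective (fun h => ⟨ι h, hne h⟩)
    ⟨fun h h' e => hι (congrArg Subtype.val e), fun h =>
      let ⟨h', hh⟩ := hsurj h.1 h.2.1 h.2.2
      ⟨h', Subtype.ext hh⟩⟩
  exact ⟨Iso.ofInjective half κ hκ hatt (fun h => Subtype.ext (hinv h).symm)
    (fun v e he => hlab v _ rfl e fun x => congrArg Subtype.val (he x)), fun _ => rfl, fun _ => rfl⟩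

/-- The contraction of the edge of `h`, in the direction away from `h`, with the sign relating this
direction to the orientation. -/
noncomputable def signedContraction (Γ : LabelledGraph O) (h : Γ.H) : GraphComplex O :=
  Γ.dir h • Γ.contractCls h

theorem contractCls_of_loop {Γ : LabelledGraph O} {t : Γ.H} (ht : Γ.att t = Γ.att (Γ.inv t)) :
    Γ.contractCls t = 0 := dif_neg (not_not.2 ht)

theorem contractCls_of_ne {Γ : LabelledGraph O} {t : Γ.H} (ht : Γ.att t ≠ Γ.att (Γ.inv t)) :
    Γ.contractCls t =
      Γ.frontSign (Γ.att t) (Γ.att (Γ.inv t)) • (Γ.contract t ht).cls := dif_pos ht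

theorem contract_edgeSign {Γ Δ : LabelledGraph O} (f : Γ.H → Δ.H) (t : Γ.H)
    (hf : Δ.inv (f t) = f (Γ.inv t)) :
    ∏ h, edgeSign Γ Δ f h =
      Γ.dir t * Δ.dir (f t) * ∏ h : Γ.ContractH t, edgeSign Γ Δ f h := by
  rw [prod_eq_mul_mul_prod_subtype (Γ.inv_ne t).symm, edgeSign_mul_inv f t hf]

theorem dir_mul_self (Γ : LabelledGraph O) (h : Γ.H) : Γ.dir h * Γ.dir h = 1 := by
  unfold dir; split_ifs <;> rfl

/-- The action of an isomorphism on the vertices which are not endpoints of an edge. -/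
def Iso.contractRest {Γ Δ : LabelledGraph O} (f : Iso Γ Δ) (t : Γ.H) :
    {v // v ≠ Γ.att t ∧ v ≠ Γ.att (Γ.inv t)} →
      {v // v ≠ Δ.att (f.half t) ∧ v ≠ Δ.att (Δ.inv (f.half t))} :=
  fun v => ⟨f.vert v, by
    rw [f.att_half, f.inv_half, f.att_half, f.vert.injective.ne_iff, f.vert.injective.ne_iff]
    exact v.2⟩

/-- The action of an isomorphism on the vertices after the contraction of an edge. -/
def Iso.contractVert {Γ Δ : LabelledGraph O} (f : Iso Γ Δ) (t : Γ.H) :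
    Γ.ContractV t → Δ.ContractV (f.half t) :=
  WithBot.map (f.contractRest t)

theorem Iso.exists_contract {Γ Δ : LabelledGraph O} (f : Iso Γ Δ) (t : Γ.H)
    (ht : Γ.att t ≠ Γ.att (Γ.inv t)) (ht' : Δ.att (f.half t) ≠ Δ.att (Δ.inv (f.half t))) :
    ∃ g : Iso (Γ.contract t ht) (Δ.contract (f.half t) ht'),
      (∀ v, g.vert v = f.contractVert t v) ∧ ∀ h, (g.half h).1 = f.half h.1 := by
  refine exists_iso_contract Δ (f.half t) ht' (Γ.contract t ht) (fun h => f.half h.1)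
    (f.half.injective.comp Subtype.val_injective)
    (fun h => by
      rw [f.inv_half, f.half.injective.ne_iff, f.half.injective.ne_iff]
      exact h.2)
    (fun h h1 h2 => ?_) (fun h => (f.inv_half _).symm) (f.contractVert t) ?_ ?_ ?_ ?_
  · obtain ⟨h, rfl⟩ := f.half.surjective h
    rw [f.inv_half] at h2
    exact ⟨⟨h, f.half.injective.ne_iff.1 h1, f.half.injective.ne_iff.1 h2⟩, rfl⟩
  · exact WithBot.map_injective fun v w h =>
      Subtype.ext (f.vert.injective (congrArg Subtype.val h))
  · intro h
    change _ = f.contractVert t (Γ.contractAtt t h)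
    generalize hz : Γ.contractAtt t h = z
    cases z using WithBot.recBotCoe with
    | bot =>
      replace hz := (Γ.contractAtt_eq_bot t h).1 hz
      change _ = ⊥
      rw [contractAtt_eq_bot]
      simpa only [f.att_half, f.inv_half, f.vert.apply_eq_iff_eq] using hz
    | coe v =>
      replace hz := (Γ.contractAtt_eq_coe t h v).1 hz
      change _ = WithBot.some _
      rw [contractAtt_eq_coe]
      simp [f.att_half, hz, contractRest]
  · intro v w hw e he
    cases v using WithBot.recBotCoe with
    | bot => cases hw
    | coe v =>
      have hw' : (⟨f.vert v, _⟩ : {v // v ≠ Δ.att (f.half t) ∧ v ≠ Δ.att (Δ.inv (f.half t))}) = w :=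
        WithBot.coe_injective hw
      subst hw'
      rw [f.lab_vert, CyclicOperad.Dec.map_map]
      change CyclicOperad.Dec.map _ _ = _
      congr 1
      congr 1
      ext x
      have h1 := he (f.half.subtypeEquiv (fun h => by simp [att_half]) x)
      exact (f.half.injective h1).symm
  · intro v hv e hl hr
    cases v using WithBot.recBotCoe with
    | coe v => cases hv
    | bot =>
      have h1 : ∀ h, Γ.att h = Γ.att t ↔ Δ.att (f.half h) = Δ.att (f.half t) := by
        simp [f.att_half]
      have h2 : ∀ h, Γ.att h = Γ.att (Γ.inv t) ↔
          Δ.att (f.half h) = Δ.att (Δ.inv (f.half t)) := by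
        simp [f.att_half, f.inv_half]
      rw [f.lab_eq (f.att_half t).symm (f.half.subtypeEquiv h1) fun _ => rfl,
        f.lab_eq (v := Γ.att (Γ.inv t)) (by rw [f.inv_half, f.att_half])
          (f.half.subtypeEquiv h2) fun _ => rfl]
      have := (Γ.contract t ht).nonempty_halves (⊥ : Γ.ContractV t)
      have key := CyclicOperad.graft_map (O := O) (s := (⟨t, rfl⟩ : {h // Γ.att h = Γ.att t}))
        (t := (⟨Γ.inv t, rfl⟩ : {h // Γ.att h = Γ.att (Γ.inv t)}))
        (s' := (⟨f.half t, rfl⟩ : {h // Δ.att h = Δ.att (f.half t)}))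
        (t' := (⟨Δ.inv (f.half t), rfl⟩ : {h // Δ.att h = Δ.att (Δ.inv (f.half t))}))
        (f.half.subtypeEquiv h1) (f.half.subtypeEquiv h2) (Equiv.refl _) rfl
        (Subtype.ext (f.inv_half t).symm) (Γ.two_le_card _) (Δ.two_le_card _)
        (Γ.contractBot t ht) e (fun x hx hx' => Subtype.ext (Subtype.ext (f.half.injective (hl _))))
        (fun y hy hy' => Subtype.ext (Subtype.ext (f.half.injective (hr _))))
        (Γ.lab _) (Γ.lab _)
      exact (CyclicOperad.Dec.map_refl ((Γ.contract t ht).lab (⊥ : Γ.ContractV t))).symm.trans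
        key.symm

theorem contract_loop_iff {Γ Δ : LabelledGraph O} (f : Iso Γ Δ) (t : Γ.H) :
    Δ.att (f.half t) ≠ Δ.att (Δ.inv (f.half t)) ↔ Γ.att t ≠ Γ.att (Γ.inv t) := by
  rw [f.inv_half, f.att_half, f.att_half, f.vert.injective.ne_iff]

/-- The sign of the induced isomorphism of contractions lacks two parts of `f.sign`: the inversions
involving an endpoint of the edge, and the direction of the edge itself. The first is the change of
`frontSign`, by `orderSign_rest`; the second is the change of `dir`. -/
theorem Iso.signedContraction_eq {Γ Δ : LabelledGraph O} (f : Iso Γ Δ) (t : Γ.H) :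
    Γ.signedContraction t = f.sign • Δ.signedContraction (f.half t) := by
  unfold signedContraction
  by_cases ht : Γ.att t = Γ.att (Γ.inv t)
  · rw [contractCls_of_loop ht, contractCls_of_loop, smul_zero, smul_zero, smul_zero]
    exact not_ne_iff.1 (mt (contract_loop_iff f t).1 (not_not.2 ht))
  have ht' := (contract_loop_iff f t).2 ht
  obtain ⟨g, hg, hg'⟩ := f.exists_contract t ht ht'
  rw [contractCls_of_ne ht, contractCls_of_ne ht', g.cls_eq, smul_smul, smul_smul, smul_smul,
    smul_smul]
  congr 1
  have h1 : Δ.frontSign (Δ.att (f.half t)) (Δ.att (Δ.inv (f.half t))) =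
      Δ.frontSign (f.vert (Γ.att t)) (f.vert (Γ.att (Γ.inv t))) := by
    rw [f.inv_half, f.att_half, f.att_half]
  have h2 : orderSign g.vert =
      orderSign fun r : {v // v ≠ Γ.att t ∧ v ≠ Γ.att (Γ.inv t)} => f.vert r := by
    refine (congrArg orderSign (funext hg : ⇑g.vert = f.contractVert t)).trans
      ((orderSign_withBot (q := f.contractRest t) rfl fun r => rfl).trans ?_)
    exact orderSign_subtype _
  have h3 : ∏ h, edgeSign _ _ g.half h = ∏ h : Γ.ContractH t, edgeSign Γ Δ f.half h :=
    Finset.prod_congr rfl fun h _ => by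
      unfold edgeSign
      change (if Γ.out h.1 = true ∧ Δ.out (g.half h).1 = false then _ else _) = _
      rw [hg']
  have h4 := contract_edgeSign (Γ := Γ) (Δ := Δ) f.half t (f.inv_half t)
  have h5 := orderSign_rest f.vert ht
  rw [← frontSign_eq Γ ht, ← frontSign_eq Δ (f.vert.injective.ne ht)] at h5
  rw [g.sign_eq, f.sign_eq, h1, h2, h3, h4]
  have h6 := Δ.dir_mul_self (f.half t)
  generalize ∏ h : Γ.ContractH t, edgeSign Γ Δ f.half h = E at *
  calc _ = Γ.dir t * (Γ.frontSign (Γ.att t) (Γ.att (Γ.inv t)) *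
        orderSign fun r : {v // v ≠ Γ.att t ∧ v ≠ Γ.att (Γ.inv t)} => f.vert r) * E := by ring
    _ = _ := by
      rw [h5]
      linear_combination (-(Γ.dir t * orderSign f.vert *
        Δ.frontSign (f.vert (Γ.att t)) (f.vert (Γ.att (Γ.inv t))) * E)) * h6

end LabelledGraph

/-- Grafting as a bilinear map. -/
noncomputable def CyclicOperad.graftₗ {k : Type*} [CommRing k] {O : CyclicOperad k} {S T U : Type}
    [Finite S] [Finite T] (s : S) (t : T) (hS : 2 ≤ Nat.card S)
    (e : {x : S // x ≠ s} ⊕ {y : T // y ≠ t} ≃ U) : O.Dec S →ₗ[k] O.Dec T →ₗ[k] O.Dec U :=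
  LinearMap.mk₂ k (graft s t hS e) (graft_add_left hS e) (graft_smul_left hS e)
    (graft_add_right hS e) (graft_smul_right hS e)

namespace LabelledGraph

universe u w

variable {k : Type u} [CommRing k] {O : CyclicOperad.{u, w} k}

/-- For vertices which are equal, but not definitionally, such as those of `t` and `inv (inv t)`. -/
theorem graft_lab_congr (Γ : LabelledGraph O) {U : Type} {v v' w w' : Γ.V}
    {s : {h // Γ.att h = v}} {s' : {h // Γ.att h = v'}} {t : {h // Γ.att h = w}}
    {t' : {h // Γ.att h = w'}} (hs : s.1 = s'.1) (ht : t.1 = t'.1)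
    (hv : 2 ≤ Nat.card {h // Γ.att h = v}) (hv' : 2 ≤ Nat.card {h // Γ.att h = v'})
    (e : {x // x ≠ s} ⊕ {y // y ≠ t} ≃ U) (e' : {x // x ≠ s'} ⊕ {y // y ≠ t'} ≃ U)
    (hl : ∀ x x', x.1.1 = x'.1.1 → e (Sum.inl x) = e' (Sum.inl x'))
    (hr : ∀ y y', y.1.1 = y'.1.1 → e (Sum.inr y) = e' (Sum.inr y')) :
    CyclicOperad.graft s t hv e (Γ.lab v) (Γ.lab w) =
      CyclicOperad.graft s' t' hv' e' (Γ.lab v') (Γ.lab w') := by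
  obtain ⟨s, rfl⟩ := s
  obtain ⟨s', rfl⟩ := s'
  obtain ⟨t, rfl⟩ := t
  obtain ⟨t', rfl⟩ := t'
  dsimp only at hs ht
  subst hs ht
  congr 1
  ext x
  rcases x with x | x
  · exact hl x x rfl
  · exact hr x x rfl

/-- The labels of the new vertices agree because grafting is symmetric. The sign is trivial because
in both contractions the new vertex is first and the others keep their order. -/
theorem exists_iso_contract_inv (Γ : LabelledGraph O) (t : Γ.H)
    (ht : Γ.att t ≠ Γ.att (Γ.inv t)) (ht' : Γ.att (Γ.inv t) ≠ Γ.att (Γ.inv (Γ.inv t))) :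
    ∃ g : Iso (Γ.contract (Γ.inv t) ht') (Γ.contract t ht), g.sign = 1 ∧
      ∀ h, (g.half h).1 = h.1 := by
  let κ₀ : {v // v ≠ Γ.att (Γ.inv t) ∧ v ≠ Γ.att (Γ.inv (Γ.inv t))} →
      {v // v ≠ Γ.att t ∧ v ≠ Γ.att (Γ.inv t)} := fun v =>
    ⟨v, fun e => v.2.2 (e.trans (congrArg Γ.att (Γ.inv_inv t).symm)), v.2.1⟩
  obtain ⟨g, hg, hg'⟩ := exists_iso_contract Γ t ht (Γ.contract (Γ.inv t) ht') (fun h => h.1)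
    Subtype.val_injective (fun h => ⟨fun e => h.2.2 (e.trans (Γ.inv_inv t).symm), h.2.1⟩)
      (fun h h1 h2 => ⟨⟨h, h2, by rwa [Γ.inv_inv]⟩, rfl⟩) (fun h => rfl)
    (WithBot.map κ₀) (WithBot.map_injective fun v w h => Subtype.ext (congrArg (fun v => v.1) h :))
    (fun h => by
      change _ = WithBot.map κ₀ (Γ.contractAtt (Γ.inv t) h)
      generalize hz : Γ.contractAtt (Γ.inv t) h = z
      cases z using WithBot.recBotCoe with
      | bot =>
        replace hz := (Γ.contractAtt_eq_bot (Γ.inv t) h).1 hz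
        exact (Γ.contractAtt_eq_bot t _).2
          (hz.symm.imp_left fun h => h.trans (congrArg Γ.att (Γ.inv_inv t)))
      | coe v =>
        replace hz := (Γ.contractAtt_eq_coe (Γ.inv t) h v).1 hz
        exact (Γ.contractAtt_eq_coe t _ _).2 hz)
    (fun v w hw e he => by
      cases v using WithBot.recBotCoe with
      | bot => cases hw
      | coe v =>
        have hw' : κ₀ v = w := WithBot.coe_injective hw
        subst hw'
        change CyclicOperad.Dec.map (Γ.contractCoe (Γ.inv t) v) (Γ.lab v) = _
        congr 1
        congr 1
        ext x
        exact (he x).symm)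
    (fun v hv e hl hr => by
      cases v using WithBot.recBotCoe with
      | coe v => cases hv
      | bot =>
        rw [← CyclicOperad.graft_comm (Γ.two_le_card _) (Γ.two_le_card _) e
          ((Equiv.sumComm _ _).trans e) (fun _ => rfl) (fun _ => rfl)]
        refine graft_lab_congr Γ rfl (Γ.inv_inv t) (Γ.two_le_card _) _ (Γ.contractBot (Γ.inv t) ht')
          ((Equiv.sumComm _ _).trans e) (fun x x' hx => ?_) (fun x x' hx => ?_)
        · exact Subtype.ext (Subtype.ext (hx.trans (hr x').symm))
        · exact Subtype.ext (Subtype.ext (hx.trans (hl x').symm)))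
  refine ⟨g, ?_, hg'⟩
  have h2 : orderSign g.vert = 1 :=
    (congrArg orderSign (funext hg : ⇑g.vert = WithBot.map κ₀)).trans
      (orderSign_of_strictMono (WithBot.strictMono_map_iff.2 fun v w h => h))
  have h3 : ∀ h, edgeSign _ _ g.half h = 1 := fun h => by
    unfold edgeSign
    change (if Γ.out h.1 = true ∧ Γ.out (g.half h).1 = false then _ else _) = _
    rw [hg']
    simp
  rw [g.sign_eq, h2, Finset.prod_eq_one fun h _ => h3 h, one_mul]

/-- The signed contraction of an edge does not depend on its direction. -/
theorem signedContraction_inv (Γ : LabelledGraph O) (t : Γ.H) :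
    Γ.signedContraction (Γ.inv t) = Γ.signedContraction t := by
  unfold signedContraction
  by_cases ht : Γ.att t = Γ.att (Γ.inv t)
  · rw [contractCls_of_loop ht, contractCls_of_loop (by rw [Γ.inv_inv, ht]), smul_zero, smul_zero]
  have ht' : Γ.att (Γ.inv t) ≠ Γ.att (Γ.inv (Γ.inv t)) := by
    rw [Γ.inv_inv]
    exact Ne.symm ht
  obtain ⟨g, h1, -⟩ := Γ.exists_iso_contract_inv t ht ht'
  -- The endpoints come to the front in the opposite order. This sign cancels the one from
  -- `dir_inv`.
  have h2 : Γ.frontSign (Γ.att (Γ.inv t)) (Γ.att (Γ.inv (Γ.inv t))) =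
      -Γ.frontSign (Γ.att t) (Γ.att (Γ.inv t)) := by
    rw [Γ.inv_inv, frontSign_swap Γ ht]
  rw [contractCls_of_ne ht, contractCls_of_ne ht', g.cls_eq, h1, one_smul, h2, Γ.dir_inv, neg_smul,
    neg_smul, smul_neg, neg_neg]

/-! ### Maps defined on the graph complex -/

/-- The graph with the labels replaced by `ℓ`. -/
def withLab (Γ : LabelledGraph O) (ℓ : ∀ v, O.Dec {h // Γ.att h = v}) : LabelledGraph O :=
  { Γ with lab := ℓ }

/-- The class in the graph complex, as a function of the labels. -/
noncomputable def clsMultilinear (Γ : LabelledGraph O) :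
    MultilinearMap k (fun v => O.Dec {h // Γ.att h = v}) (GraphComplex O) where
  toFun ℓ := (Γ.withLab ℓ).cls
  map_update_add' := by
    intro inst ℓ v x y
    -- The arbitrary instance is replaced by the one from the vertex order, which is used by
    -- `setLab`.
    obtain rfl := Subsingleton.elim inst (LinearOrder.toDecidableEq (α := Γ.V))
    have h : Finsupp.single ((Γ.withLab ℓ).setLab v (x + y)) 1 -
        (Finsupp.single ((Γ.withLab ℓ).setLab v x) 1 +
          Finsupp.single ((Γ.withLab ℓ).setLab v y) 1) ∈ graphRel O :=
      Submodule.subset_span (Or.inl (Or.inr ⟨Γ.withLab ℓ, v, x, y, rfl⟩))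
    exact (Submodule.Quotient.eq _).2 h
  map_update_smul' := by
    intro inst ℓ v c x
    obtain rfl := Subsingleton.elim inst (LinearOrder.toDecidableEq (α := Γ.V))
    have h : Finsupp.single ((Γ.withLab ℓ).setLab v (c • x)) 1 -
        c • Finsupp.single ((Γ.withLab ℓ).setLab v x) 1 ∈ graphRel O :=
      Submodule.subset_span (Or.inr ⟨Γ.withLab ℓ, v, c, x, rfl⟩)
    exact (Submodule.Quotient.eq _).2 h

/-- `F` depends linearly on the label of each vertex. -/
def IsLinearInLabels {M : Type*} [AddCommGroup M] [Module k M] (F : LabelledGraph O → M) : Prop :=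
  ∀ (Γ : LabelledGraph O) (v : Γ.V), ∃ T : O.Dec {h // Γ.att h = v} →ₗ[k] M,
    ∀ x, F (Γ.setLab v x) = T x

/-- The universal property of the graph complex: one hypothesis kills the isomorphism relations, the
other one both families of multilinearity relations. -/
theorem exists_linearMap {M : Type*} [AddCommGroup M] [Module k M] (F : LabelledGraph O → M)
    (hiso : ∀ (Γ Δ : LabelledGraph O) (f : Iso Γ Δ), F Γ = f.sign • F Δ)
    (hlab : IsLinearInLabels F) : ∃ d : GraphComplex O →ₗ[k] M, ∀ Γ, d Γ.cls = F Γ := by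
  have h : graphRel O ≤ LinearMap.ker (Finsupp.linearCombination k F) := by
    refine Submodule.span_le.2 ?_
    rintro _ ((⟨Γ, Δ, f, rfl⟩ | ⟨Γ, v, x, y, rfl⟩) | ⟨Γ, v, c, x, rfl⟩)
    · simp [hiso Γ Δ f, ← Int.cast_smul_eq_zsmul k]
    · obtain ⟨T, hT⟩ := hlab Γ v
      simp [hT]
    · obtain ⟨T, hT⟩ := hlab Γ v
      simp [hT]
  refine ⟨(graphRel O).liftQ (Finsupp.linearCombination k F) h, fun Γ => ?_⟩
  rw [cls, Submodule.mkQ_apply, Submodule.liftQ_apply]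
  simp

theorem span_cls : Submodule.span k (Set.range (cls : LabelledGraph O → GraphComplex O)) = ⊤ := by
  refine (Submodule.eq_top_iff').2 fun x => ?_
  obtain ⟨x, rfl⟩ := Submodule.mkQ_surjective _ x
  induction x using Finsupp.induction_linear with
  | zero => simp
  | add x y hx hy =>
    rw [map_add]
    exact add_mem hx hy
  | single Γ c =>
    rw [← mul_one c, ← smul_eq_mul, ← Finsupp.smul_single, map_smul]
    exact Submodule.smul_mem _ _ (Submodule.subset_span ⟨Γ, rfl⟩)

theorem ext_cls {M : Type*} [AddCommGroup M] [Module k M] {f g : GraphComplex O →ₗ[k] M}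
    (h : ∀ Γ : LabelledGraph O, f Γ.cls = g Γ.cls) : f = g :=
  LinearMap.ext_on_range span_cls h

/-- The labels after the contraction of an edge, as a function of the labels. -/
noncomputable def contractLab (Γ : LabelledGraph O) (t : Γ.H) (ht : Γ.att t ≠ Γ.att (Γ.inv t))
    (ℓ : ∀ v, O.Dec {h // Γ.att h = v}) (v : Γ.ContractV t) :
    O.Dec {h // Γ.contractAtt t h = v} :=
  WithBot.recBotCoe (C := fun v => O.Dec {h // Γ.contractAtt t h = v})
    (CyclicOperad.graftₗ _ _ (Γ.two_le_card _) (Γ.contractBot t ht)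
      (ℓ (Γ.att t)) (ℓ (Γ.att (Γ.inv t))))
    (fun v => CyclicOperad.Dec.map (Γ.contractCoe t v) (ℓ v)) v

theorem withLab_contract (Γ : LabelledGraph O) (t : Γ.H) (ht : Γ.att t ≠ Γ.att (Γ.inv t))
    (ℓ : ∀ v, O.Dec {h // Γ.att h = v}) :
    (Γ.withLab ℓ).contract t ht = (Γ.contract t ht).withLab (Γ.contractLab t ht ℓ) := rfl

/-- A change of one label affects one label of the contraction. At an endpoint it is one argument of
the grafting at the new vertex; as the edge is not a loop, the other argument stays fixed, and
linearity follows from bilinearity. -/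
theorem contractLab_update (Γ : LabelledGraph O) (t : Γ.H) (ht : Γ.att t ≠ Γ.att (Γ.inv t))
    (ℓ : ∀ v, O.Dec {h // Γ.att h = v}) (v : Γ.V) :
    ∃ (v' : Γ.ContractV t) (T : O.Dec {h // Γ.att h = v} →ₗ[k] O.Dec {h // Γ.contractAtt t h = v'}),
      ∀ x, Γ.contractLab t ht (Function.update ℓ v x) =
        Function.update (Γ.contractLab t ht ℓ) v' (T x) := by
  by_cases h1 : v = Γ.att t
  · subst h1
    refine ⟨⊥, (CyclicOperad.graftₗ _ _ (Γ.two_le_card _) (Γ.contractBot t ht)).flip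
      (ℓ (Γ.att (Γ.inv t))), fun x => funext fun v => ?_⟩
    cases v using WithBot.recBotCoe with
    | bot => simp [contractLab, ht.symm]
    | coe v => simp [contractLab, v.2.1]
  by_cases h2 : v = Γ.att (Γ.inv t)
  · subst h2
    refine ⟨⊥, (CyclicOperad.graftₗ _ _ (Γ.two_le_card _) (Γ.contractBot t ht)) (ℓ (Γ.att t)),
      fun x => funext fun v => ?_⟩
    cases v using WithBot.recBotCoe with
    | bot => simp [contractLab, ht]
    | coe v => simp [contractLab, v.2.2]
  · refine ⟨((⟨v, h1, h2⟩ : {v // v ≠ Γ.att t ∧ v ≠ Γ.att (Γ.inv t)}) : Γ.ContractV t),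
      CyclicOperad.Dec.map (Γ.contractCoe t ⟨v, h1, h2⟩), fun x => funext fun w => ?_⟩
    cases w using WithBot.recBotCoe with
    | bot => simp [contractLab, Ne.symm h1, Ne.symm h2]
    | coe w =>
      by_cases h3 : w = ⟨v, h1, h2⟩
      · subst h3
        simp [contractLab]
      · have h4 : w.1 ≠ v := fun e => h3 (Subtype.ext e)
        simp [contractLab, h3, h4]

theorem signedContraction_linear (Γ : LabelledGraph O) (t : Γ.H) (v : Γ.V) :
    ∃ T : O.Dec {h // Γ.att h = v} →ₗ[k] GraphComplex O,
      ∀ x, (Γ.setLab v x).signedContraction t = T x := by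
  by_cases ht : Γ.att t = Γ.att (Γ.inv t)
  · refine ⟨0, fun x => ?_⟩
    change _ • (Γ.setLab v x).contractCls t = _
    rw [contractCls_of_loop (Γ := Γ.setLab v x) ht, smul_zero]
    rfl
  obtain ⟨v', T, hT⟩ := Γ.contractLab_update t ht Γ.lab v
  refine ⟨Γ.dir t • Γ.frontSign (Γ.att t) (Γ.att (Γ.inv t)) •
    (Γ.contract t ht).clsMultilinear.toLinearMap (Γ.contractLab t ht Γ.lab) v' ∘ₗ T, fun x => ?_⟩
  change _ • (Γ.setLab v x).contractCls t = _
  rw [contractCls_of_ne (Γ := Γ.setLab v x) ht]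
  change _ • _ • ((Γ.withLab (Function.update Γ.lab v x)).contract t ht).cls = _
  rw [withLab_contract, hT]
  rfl

end LabelledGraph

/-! ### The boundary operator as a sum over half-edges -/

namespace LabelledGraph

universe u w

variable {k : Type u} [Field k] [CharZero k] {O : CyclicOperad.{u, w} k}

/-- Exactly one of the two half-edges of an edge is outgoing, and both have the same signed
contraction. The right-hand side no longer refers to directions of edges. -/
theorem sum_contractCls (Γ : LabelledGraph O) :
    ∑ h : {h : Γ.H // Γ.out h = true}, Γ.contractCls h =
      (1 / 2 : k) • ∑ h, Γ.signedContraction h := by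
  have h1 : ∑ h : {h : Γ.H // Γ.out h = true}, Γ.contractCls h =
      ∑ h, if Γ.out h = true then Γ.signedContraction h else 0 := by
    rw [← Finset.sum_filter, Finset.sum_subtype (p := fun h => Γ.out h = true) _ (by simp)]
    refine Finset.sum_congr rfl fun h _ => ?_
    rw [signedContraction, dir, if_pos h.2, one_smul]
  have h2 : ∑ h, (if Γ.out h = true then 0 else Γ.signedContraction h) =
      ∑ h, if Γ.out h = true then Γ.signedContraction h else 0 := by
    refine Fintype.sum_bijective Γ.inv (Function.Involutive.bijective Γ.inv_inv) _ _ fun h => ?_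
    rw [Γ.out_inv, signedContraction_inv]
    cases Γ.out h <;> rfl
  have h3 : ∑ h, Γ.signedContraction h =
      (2 : k) • ∑ h : {h : Γ.H // Γ.out h = true}, Γ.contractCls h := by
    rw [two_smul, h1]
    nth_rw 2 [← h2]
    rw [← Finset.sum_add_distrib]
    refine Finset.sum_congr rfl fun h _ => ?_
    split_ifs <;> simp
  rw [h3, smul_smul]
  norm_num

theorem exists_isBoundary (O : CyclicOperad.{u, w} k) : ∃ d, IsBoundary O d := by
  refine exists_linearMap (fun Γ => ∑ h : {h : Γ.H // Γ.out h = true}, Γ.contractCls h)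
    (fun Γ Δ f => ?_) (fun Γ v => ?_)
  · rw [sum_contractCls, sum_contractCls, smul_comm]
    congr 1
    rw [Finset.smul_sum]
    exact Fintype.sum_equiv f.half _ (fun h => f.sign • Δ.signedContraction h) fun h =>
      f.signedContraction_eq h
  · choose T hT using fun t => Γ.signedContraction_linear t v
    refine ⟨(1 / 2 : k) • ∑ h, T h, fun x => ?_⟩
    refine (sum_contractCls _).trans ?_
    rw [LinearMap.smul_apply, LinearMap.sum_apply]
    congr 1
    exact Finset.sum_congr rfl fun h _ => hT h x

theorem IsBoundary.apply_cls {d : GraphComplex O →ₗ[k] GraphComplex O} (hd : IsBoundary O d)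
    (Γ : LabelledGraph O) : d Γ.cls = (1 / 2 : k) • ∑ h, Γ.signedContraction h :=
  (hd Γ).trans Γ.sum_contractCls

end LabelledGraph

/-! ### Contraction of two disjoint edges -/

theorem orderSign_swap_bot {R X : Type*} [LinearOrder R] [LinearOrder X] [Fintype R]
    [Fintype (WithBot R)] {p : WithBot R → X} (r₀ : R) (h₀ : p r₀ < p ⊥)
    (h₁ : ∀ r, r ≠ r₀ → p ⊥ < p r) (hp : StrictMono fun r : R => p r) : orderSign p = -1 := by
  -- The only inversion is the pair `(⊥, r₀)`.
  rw [orderSign, Fintype.prod_withBot, Fintype.prod_withBot, invSign_self, one_mul,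
    Fintype.prod_eq_single (f := fun r : R => invSign p ⊥ r) r₀
      fun r hr => if_neg fun h => (h₁ r hr).not_gt h.2,
    Finset.prod_eq_one, mul_one]
  · exact if_pos ⟨WithBot.bot_lt_coe _, h₀⟩
  · intro r _
    rw [Fintype.prod_withBot, Finset.prod_eq_one, mul_one]
    · exact if_neg fun h => not_lt_bot h.1
    · exact fun s _ => if_neg fun h => (hp (WithBot.coe_lt_coe.1 h.1)).not_gt h.2

/-- The bijection of subtypes given by an injection. -/
noncomputable def Equiv.subtypeOfInjective {X Y : Type*} (f : Y → X) (hf : f.Injective)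
    {P : X → Prop} {Q : Y → Prop} (h : ∀ y, Q y → P (f y)) (h' : ∀ x, P x → ∃ y, Q y ∧ f y = x) :
    {x // P x} ≃ {y // Q y} :=
  (Equiv.ofBijective (fun y : {y // Q y} => (⟨f y, h y y.2⟩ : {x // P x}))
    ⟨fun _ _ e => Subtype.ext (hf (congrArg Subtype.val e)), fun x =>
      let ⟨y, hy, hx⟩ := h' x x.2
      ⟨⟨y, hy⟩, Subtype.ext hx⟩⟩).symm

theorem Equiv.subtypeOfInjective_apply {X Y : Type*} (f : Y → X) (hf : f.Injective)
    {P : X → Prop} {Q : Y → Prop} (h : ∀ y, Q y → P (f y)) (h' : ∀ x, P x → ∃ y, Q y ∧ f y = x)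
    (x : {x // P x}) : f (Equiv.subtypeOfInjective f hf h h' x) = x :=
  congrArg Subtype.val ((Equiv.ofBijective (fun y : {y // Q y} => (⟨f y, h y y.2⟩ : {x // P x}))
    _).apply_symm_apply x)

namespace LabelledGraph

universe u w

variable {k : Type u} [CommRing k] {O : CyclicOperad.{u, w} k}

/-- An isomorphism given by a bijection of half-edges. -/
noncomputable def Iso.ofHalf {Γ Δ : LabelledGraph O} (half : Γ.H ≃ Δ.H)
    (hatt : ∀ h h', Γ.att h = Γ.att h' ↔ Δ.att (half h) = Δ.att (half h'))
    (inv_half : ∀ h, Δ.inv (half h) = half (Γ.inv h))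
    (hlab : ∀ v w (e : {h // Γ.att h = v} ≃ {h // Δ.att h = w}), (∀ x, (e x : Δ.H) = half x) →
      Δ.lab w = CyclicOperad.Dec.map e (Γ.lab v)) : Iso Γ Δ :=
  Iso.ofInjective half (fun v => Δ.att (half (Γ.att_surjective v).choose))
    (fun v w h => by
      rw [← (Γ.att_surjective v).choose_spec, ← (Γ.att_surjective w).choose_spec]
      exact (hatt _ _).2 h)
    (fun h => (hatt _ _).1 (Γ.att_surjective (Γ.att h)).choose_spec.symm) inv_half
    (fun v e he => hlab v _ e he)

theorem Iso.sign_of_out_eq {Γ Δ : LabelledGraph O} (f : Iso Γ Δ)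
    (h : ∀ h, Δ.out (f.half h) = Γ.out h) : f.sign = orderSign f.vert := by
  rw [f.sign_eq, Finset.prod_eq_one, mul_one]
  intro x _
  unfold edgeSign
  rw [h]
  simp

/-- Reduces incidence in iterated contractions to propositional logic about incidence in `Γ`. -/
theorem contract_att_eq_iff (Γ : LabelledGraph O) (t : Γ.H) (ht : Γ.att t ≠ Γ.att (Γ.inv t))
    (x y : Γ.ContractH t) :
    (Γ.contract t ht).att x = (Γ.contract t ht).att y ↔ Γ.att x = Γ.att y ∨
      (Γ.att x = Γ.att t ∨ Γ.att x = Γ.att (Γ.inv t)) ∧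
      (Γ.att y = Γ.att t ∨ Γ.att y = Γ.att (Γ.inv t)) := by
  change Γ.contractAtt t x = Γ.contractAtt t y ↔ _
  generalize hz : Γ.contractAtt t y = z
  cases z using WithBot.recBotCoe with
  | bot =>
    rw [contractAtt_eq_bot] at hz ⊢
    grind
  | coe v =>
    rw [contractAtt_eq_coe] at hz ⊢
    have := v.2
    grind

theorem lab_congr (Γ : LabelledGraph O) {v w : Γ.V} (e : {h // Γ.att h = v} ≃ {h // Γ.att h = w})
    (he : ∀ x, (e x).1 = x.1) : Γ.lab w = CyclicOperad.Dec.map e (Γ.lab v) := by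
  obtain ⟨x⟩ := Γ.nonempty_halves v
  obtain rfl : v = w := by rw [← x.2, ← (e x).2, he]
  obtain rfl : e = Equiv.refl _ := Equiv.ext fun x => Subtype.ext (he x)
  rw [CyclicOperad.Dec.map_refl]

theorem contract_lab_coe (Γ : LabelledGraph O) (t : Γ.H) (ht : Γ.att t ≠ Γ.att (Γ.inv t))
    {v : Γ.V} (hv : v ≠ Γ.att t) (hv' : v ≠ Γ.att (Γ.inv t)) {z : (Γ.contract t ht).V}
    (e : {h // Γ.att h = v} ≃ {h // (Γ.contract t ht).att h = z}) (he : ∀ x, (e x).1.1 = x.1) :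
    (Γ.contract t ht).lab z = CyclicOperad.Dec.map e (Γ.lab v) := by
  obtain ⟨x⟩ := Γ.nonempty_halves v
  obtain rfl : z = ((⟨v, hv, hv'⟩ : {v // v ≠ Γ.att t ∧ v ≠ Γ.att (Γ.inv t)}) : Γ.ContractV t) :=
    (e x).2.symm.trans ((Γ.contractAtt_eq_coe t _ _).2 ((congrArg Γ.att (he x)).trans x.2))
  change CyclicOperad.Dec.map (Γ.contractCoe t ⟨v, hv, hv'⟩) (Γ.lab v) = _
  congr 1
  congr 1
  ext x
  exact (he x).symm

/-- The label of the new vertex after the contraction of an edge. -/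
theorem contract_lab_bot (Γ : LabelledGraph O) (t : Γ.H) (ht : Γ.att t ≠ Γ.att (Γ.inv t))
    {z : (Γ.contract t ht).V} (hz : z = (⊥ : Γ.ContractV t))
    (e : {x : {h : Γ.H // Γ.att h = Γ.att t} // x ≠ ⟨t, rfl⟩} ⊕
      {y : {h : Γ.H // Γ.att h = Γ.att (Γ.inv t)} // y ≠ ⟨Γ.inv t, rfl⟩} ≃
      {h // (Γ.contract t ht).att h = z}) (hl : ∀ x, (e (Sum.inl x)).1.1 = x.1.1)
    (hr : ∀ x, (e (Sum.inr x)).1.1 = x.1.1) :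
    (Γ.contract t ht).lab z = CyclicOperad.graft _ _ (Γ.two_le_card _) e
        (Γ.lab (Γ.att t)) (Γ.lab (Γ.att (Γ.inv t))) := by
  subst hz
  obtain rfl : e = Γ.contractBot t ht := by
    refine Equiv.ext fun x => Subtype.ext (Subtype.ext ?_)
    rcases x with x | x
    · exact hl x
    · exact hr x
  rfl

section

variable (Γ : LabelledGraph O) {t h : Γ.H} (ht : Γ.att t ≠ Γ.att (Γ.inv t))
  (hh : Γ.att h ≠ Γ.att (Γ.inv h)) (h₁ : h ≠ t ∧ h ≠ Γ.inv t) (h₂ : t ≠ h ∧ t ≠ Γ.inv h)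

theorem exists_contractHalvesEquiv {v : Γ.V} (hv : v ≠ Γ.att t) (hv' : v ≠ Γ.att (Γ.inv t))
    {z : (Γ.contract t ht).V} (x : Γ.ContractH t) (hx : Γ.att x = v)
    (hz : (Γ.contract t ht).att x = z) :
    ∃ e : {h // Γ.att h = v} ≃ {h // (Γ.contract t ht).att h = z}, ∀ x, (e x).1.1 = x.1 := by
  subst hx hz
  refine ⟨Equiv.subtypeOfInjective (fun y : Γ.ContractH t => y.1) Subtype.val_injective
    (fun y hy => ?_) (fun y hy => ?_),
    Equiv.subtypeOfInjective_apply (fun y : Γ.ContractH t => y.1) Subtype.val_injective _ _⟩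
  · rw [contract_att_eq_iff] at hy
    grind
  · refine ⟨⟨y, fun e => hv ?_, fun e => hv' ?_⟩, ?_, rfl⟩
    · rw [← hy, e]
    · rw [← hy, e]
    · rw [contract_att_eq_iff]
      exact Or.inl hy

/-- The label of the vertex obtained from the contraction of one of two disjoint edges. -/
theorem contract_contract_lab_bot (hd₁ : Γ.att t ≠ Γ.att h) (hd₂ : Γ.att t ≠ Γ.att (Γ.inv h))
    (hd₃ : Γ.att (Γ.inv t) ≠ Γ.att h) (hd₄ : Γ.att (Γ.inv t) ≠ Γ.att (Γ.inv h))
    (ht' : (Γ.contract h hh).att ⟨t, h₂⟩ ≠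
      (Γ.contract h hh).att ((Γ.contract h hh).inv ⟨t, h₂⟩))
    (e : {x // (Γ.contract t ht).att x = (⊥ : Γ.ContractV t)} ≃
      {x // ((Γ.contract h hh).contract ⟨t, h₂⟩ ht').att x =
        (⊥ : (Γ.contract h hh).ContractV ⟨t, h₂⟩)}) (he : ∀ x, (e x).1.1.1 = x.1.1) :
    ((Γ.contract h hh).contract ⟨t, h₂⟩ ht').lab
        (⊥ : (Γ.contract h hh).ContractV ⟨t, h₂⟩) =
      CyclicOperad.Dec.map e ((Γ.contract t ht).lab (⊥ : Γ.ContractV t)) := by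
  obtain ⟨e₁, he₁⟩ := exists_contractHalvesEquiv Γ hh hd₁ hd₂ ⟨t, h₂⟩ rfl rfl
  obtain ⟨e₂, he₂⟩ := exists_contractHalvesEquiv Γ hh hd₃ hd₄
    ((Γ.contract h hh).inv ⟨t, h₂⟩) rfl rfl
  have key := CyclicOperad.graft_map (O := O) (s := (⟨t, rfl⟩ : {h // Γ.att h = Γ.att t}))
        (t := (⟨Γ.inv t, rfl⟩ : {h // Γ.att h = Γ.att (Γ.inv t)}))
        (s' := ⟨⟨t, h₂⟩, rfl⟩) (t' := ⟨(Γ.contract h hh).inv ⟨t, h₂⟩, rfl⟩)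
        e₁ e₂ e (Subtype.ext (Subtype.ext (he₁ _))) (Subtype.ext (Subtype.ext (he₂ _)))
        (Γ.two_le_card _) ((Γ.contract h hh).two_le_card _)
        (Γ.contractBot t ht) ((Γ.contract h hh).contractBot ⟨t, h₂⟩ ht')
        (fun x hx hx' => Subtype.ext (Subtype.ext (Subtype.ext ((he₁ x).trans
          (he (Γ.contractBot t ht (Sum.inl ⟨x, hx⟩))).symm))))
        (fun x hx hx' => Subtype.ext (Subtype.ext (Subtype.ext ((he₂ x).trans
          (he (Γ.contractBot t ht (Sum.inr ⟨x, hx⟩))).symm))))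
        (Γ.lab _) (Γ.lab _)
  rw [← Γ.contract_lab_coe h hh hd₁ hd₂ e₁ he₁, ← Γ.contract_lab_coe h hh hd₃ hd₄ e₂ he₂] at key
  exact key

/-- The half-edges after the contraction of two edges do not depend on the order. -/
def contractSwapHalf (ht' : (Γ.contract h hh).att ⟨t, h₂⟩ ≠
      (Γ.contract h hh).att ((Γ.contract h hh).inv ⟨t, h₂⟩))
    (hh' : (Γ.contract t ht).att ⟨h, h₁⟩ ≠
      (Γ.contract t ht).att ((Γ.contract t ht).inv ⟨h, h₁⟩)) :
    ((Γ.contract h hh).contract ⟨t, h₂⟩ ht').H ≃ ((Γ.contract t ht).contract ⟨h, h₁⟩ hh').H where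
  toFun x := ⟨⟨x.1.1, fun e => x.2.1 (Subtype.ext e), fun e => x.2.2 (Subtype.ext e)⟩,
    fun e => x.1.2.1 (congrArg Subtype.val e), fun e => x.1.2.2 (congrArg Subtype.val e)⟩
  invFun x := ⟨⟨x.1.1, fun e => x.2.1 (Subtype.ext e), fun e => x.2.2 (Subtype.ext e)⟩,
    fun e => x.1.2.1 (congrArg Subtype.val e), fun e => x.1.2.2 (congrArg Subtype.val e)⟩
  left_inv _ := rfl
  right_inv _ := rfl

theorem contract_contract_att_coe (z : Γ.ContractH h)
    (ht' : (Γ.contract h hh).att z ≠ (Γ.contract h hh).att ((Γ.contract h hh).inv z))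
    (x : ((Γ.contract h hh).contract z ht').H) (v : {v // v ≠ Γ.att h ∧ v ≠ Γ.att (Γ.inv h)}) (hv) :
    ((Γ.contract h hh).contract z ht').att x =
      ((⟨(v : Γ.ContractV h), hv⟩ : {v // v ≠ (Γ.contract h hh).att z ∧
        v ≠ (Γ.contract h hh).att ((Γ.contract h hh).inv z)}) :
        (Γ.contract h hh).ContractV z) ↔ Γ.att x.1.1 = v :=
  ((Γ.contract h hh).contractAtt_eq_coe _ _ _).trans (Γ.contractAtt_eq_coe _ _ _)

theorem contract_contract_att_coe_bot (z : Γ.ContractH h)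
    (ht' : (Γ.contract h hh).att z ≠ (Γ.contract h hh).att ((Γ.contract h hh).inv z))
    (x : ((Γ.contract h hh).contract z ht').H) (hv) :
    ((Γ.contract h hh).contract z ht').att x =
      ((⟨(⊥ : Γ.ContractV h), hv⟩ : {v // v ≠ (Γ.contract h hh).att z ∧
        v ≠ (Γ.contract h hh).att ((Γ.contract h hh).inv z)}) :
        (Γ.contract h hh).ContractV z) ↔ Γ.att x.1.1 = Γ.att h ∨ Γ.att x.1.1 = Γ.att (Γ.inv h) :=
  ((Γ.contract h hh).contractAtt_eq_coe _ _ _).trans (Γ.contractAtt_eq_bot _ _)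

theorem contract_contract_att_bot (z : Γ.ContractH h)
    (ht' : (Γ.contract h hh).att z ≠ (Γ.contract h hh).att ((Γ.contract h hh).inv z))
    (x : ((Γ.contract h hh).contract z ht').H) :
    ((Γ.contract h hh).contract z ht').att x = (⊥ : (Γ.contract h hh).ContractV z) ↔
      (Γ.att x.1.1 = Γ.att z.1 ∨ (Γ.att x.1.1 = Γ.att h ∨ Γ.att x.1.1 = Γ.att (Γ.inv h)) ∧
        (Γ.att z.1 = Γ.att h ∨ Γ.att z.1 = Γ.att (Γ.inv h))) ∨
      (Γ.att x.1.1 = Γ.att (Γ.inv z.1) ∨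
        (Γ.att x.1.1 = Γ.att h ∨ Γ.att x.1.1 = Γ.att (Γ.inv h)) ∧
        (Γ.att (Γ.inv z.1) = Γ.att h ∨ Γ.att (Γ.inv z.1) = Γ.att (Γ.inv h))) :=
  ((Γ.contract h hh).contractAtt_eq_bot _ _).trans
    (or_congr (Γ.contract_att_eq_iff _ _ _ _) (Γ.contract_att_eq_iff _ _ _ _))

theorem contract_contract_att_eq_iff (z : Γ.ContractH h)
    (ht' : (Γ.contract h hh).att z ≠ (Γ.contract h hh).att ((Γ.contract h hh).inv z))
    (x y : ((Γ.contract h hh).contract z ht').H) :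
    ((Γ.contract h hh).contract z ht').att x = ((Γ.contract h hh).contract z ht').att y ↔
      (Γ.att x.1.1 = Γ.att y.1.1 ∨
        (Γ.att x.1.1 = Γ.att h ∨ Γ.att x.1.1 = Γ.att (Γ.inv h)) ∧
        (Γ.att y.1.1 = Γ.att h ∨ Γ.att y.1.1 = Γ.att (Γ.inv h))) ∨
      ((Γ.contract h hh).contract z ht').att x = (⊥ : (Γ.contract h hh).ContractV z) ∧
        ((Γ.contract h hh).contract z ht').att y = (⊥ : (Γ.contract h hh).ContractV z) :=
  ((Γ.contract h hh).contract_att_eq_iff z ht' _ _).trans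
    (or_congr (Γ.contract_att_eq_iff _ _ _ _)
      (and_congr ((Γ.contract h hh).contractAtt_eq_bot _ _).symm
        ((Γ.contract h hh).contractAtt_eq_bot _ _).symm))

/-- The label of a vertex which is not affected by the contraction of two edges. -/
theorem contract_contract_lab_other (z : Γ.ContractH h)
    (ht' : (Γ.contract h hh).att z ≠ (Γ.contract h hh).att ((Γ.contract h hh).inv z))
    (x : ((Γ.contract h hh).contract z ht').H)
    {v : ((Γ.contract h hh).contract z ht').V}
    (hx : ((Γ.contract h hh).contract z ht').att x = v)
    (hx₁ : Γ.att x.1.1 ≠ Γ.att h) (hx₂ : Γ.att x.1.1 ≠ Γ.att (Γ.inv h))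
    (hx₃ : Γ.att x.1.1 ≠ Γ.att z.1) (hx₄ : Γ.att x.1.1 ≠ Γ.att (Γ.inv z.1)) :
    ∃ e : {y // Γ.att y = Γ.att x.1.1} ≃ {y // ((Γ.contract h hh).contract z ht').att y = v},
      (∀ y, (e y).1.1.1 = y.1) ∧
      ((Γ.contract h hh).contract z ht').lab v = CyclicOperad.Dec.map e (Γ.lab _) := by
  obtain ⟨e₁, he₁⟩ := exists_contractHalvesEquiv Γ hh hx₁ hx₂ x.1 rfl rfl
  have h3 : (Γ.contract h hh).att x.1 ≠ (Γ.contract h hh).att z := fun e => by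
    have := (Γ.contract_att_eq_iff h hh x.1 z).1 e
    tauto
  have h4 : (Γ.contract h hh).att x.1 ≠ (Γ.contract h hh).att ((Γ.contract h hh).inv z) :=
    fun e => by
      have := (Γ.contract_att_eq_iff h hh x.1 ((Γ.contract h hh).inv z)).1 e
      tauto
  obtain ⟨e₂, he₂⟩ := exists_contractHalvesEquiv (Γ.contract h hh) ht' h3 h4 x rfl hx
  refine ⟨e₁.trans e₂, fun y => (congrArg Subtype.val (he₂ _)).trans (he₁ y), ?_⟩
  rw [(Γ.contract h hh).contract_lab_coe z ht' h3 h4 e₂ he₂,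
    Γ.contract_lab_coe h hh hx₁ hx₂ e₁ he₁, CyclicOperad.Dec.map_map]

theorem exists_contract_contract_att_eq (z : Γ.ContractH h)
    (ht' : (Γ.contract h hh).att z ≠ (Γ.contract h hh).att ((Γ.contract h hh).inv z))
    (x : ((Γ.contract h hh).contract z ht').H)
    (hx₁ : Γ.att x.1.1 ≠ Γ.att h) (hx₂ : Γ.att x.1.1 ≠ Γ.att (Γ.inv h))
    (hx₃ : Γ.att x.1.1 ≠ Γ.att z.1) (hx₄ : Γ.att x.1.1 ≠ Γ.att (Γ.inv z.1)) :
    ∃ (u : {v // v ≠ Γ.att h ∧ v ≠ Γ.att (Γ.inv h)})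
      (hu : (u : Γ.ContractV h) ≠ (Γ.contract h hh).att z ∧
        (u : Γ.ContractV h) ≠ (Γ.contract h hh).att ((Γ.contract h hh).inv z)),
      u.1 = Γ.att x.1.1 ∧ ((Γ.contract h hh).contract z ht').att x =
        ((⟨(u : Γ.ContractV h), hu⟩ : {v // v ≠ (Γ.contract h hh).att z ∧
          v ≠ (Γ.contract h hh).att ((Γ.contract h hh).inv z)}) :
          (Γ.contract h hh).ContractV z) :=
  ⟨⟨Γ.att x.1.1, hx₁, hx₂⟩,
    ⟨fun e => hx₃ ((Γ.contractAtt_eq_coe h z _).1 e.symm).symm,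
      fun e => hx₄ ((Γ.contractAtt_eq_coe h ((Γ.contract h hh).inv z) _).1 e.symm).symm⟩, rfl,
    (contract_contract_att_coe Γ hh z ht' x _ _).2 rfl⟩

/-- The contractions of two disjoint edges commute up to a sign. -/
theorem exists_iso_contract_disjoint (hd₁ : Γ.att t ≠ Γ.att h) (hd₂ : Γ.att t ≠ Γ.att (Γ.inv h))
    (hd₃ : Γ.att (Γ.inv t) ≠ Γ.att h) (hd₄ : Γ.att (Γ.inv t) ≠ Γ.att (Γ.inv h))
    (ht' : (Γ.contract h hh).att ⟨t, h₂⟩ ≠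
      (Γ.contract h hh).att ((Γ.contract h hh).inv ⟨t, h₂⟩))
    (hh' : (Γ.contract t ht).att ⟨h, h₁⟩ ≠
      (Γ.contract t ht).att ((Γ.contract t ht).inv ⟨h, h₁⟩)) :
    ∃ f : Iso ((Γ.contract h hh).contract ⟨t, h₂⟩ ht') ((Γ.contract t ht).contract ⟨h, h₁⟩ hh'),
      f.sign = -1 := by
  have hiff : ∀ x : ((Γ.contract h hh).contract ⟨t, h₂⟩ ht').H,
      ((Γ.contract h hh).contract ⟨t, h₂⟩ ht').att x =
        (⊥ : (Γ.contract h hh).ContractV ⟨t, h₂⟩) ↔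
      Γ.att x.1.1 = Γ.att t ∨ Γ.att x.1.1 = Γ.att (Γ.inv t) := fun x => by
    rw [contract_contract_att_bot]
    tauto
  have hiff' : ∀ x : ((Γ.contract t ht).contract ⟨h, h₁⟩ hh').H,
      ((Γ.contract t ht).contract ⟨h, h₁⟩ hh').att x =
        (⊥ : (Γ.contract t ht).ContractV ⟨h, h₁⟩) ↔
      Γ.att x.1.1 = Γ.att h ∨ Γ.att x.1.1 = Γ.att (Γ.inv h) := fun x => by
    rw [contract_contract_att_bot]
    tauto
  have hatt : ∀ x y, ((Γ.contract h hh).contract ⟨t, h₂⟩ ht').att x =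
      ((Γ.contract h hh).contract ⟨t, h₂⟩ ht').att y ↔
      ((Γ.contract t ht).contract ⟨h, h₁⟩ hh').att (Γ.contractSwapHalf ht hh h₁ h₂ ht' hh' x) =
      ((Γ.contract t ht).contract ⟨h, h₁⟩ hh').att (Γ.contractSwapHalf ht hh h₁ h₂ ht' hh' y) := by
    intro x y
    rw [contract_contract_att_eq_iff, contract_contract_att_eq_iff, hiff, hiff, hiff', hiff']
    change _ ↔ (Γ.att x.1.1 = Γ.att y.1.1 ∨ (Γ.att x.1.1 = _ ∨ Γ.att x.1.1 = _) ∧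
      (Γ.att y.1.1 = _ ∨ Γ.att y.1.1 = _)) ∨ (Γ.att x.1.1 = _ ∨ Γ.att x.1.1 = _) ∧
      (Γ.att y.1.1 = _ ∨ Γ.att y.1.1 = _)
    tauto
  -- Since the edges are disjoint, the vertex created by the first contraction is not an endpoint of
  -- the second edge and survives as an old vertex.
  have hB : (⊥ : Γ.ContractV t) ≠ (Γ.contract t ht).att ⟨h, h₁⟩ ∧
      (⊥ : Γ.ContractV t) ≠ (Γ.contract t ht).att ((Γ.contract t ht).inv ⟨h, h₁⟩) :=
    ⟨fun e => ((Γ.contractAtt_eq_bot _ _).1 e.symm).elim hd₁.symm hd₃.symm,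
      fun e => ((Γ.contractAtt_eq_bot _ _).1 e.symm).elim hd₂.symm hd₄.symm⟩
  have hA : (⊥ : Γ.ContractV h) ≠ (Γ.contract h hh).att ⟨t, h₂⟩ ∧
      (⊥ : Γ.ContractV h) ≠ (Γ.contract h hh).att ((Γ.contract h hh).inv ⟨t, h₂⟩) :=
    ⟨fun e => ((Γ.contractAtt_eq_bot _ _).1 e.symm).elim hd₁ hd₂,
      fun e => ((Γ.contractAtt_eq_bot _ _).1 e.symm).elim hd₃ hd₄⟩
  have hlab : ∀ v w (e : {x // ((Γ.contract h hh).contract ⟨t, h₂⟩ ht').att x = v} ≃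
      {x // ((Γ.contract t ht).contract ⟨h, h₁⟩ hh').att x = w}),
      (∀ x, (e x).1 = Γ.contractSwapHalf ht hh h₁ h₂ ht' hh' x) →
      ((Γ.contract t ht).contract ⟨h, h₁⟩ hh').lab w =
        CyclicOperad.Dec.map e (((Γ.contract h hh).contract ⟨t, h₂⟩ ht').lab v) := by
    intro v w e he
    have he' : ∀ x, (e x).1.1.1 = x.1.1.1 := fun x => congrArg (fun x => x.1.1) (he x)
    obtain ⟨x⟩ := nonempty_halves _ v
    -- A vertex comes from the contraction of `t`, from that of `h`, or from an unaffected vertex of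
    -- `Γ`.
    by_cases hx₁ : Γ.att x.1.1.1 = Γ.att t ∨ Γ.att x.1.1.1 = Γ.att (Γ.inv t)
    · obtain rfl : v = (⊥ : (Γ.contract h hh).ContractV ⟨t, h₂⟩) := x.2.symm.trans ((hiff _).2 hx₁)
      obtain rfl : w = ((⟨(⊥ : Γ.ContractV t), hB⟩ : {v // v ≠ (Γ.contract t ht).att ⟨h, h₁⟩ ∧
          v ≠ (Γ.contract t ht).att ((Γ.contract t ht).inv ⟨h, h₁⟩)}) :
          (Γ.contract t ht).ContractV ⟨h, h₁⟩) :=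
        (e x).2.symm.trans ((contract_contract_att_coe_bot Γ ht _ hh' _ _).2 (by rwa [he']))
      have := nonempty_halves (Γ.contract t ht) (⊥ : Γ.ContractV t)
      rw [contract_contract_lab_bot Γ ht hh h₂ hd₁ hd₂ hd₃ hd₄ ht'
        (((Γ.contract t ht).contractCoe ⟨h, h₁⟩ ⟨(⊥ : Γ.ContractV t), hB⟩).trans e.symm)
        fun y => (he' _).symm.trans (congrArg (fun x => x.1.1.1) (e.apply_symm_apply _)),
        CyclicOperad.Dec.map_map]
      exact congrArg (fun e => CyclicOperad.Dec.map e ((Γ.contract t ht).lab (⊥ : Γ.ContractV t)))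
        (Equiv.ext fun y => (e.apply_symm_apply _).symm)
    by_cases hx₂ : Γ.att x.1.1.1 = Γ.att h ∨ Γ.att x.1.1.1 = Γ.att (Γ.inv h)
    · obtain rfl : w = (⊥ : (Γ.contract t ht).ContractV ⟨h, h₁⟩) :=
        (e x).2.symm.trans ((hiff' _).2 (by rwa [he']))
      obtain rfl : v = ((⟨(⊥ : Γ.ContractV h), hA⟩ : {v // v ≠ (Γ.contract h hh).att ⟨t, h₂⟩ ∧
          v ≠ (Γ.contract h hh).att ((Γ.contract h hh).inv ⟨t, h₂⟩)}) :
          (Γ.contract h hh).ContractV ⟨t, h₂⟩) :=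
        x.2.symm.trans ((contract_contract_att_coe_bot Γ hh _ ht' _ _).2 hx₂)
      have := nonempty_halves (Γ.contract h hh) (⊥ : Γ.ContractV h)
      rw [contract_contract_lab_bot Γ hh ht h₁ hd₁.symm hd₃.symm hd₂.symm hd₄.symm hh'
        (((Γ.contract h hh).contractCoe ⟨t, h₂⟩ ⟨(⊥ : Γ.ContractV h), hA⟩).trans e)
        fun y => he' _]
      exact (CyclicOperad.Dec.map_map ((Γ.contract h hh).contractCoe ⟨t, h₂⟩
        ⟨(⊥ : Γ.ContractV h), hA⟩) e _).symm
    · obtain ⟨e₁, he₁, hl₁⟩ := Γ.contract_contract_lab_other hh _ ht' x.1 x.2 (by tauto) (by tauto)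
        (by tauto) (by tauto)
      obtain ⟨e₂, he₂, hl₂⟩ := Γ.contract_contract_lab_other ht _ hh'
        (Γ.contractSwapHalf ht hh h₁ h₂ ht' hh' x.1) (v := w) (by rw [← he]; exact (e x).2)
        (fun h => hx₁ (Or.inl h)) (fun h => hx₁ (Or.inr h)) (fun h => hx₂ (Or.inl h))
        (fun h => hx₂ (Or.inr h))
      rw [hl₁, hl₂, CyclicOperad.Dec.map_map]
      exact congrArg (fun e => CyclicOperad.Dec.map e (Γ.lab (Γ.att x.1.1.1)))
        (Equiv.ext fun y => Subtype.ext (Subtype.ext (Subtype.ext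
          ((he₂ y).trans ((he' _).trans (he₁ y)).symm))))
  let f := Iso.ofHalf (Γ.contractSwapHalf ht hh h₁ h₂ ht' hh') hatt (fun _ => rfl) hlab
  refine ⟨f, ?_⟩
  rw [f.sign_of_out_eq fun _ => rfl]
  have hf : ∀ x, f.vert (((Γ.contract h hh).contract ⟨t, h₂⟩ ht').att x) =
      ((Γ.contract t ht).contract ⟨h, h₁⟩ hh').att (Γ.contractSwapHalf ht hh h₁ h₂ ht' hh' x) :=
    fun x => (f.att_half x).symm
  -- The vertex created last is the first one in the order. So the two new vertices occupy the first
  -- two places, in opposite orders in the two graphs, and `f` exchanges these places.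
  have f₁ : f.vert (⊥ : (Γ.contract h hh).ContractV ⟨t, h₂⟩) =
      ((⟨(⊥ : Γ.ContractV t), hB⟩ : {v // v ≠ (Γ.contract t ht).att ⟨h, h₁⟩ ∧
          v ≠ (Γ.contract t ht).att ((Γ.contract t ht).inv ⟨h, h₁⟩)}) :
          (Γ.contract t ht).ContractV ⟨h, h₁⟩) := by
    obtain ⟨x, hx⟩ := att_surjective ((Γ.contract h hh).contract ⟨t, h₂⟩ ht')
      (⊥ : (Γ.contract h hh).ContractV ⟨t, h₂⟩)
    rw [← hx, hf]
    exact (contract_contract_att_coe_bot Γ ht _ hh' _ _).2 ((hiff x).1 hx)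
  have f₂ : f.vert ((⟨(⊥ : Γ.ContractV h), hA⟩ : {v // v ≠ (Γ.contract h hh).att ⟨t, h₂⟩ ∧
          v ≠ (Γ.contract h hh).att ((Γ.contract h hh).inv ⟨t, h₂⟩)}) :
          (Γ.contract h hh).ContractV ⟨t, h₂⟩) = (⊥ : (Γ.contract t ht).ContractV ⟨h, h₁⟩) := by
    obtain ⟨x, hx⟩ := att_surjective ((Γ.contract h hh).contract ⟨t, h₂⟩ ht')
      ((⟨(⊥ : Γ.ContractV h), hA⟩ : {v // v ≠ (Γ.contract h hh).att ⟨t, h₂⟩ ∧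
          v ≠ (Γ.contract h hh).att ((Γ.contract h hh).inv ⟨t, h₂⟩)}) :
          (Γ.contract h hh).ContractV ⟨t, h₂⟩)
    rw [← hx, hf]
    exact (hiff' _).2 ((contract_contract_att_coe_bot Γ hh _ ht' _ _).1 hx)
  have f₃ : ∀ (u : {v // v ≠ Γ.att h ∧ v ≠ Γ.att (Γ.inv h)})
      (q : (u : Γ.ContractV h) ≠ (Γ.contract h hh).att ⟨t, h₂⟩ ∧
          (u : Γ.ContractV h) ≠ (Γ.contract h hh).att ((Γ.contract h hh).inv ⟨t, h₂⟩)),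
      ∃ (u' : {v // v ≠ Γ.att t ∧ v ≠ Γ.att (Γ.inv t)})
        (q' : (u' : Γ.ContractV t) ≠ (Γ.contract t ht).att ⟨h, h₁⟩ ∧
          (u' : Γ.ContractV t) ≠ (Γ.contract t ht).att ((Γ.contract t ht).inv ⟨h, h₁⟩)),
      u'.1 = u.1 ∧ f.vert ((⟨(u : Γ.ContractV h), q⟩ : {v // v ≠ (Γ.contract h hh).att ⟨t, h₂⟩ ∧
          v ≠ (Γ.contract h hh).att ((Γ.contract h hh).inv ⟨t, h₂⟩)}) :
          (Γ.contract h hh).ContractV ⟨t, h₂⟩) =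
        ((⟨(u' : Γ.ContractV t), q'⟩ : {v // v ≠ (Γ.contract t ht).att ⟨h, h₁⟩ ∧
          v ≠ (Γ.contract t ht).att ((Γ.contract t ht).inv ⟨h, h₁⟩)}) :
          (Γ.contract t ht).ContractV ⟨h, h₁⟩) := by
    intro u q
    obtain ⟨x, hx⟩ := att_surjective ((Γ.contract h hh).contract ⟨t, h₂⟩ ht')
      ((⟨(u : Γ.ContractV h), q⟩ : {v // v ≠ (Γ.contract h hh).att ⟨t, h₂⟩ ∧
          v ≠ (Γ.contract h hh).att ((Γ.contract h hh).inv ⟨t, h₂⟩)}) :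
          (Γ.contract h hh).ContractV ⟨t, h₂⟩)
    have hu : Γ.att x.1.1 = u := (contract_contract_att_coe Γ hh _ ht' _ _ _).1 hx
    have hn : ¬ (Γ.att x.1.1 = Γ.att t ∨ Γ.att x.1.1 = Γ.att (Γ.inv t)) := fun e =>
      WithBot.bot_ne_coe (((hiff x).2 e).symm.trans hx)
    obtain ⟨u', q', h3, h4⟩ := exists_contract_contract_att_eq Γ ht _ hh'
      (Γ.contractSwapHalf ht hh h₁ h₂ ht' hh' x) (fun e => hn (Or.inl e)) (fun e => hn (Or.inr e))
      (fun e => u.2.1 (hu.symm.trans e)) (fun e => u.2.2 (hu.symm.trans e))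
    refine ⟨u', q', h3.trans hu, ?_⟩
    rw [← hx, hf]
    exact h4
  -- The exchange of the first two vertices is the only source of the sign: on everything after `⊥`,
  -- `f` is increasing.
  refine orderSign_swap_bot (p := f.vert) ⟨(⊥ : Γ.ContractV h), hA⟩ ?_ ?_ ?_
  · refine (f₂.trans_lt ?_).trans_eq f₁.symm
    exact WithBot.bot_lt_coe _
  · rintro ⟨r, q⟩ hr
    cases r using WithBot.recBotCoe with
    | bot => exact absurd rfl hr
    | coe u =>
      obtain ⟨u', q', h3, h4⟩ := f₃ u q
      refine (f₁.trans_lt ?_).trans_eq h4.symm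
      exact WithBot.coe_lt_coe.2 (Subtype.mk_lt_mk.2 (WithBot.bot_lt_coe _))
  · rintro ⟨r, q⟩ ⟨s, q'⟩ hrs
    cases s using WithBot.recBotCoe with
    | bot => exact absurd (Subtype.mk_lt_mk.1 hrs) (WithBot.not_lt_bot _)
    | coe s =>
      obtain ⟨s', q₁', h3, h4⟩ := f₃ s q'
      cases r using WithBot.recBotCoe with
      | bot =>
        refine (f₂.trans_lt ?_).trans_eq h4.symm
        exact WithBot.bot_lt_coe _
      | coe r =>
        obtain ⟨r', q₂', h5, h6⟩ := f₃ r q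
        refine (h6.trans_lt ?_).trans_eq h4.symm
        refine WithBot.coe_lt_coe.2 (Subtype.mk_lt_mk.2 (WithBot.coe_lt_coe.2 ?_))
        rw [← Subtype.coe_lt_coe, h5, h3, Subtype.coe_lt_coe]
        exact WithBot.coe_lt_coe.1 hrs

end

end LabelledGraph

/-! ### Contraction of two edges with one common vertex -/

namespace CyclicOperad

variable {k : Type*} [CommRing k] {O : CyclicOperad k} {S T U : Type} [Finite S] [Finite T]

/-- Moves a relabelling of an argument into the identification of the remaining elements, as needed
before associativity can be applied to labels of contracted graphs. -/
theorem exists_graft_map_right {T' : Type} [Finite T'] {s : S} {t : T} {t' : T'} (g : T ≃ T')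
    (ht : g t = t') (hS : 2 ≤ Nat.card S) (e' : {x : S // x ≠ s} ⊕ {y : T' // y ≠ t'} ≃ U) :
    ∃ e : {x : S // x ≠ s} ⊕ {y : T // y ≠ t} ≃ U, (∀ x, e (Sum.inl x) = e' (Sum.inl x)) ∧
      (∀ y hy hy', e (Sum.inr ⟨y, hy⟩) = e' (Sum.inr ⟨g y, hy'⟩)) ∧
      ∀ (x : O.Dec S) (y : O.Dec T), graft s t' hS e' x (Dec.map g y) = graft s t hS e x y := by
  have : Nonempty S := ⟨s⟩
  let g' : {y : T // y ≠ t} ≃ {y : T' // y ≠ t'} :=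
    g.subtypeEquiv fun y => by rw [← ht, g.injective.ne_iff]
  let e : {x : S // x ≠ s} ⊕ {y : T // y ≠ t} ≃ U := ((Equiv.refl _).sumCongr g').trans e'
  have : Nonempty U ∨ IsEmpty U := (isEmpty_or_nonempty U).symm
  refine ⟨e, fun x => rfl, fun y hy hy' => rfl, fun x y => ?_⟩
  have key := graft_map (O := O) (Equiv.refl S) g (Equiv.refl U) rfl ht hS hS e e'
    (fun _ _ _ => rfl) (fun _ _ _ => rfl) x y
  rw [Dec.map_refl, map_graft] at key
  exact key

theorem exists_graft_map_left {S' : Type} [Finite S'] {s : S} {s' : S'} {t : T} (f : S ≃ S')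
    (hs : f s = s') (hS : 2 ≤ Nat.card S) (hS' : 2 ≤ Nat.card S')
    (e' : {x : S' // x ≠ s'} ⊕ {y : T // y ≠ t} ≃ U) :
    ∃ e : {x : S // x ≠ s} ⊕ {y : T // y ≠ t} ≃ U,
      (∀ x hx hx', e (Sum.inl ⟨x, hx⟩) = e' (Sum.inl ⟨f x, hx'⟩)) ∧
      (∀ y, e (Sum.inr y) = e' (Sum.inr y)) ∧
      ∀ (x : O.Dec S) (y : O.Dec T), graft s' t hS' e' (Dec.map f x) y = graft s t hS e x y := by
  have : Nonempty T := ⟨t⟩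
  let f' : {x : S // x ≠ s} ≃ {x : S' // x ≠ s'} :=
    f.subtypeEquiv fun y => by rw [← hs, f.injective.ne_iff]
  let e : {x : S // x ≠ s} ⊕ {y : T // y ≠ t} ≃ U := (f'.sumCongr (Equiv.refl _)).trans e'
  refine ⟨e, fun x hx hx' => rfl, fun y => rfl, fun x y => ?_⟩
  have key := graft_map (O := O) f (Equiv.refl T) (Equiv.refl U) hs rfl hS hS' e e'
    (fun _ _ _ => rfl) (fun _ _ _ => rfl) x y
  rw [Dec.map_refl, map_graft] at key
  exact key

end CyclicOperad

namespace LabelledGraph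

universe u w

variable {k : Type u} [CommRing k] {O : CyclicOperad.{u, w} k}

theorem exists_contract_lab_bot (Γ : LabelledGraph O) (t : Γ.H)
    (ht : Γ.att t ≠ Γ.att (Γ.inv t)) {v w : Γ.V} (s : {h // Γ.att h = v}) (s' : {h // Γ.att h = w})
    (hs : s.1 = t) (hs' : s'.1 = Γ.inv t) {z : (Γ.contract t ht).V} (hz : z = (⊥ : Γ.ContractV t)) :
    ∃ e : {x // x ≠ s} ⊕ {y // y ≠ s'} ≃ {h // (Γ.contract t ht).att h = z},
      (∀ x, (e (Sum.inl x)).1.1 = x.1.1) ∧ (∀ y, (e (Sum.inr y)).1.1 = y.1.1) ∧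
      (Γ.contract t ht).lab z =
        CyclicOperad.graft s s' (Γ.two_le_card _) e (Γ.lab v) (Γ.lab w) := by
  obtain ⟨s, rfl⟩ := s
  obtain ⟨s', rfl⟩ := s'
  dsimp only at hs hs'
  subst hs hs' hz
  exact ⟨Γ.contractBot s ht, fun _ => rfl, fun _ => rfl, rfl⟩

theorem exists_contract_lab_coe (Γ : LabelledGraph O) {t : Γ.H} (ht : Γ.att t ≠ Γ.att (Γ.inv t))
    {v : Γ.V} (hv : v ≠ Γ.att t) (hv' : v ≠ Γ.att (Γ.inv t)) {z : (Γ.contract t ht).V}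
    (x : Γ.ContractH t) (hx : Γ.att x = v) (hz : (Γ.contract t ht).att x = z) :
    ∃ e : {h // Γ.att h = v} ≃ {h // (Γ.contract t ht).att h = z}, (∀ x, (e x).1.1 = x.1) ∧
      (Γ.contract t ht).lab z = CyclicOperad.Dec.map e (Γ.lab v) := by
  obtain ⟨e, he⟩ := exists_contractHalvesEquiv Γ ht hv hv' x hx hz
  exact ⟨e, he, Γ.contract_lab_coe t ht hv hv' e he⟩

section

variable (Γ : LabelledGraph O) {t h : Γ.H} (ht : Γ.att t ≠ Γ.att (Γ.inv t))
  (hh : Γ.att h ≠ Γ.att (Γ.inv h)) (h₁ : h ≠ t ∧ h ≠ Γ.inv t) (h₂ : t ≠ h ∧ t ≠ Γ.inv h)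

/-- The edges form a path whose middle vertex is `att h`. Contracting `t` first composes the first
two labels and then the third, contracting `h` first composes the last two and then the first; these
are the two sides of `graft_assoc`. The rest identifies half-edges, all of which are tracked by
their values in `Γ.H`. -/
theorem contract_contract_lab_shared (hb : Γ.att (Γ.inv t) = Γ.att h)
    (hac : Γ.att t ≠ Γ.att (Γ.inv h))
    (ht' : (Γ.contract h hh).att ⟨t, h₂⟩ ≠
      (Γ.contract h hh).att ((Γ.contract h hh).inv ⟨t, h₂⟩))
    (hh' : (Γ.contract t ht).att ⟨h, h₁⟩ ≠
      (Γ.contract t ht).att ((Γ.contract t ht).inv ⟨h, h₁⟩))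
    (e : {x // ((Γ.contract h hh).contract ⟨t, h₂⟩ ht').att x =
        (⊥ : (Γ.contract h hh).ContractV ⟨t, h₂⟩)} ≃
      {x // ((Γ.contract t ht).contract ⟨h, h₁⟩ hh').att x =
        (⊥ : (Γ.contract t ht).ContractV ⟨h, h₁⟩)}) (he : ∀ x, (e x).1.1.1 = x.1.1.1) :
    ((Γ.contract t ht).contract ⟨h, h₁⟩ hh').lab (⊥ : (Γ.contract t ht).ContractV ⟨h, h₁⟩) =
      CyclicOperad.Dec.map e (((Γ.contract h hh).contract ⟨t, h₂⟩ ht').lab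
        (⊥ : (Γ.contract h hh).ContractV ⟨t, h₂⟩)) := by
  -- the labels of `Γ / t` at the endpoints of `h`
  obtain ⟨e₁, hl₁, hr₁, hL₁⟩ := Γ.exists_contract_lab_bot t ht ⟨t, rfl⟩ ⟨Γ.inv t, rfl⟩ rfl rfl
    (z := (Γ.contract t ht).att ⟨h, h₁⟩) ((Γ.contractAtt_eq_bot _ _).2 (Or.inr hb.symm))
  obtain ⟨eC, heC, hLC⟩ := Γ.exists_contract_lab_coe ht (v := Γ.att (Γ.inv h)) hac.symm
    (fun e => hh (hb.symm.trans e.symm)) ((Γ.contract t ht).inv ⟨h, h₁⟩) rfl rfl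
  obtain ⟨e₂', hl₂', hr₂', hL₂⟩ := (Γ.contract t ht).exists_contract_lab_bot ⟨h, h₁⟩ hh' ⟨_, rfl⟩
    ⟨_, rfl⟩ rfl rfl rfl
  -- the labels of `Γ / h` at the endpoints of `t`
  obtain ⟨e₃, hl₃, hr₃, hL₃⟩ := Γ.exists_contract_lab_bot h hh ⟨h, hb.symm⟩ ⟨Γ.inv h, rfl⟩ rfl rfl
    (z := (Γ.contract h hh).att ((Γ.contract h hh).inv ⟨t, h₂⟩))
    ((Γ.contractAtt_eq_bot _ _).2 (Or.inl hb))
  obtain ⟨eA, heA, hLA⟩ := Γ.exists_contract_lab_coe hh (v := Γ.att t)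
    (fun e => ht (e.trans hb.symm))
    hac ⟨t, h₂⟩ rfl rfl
  obtain ⟨e₄', hl₄', hr₄', hL₄⟩ := (Γ.contract h hh).exists_contract_lab_bot ⟨t, h₂⟩ ht' ⟨_, rfl⟩
    ⟨_, rfl⟩ rfl rfl rfl
  obtain ⟨e₂, hl₂, hr₂, hg₂⟩ := CyclicOperad.exists_graft_map_right (O := O)
    (t := ⟨Γ.inv h, rfl⟩) eC
    (Subtype.ext (Subtype.ext (heC _))) ((Γ.contract t ht).two_le_card _) e₂'
  obtain ⟨e₄, hl₄, hr₄, hg₄⟩ := CyclicOperad.exists_graft_map_left (O := O) (s := ⟨t, rfl⟩) eA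
    (Subtype.ext (Subtype.ext (heA _))) (Γ.two_le_card _) ((Γ.contract h hh).two_le_card _) e₄'
  have htu : (⟨Γ.inv t, rfl⟩ : {x // Γ.att x = Γ.att (Γ.inv t)}) ≠ ⟨h, hb.symm⟩ :=
    fun e => h₁.2 (congrArg Subtype.val e).symm
  have hAne : ∀ x : {x // Γ.att x = Γ.att t}, x ≠ ⟨t, rfl⟩ → eA x ≠ ⟨⟨t, h₂⟩, rfl⟩ := by
    intro x hx e
    exact hx (eA.injective (e.trans (Subtype.ext (Subtype.ext (heA ⟨t, rfl⟩).symm))))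
  have hCne : ∀ x : {x // Γ.att x = Γ.att (Γ.inv h)}, x ≠ ⟨Γ.inv h, rfl⟩ →
      eC x ≠ ⟨(Γ.contract t ht).inv ⟨h, h₁⟩, rfl⟩ := by
    intro x hx e
    exact hx (eC.injective (e.trans (Subtype.ext (Subtype.ext (heC ⟨Γ.inv h, rfl⟩).symm))))
  have key := CyclicOperad.graft_assoc (O := O) (Γ.two_le_card _) (Γ.two_le_card _)
    ((Γ.contract t ht).two_le_card _) htu e₁ e₂ e₃ (e₄.trans e)
    (Subtype.ext (Subtype.ext (hr₁ _))) (Subtype.ext (Subtype.ext (hl₃ _)))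
    (fun x hx => Subtype.ext (Subtype.ext (Subtype.ext (by
      refine ((congrArg (fun x => x.1.1.1) (hl₂ _)).trans
        ((congrArg Subtype.val (hl₂' ⟨e₁ (Sum.inl x), hx⟩)).trans (hl₁ x))).trans ?_
      exact ((he _).trans ((congrArg (fun x => x.1.1.1) (hl₄ _ x.2 (hAne _ x.2))).trans
        ((congrArg Subtype.val (hl₄' _)).trans (heA _)))).symm))))
    (fun y hy hy' h3 h4 => Subtype.ext (Subtype.ext (Subtype.ext (by
      refine ((congrArg (fun x => x.1.1.1) (hl₂ _)).trans
        ((congrArg Subtype.val (hl₂' ⟨e₁ (Sum.inr ⟨y, hy⟩), h3⟩)).trans (hr₁ ⟨y, hy⟩))).trans ?_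
      exact ((he _).trans ((congrArg (fun x => x.1.1.1) (hr₄ _)).trans
        ((congrArg Subtype.val (hr₄' _)).trans (hl₃ _)))).symm))))
    (fun z hz => Subtype.ext (Subtype.ext (Subtype.ext (by
      refine ((congrArg (fun x => x.1.1.1) (hr₂ _ z.2 (hCne _ z.2))).trans
        ((congrArg Subtype.val (hr₂' _)).trans (heC _))).trans ?_
      exact ((he _).trans ((congrArg (fun x => x.1.1.1) (hr₄ _)).trans
        ((congrArg Subtype.val (hr₄' _)).trans (hr₃ _)))).symm))))
    (Γ.lab _) (Γ.lab _) (Γ.lab _)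
  rw [hL₂, hL₄, hLA, hLC, hg₂, hg₄, CyclicOperad.map_graft, hL₁, hL₃]
  exact key

/-- The contractions of two edges with one common vertex commute. -/
theorem exists_iso_contract_shared (hb : Γ.att (Γ.inv t) = Γ.att h)
    (hac : Γ.att t ≠ Γ.att (Γ.inv h))
    (ht' : (Γ.contract h hh).att ⟨t, h₂⟩ ≠
      (Γ.contract h hh).att ((Γ.contract h hh).inv ⟨t, h₂⟩))
    (hh' : (Γ.contract t ht).att ⟨h, h₁⟩ ≠
      (Γ.contract t ht).att ((Γ.contract t ht).inv ⟨h, h₁⟩)) :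
    ∃ f : Iso ((Γ.contract h hh).contract ⟨t, h₂⟩ ht') ((Γ.contract t ht).contract ⟨h, h₁⟩ hh'),
      f.sign = 1 := by
  have hiff : ∀ x : ((Γ.contract h hh).contract ⟨t, h₂⟩ ht').H,
      ((Γ.contract h hh).contract ⟨t, h₂⟩ ht').att x =
        (⊥ : (Γ.contract h hh).ContractV ⟨t, h₂⟩) ↔
      Γ.att x.1.1 = Γ.att t ∨ Γ.att x.1.1 = Γ.att h ∨ Γ.att x.1.1 = Γ.att (Γ.inv h) := fun x => by
    rw [contract_contract_att_bot]
    change (_ ∨ _ ∧ (Γ.att t = _ ∨ Γ.att t = _)) ∨ (Γ.att x.1.1 = Γ.att (Γ.inv t) ∨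
      _ ∧ (Γ.att (Γ.inv t) = _ ∨ Γ.att (Γ.inv t) = _)) ↔ _
    rw [hb] at ht ⊢
    tauto
  have hiff' : ∀ x : ((Γ.contract t ht).contract ⟨h, h₁⟩ hh').H,
      ((Γ.contract t ht).contract ⟨h, h₁⟩ hh').att x =
        (⊥ : (Γ.contract t ht).ContractV ⟨h, h₁⟩) ↔
      Γ.att x.1.1 = Γ.att t ∨ Γ.att x.1.1 = Γ.att h ∨ Γ.att x.1.1 = Γ.att (Γ.inv h) := fun x => by
    rw [contract_contract_att_bot]
    change (_ ∨ _ ∧ (Γ.att h = _ ∨ Γ.att h = _)) ∨ (Γ.att x.1.1 = Γ.att (Γ.inv h) ∨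
      _ ∧ (Γ.att (Γ.inv h) = _ ∨ Γ.att (Γ.inv h) = _)) ↔ _
    have := hac.symm
    have := hh.symm
    rw [← hb] at *
    tauto
  have hatt : ∀ x y, ((Γ.contract h hh).contract ⟨t, h₂⟩ ht').att x =
      ((Γ.contract h hh).contract ⟨t, h₂⟩ ht').att y ↔
      ((Γ.contract t ht).contract ⟨h, h₁⟩ hh').att (Γ.contractSwapHalf ht hh h₁ h₂ ht' hh' x) =
      ((Γ.contract t ht).contract ⟨h, h₁⟩ hh').att (Γ.contractSwapHalf ht hh h₁ h₂ ht' hh' y) := by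
    intro x y
    rw [contract_contract_att_eq_iff, contract_contract_att_eq_iff, hiff, hiff, hiff', hiff']
    change _ ↔ (Γ.att x.1.1 = Γ.att y.1.1 ∨ (Γ.att x.1.1 = _ ∨ Γ.att x.1.1 = _) ∧
      (Γ.att y.1.1 = _ ∨ Γ.att y.1.1 = _)) ∨ (Γ.att x.1.1 = _ ∨ Γ.att x.1.1 = _ ∨ _) ∧
      (Γ.att y.1.1 = _ ∨ Γ.att y.1.1 = _ ∨ _)
    rw [hb]
    tauto
  have hlab : ∀ v w (e : {x // ((Γ.contract h hh).contract ⟨t, h₂⟩ ht').att x = v} ≃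
      {x // ((Γ.contract t ht).contract ⟨h, h₁⟩ hh').att x = w}),
      (∀ x, (e x).1 = Γ.contractSwapHalf ht hh h₁ h₂ ht' hh' x) →
      ((Γ.contract t ht).contract ⟨h, h₁⟩ hh').lab w =
        CyclicOperad.Dec.map e (((Γ.contract h hh).contract ⟨t, h₂⟩ ht').lab v) := by
    intro v w e he
    have he' : ∀ x, (e x).1.1.1 = x.1.1.1 := fun x => congrArg (fun x => x.1.1) (he x)
    obtain ⟨x⟩ := nonempty_halves _ v
    by_cases hx : Γ.att x.1.1.1 = Γ.att t ∨ Γ.att x.1.1.1 = Γ.att h ∨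
      Γ.att x.1.1.1 = Γ.att (Γ.inv h)
    · obtain rfl : v = (⊥ : (Γ.contract h hh).ContractV ⟨t, h₂⟩) := x.2.symm.trans ((hiff _).2 hx)
      obtain rfl : w = (⊥ : (Γ.contract t ht).ContractV ⟨h, h₁⟩) :=
        (e x).2.symm.trans ((hiff' _).2 (by rwa [he']))
      exact contract_contract_lab_shared Γ ht hh h₁ h₂ hb hac ht' hh' e he'
    · have hx₁ : Γ.att x.1.1.1 ≠ Γ.att t := fun e => hx (Or.inl e)
      have hx₂ : Γ.att x.1.1.1 ≠ Γ.att h := fun e => hx (Or.inr (Or.inl e))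
      have hx₃ : Γ.att x.1.1.1 ≠ Γ.att (Γ.inv h) := fun e => hx (Or.inr (Or.inr e))
      have hx₄ : Γ.att x.1.1.1 ≠ Γ.att (Γ.inv t) := fun e => hx₂ (e.trans hb)
      obtain ⟨e₁, he₁, hl₁⟩ := Γ.contract_contract_lab_other hh _ ht' x.1 x.2 hx₂ hx₃ hx₁ hx₄
      obtain ⟨e₂, he₂, hl₂⟩ := Γ.contract_contract_lab_other ht _ hh'
        (Γ.contractSwapHalf ht hh h₁ h₂ ht' hh' x.1) (v := w) (by rw [← he]; exact (e x).2)
        hx₁ hx₄ hx₂ hx₃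
      rw [hl₁, hl₂, CyclicOperad.Dec.map_map]
      exact congrArg (fun e => CyclicOperad.Dec.map e (Γ.lab (Γ.att x.1.1.1)))
        (Equiv.ext fun y => Subtype.ext (Subtype.ext (Subtype.ext
          ((he₂ y).trans ((he' _).trans (he₁ y)).symm))))
  let f := Iso.ofHalf (Γ.contractSwapHalf ht hh h₁ h₂ ht' hh') hatt (fun _ => rfl) hlab
  refine ⟨f, ?_⟩
  rw [f.sign_of_out_eq fun _ => rfl]
  have hf : ∀ x, f.vert (((Γ.contract h hh).contract ⟨t, h₂⟩ ht').att x) =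
      ((Γ.contract t ht).contract ⟨h, h₁⟩ hh').att (Γ.contractSwapHalf ht hh h₁ h₂ ht' hh' x) :=
    fun x => (f.att_half x).symm
  have f₁ : f.vert (⊥ : (Γ.contract h hh).ContractV ⟨t, h₂⟩) =
      (⊥ : (Γ.contract t ht).ContractV ⟨h, h₁⟩) := by
    obtain ⟨x, hx⟩ := att_surjective ((Γ.contract h hh).contract ⟨t, h₂⟩ ht')
      (⊥ : (Γ.contract h hh).ContractV ⟨t, h₂⟩)
    rw [← hx, hf]
    exact (hiff' _).2 ((hiff x).1 hx)
  -- The vertex created by the first contraction is an endpoint of the second edge, so it is not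
  -- among the remaining old vertices.
  have f₂ : ∀ q : (⊥ : Γ.ContractV h) ≠ (Γ.contract h hh).att ⟨t, h₂⟩ ∧
      (⊥ : Γ.ContractV h) ≠ (Γ.contract h hh).att ((Γ.contract h hh).inv ⟨t, h₂⟩), False :=
    fun q => q.2 ((Γ.contractAtt_eq_bot _ _).2 (Or.inl hb)).symm
  have f₃ : ∀ (u : {v // v ≠ Γ.att h ∧ v ≠ Γ.att (Γ.inv h)})
      (q : (u : Γ.ContractV h) ≠ (Γ.contract h hh).att ⟨t, h₂⟩ ∧
          (u : Γ.ContractV h) ≠ (Γ.contract h hh).att ((Γ.contract h hh).inv ⟨t, h₂⟩)),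
      ∃ (u' : {v // v ≠ Γ.att t ∧ v ≠ Γ.att (Γ.inv t)})
        (q' : (u' : Γ.ContractV t) ≠ (Γ.contract t ht).att ⟨h, h₁⟩ ∧
          (u' : Γ.ContractV t) ≠ (Γ.contract t ht).att ((Γ.contract t ht).inv ⟨h, h₁⟩)),
      u'.1 = u.1 ∧ f.vert ((⟨(u : Γ.ContractV h), q⟩ : {v // v ≠ (Γ.contract h hh).att ⟨t, h₂⟩ ∧
          v ≠ (Γ.contract h hh).att ((Γ.contract h hh).inv ⟨t, h₂⟩)}) :
          (Γ.contract h hh).ContractV ⟨t, h₂⟩) =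
        ((⟨(u' : Γ.ContractV t), q'⟩ : {v // v ≠ (Γ.contract t ht).att ⟨h, h₁⟩ ∧
          v ≠ (Γ.contract t ht).att ((Γ.contract t ht).inv ⟨h, h₁⟩)}) :
          (Γ.contract t ht).ContractV ⟨h, h₁⟩) := by
    intro u q
    obtain ⟨x, hx⟩ := att_surjective ((Γ.contract h hh).contract ⟨t, h₂⟩ ht')
      ((⟨(u : Γ.ContractV h), q⟩ : {v // v ≠ (Γ.contract h hh).att ⟨t, h₂⟩ ∧
          v ≠ (Γ.contract h hh).att ((Γ.contract h hh).inv ⟨t, h₂⟩)}) :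
          (Γ.contract h hh).ContractV ⟨t, h₂⟩)
    have hu : Γ.att x.1.1 = u := (contract_contract_att_coe Γ hh _ ht' _ _ _).1 hx
    have hn : ¬ (Γ.att x.1.1 = Γ.att t ∨ Γ.att x.1.1 = Γ.att h ∨ Γ.att x.1.1 = Γ.att (Γ.inv h)) :=
      fun e => WithBot.bot_ne_coe (((hiff x).2 e).symm.trans hx)
    obtain ⟨u', q', h3, h4⟩ := exists_contract_contract_att_eq Γ ht _ hh'
      (Γ.contractSwapHalf ht hh h₁ h₂ ht' hh' x) (fun e => hn (Or.inl e))
      (fun e => hn (Or.inr (Or.inl (e.trans hb))))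
      (fun e => u.2.1 (hu.symm.trans e)) (fun e => u.2.2 (hu.symm.trans e))
    refine ⟨u', q', h3.trans hu, ?_⟩
    rw [← hx, hf]
    exact h4
  -- In both graphs the single new vertex is first, and the others have the order of `Γ`.
  refine orderSign_of_strictMono fun r s => ?_
  cases s using WithBot.recBotCoe with
  | bot => exact fun hrs => absurd hrs (WithBot.not_lt_bot _)
  | coe s =>
    obtain ⟨s, q⟩ := s
    cases s using WithBot.recBotCoe with
    | bot => exact (f₂ q).elim
    | coe s =>
      obtain ⟨s', q₁', h3, h4⟩ := f₃ s q
      cases r using WithBot.recBotCoe with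
      | bot => exact fun _ => (f₁.trans_lt (WithBot.bot_lt_coe _)).trans_eq h4.symm
      | coe r =>
        obtain ⟨r, q'⟩ := r
        cases r using WithBot.recBotCoe with
        | bot => exact (f₂ q').elim
        | coe r =>
          intro hrs
          obtain ⟨r', q₂', h5, h6⟩ := f₃ r q'
          refine (h6.trans_lt ?_).trans_eq h4.symm
          refine WithBot.coe_lt_coe.2 (Subtype.mk_lt_mk.2 (WithBot.coe_lt_coe.2 ?_))
          rw [← Subtype.coe_lt_coe, h5, h3, Subtype.coe_lt_coe]
          exact WithBot.coe_lt_coe.1 (Subtype.mk_lt_mk.1 ((WithBot.coe_lt_coe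
            (α := {v : (Γ.contract h hh).V // v ≠ (Γ.contract h hh).att ⟨t, h₂⟩ ∧
              v ≠ (Γ.contract h hh).att ((Γ.contract h hh).inv ⟨t, h₂⟩)})).1 hrs))

end

end LabelledGraph

/-! ### Antisymmetry of the double contraction -/

namespace LabelledGraph

universe u w

variable {k : Type u} [CommRing k] {O : CyclicOperad.{u, w} k}

theorem signedContraction_of_loop {Γ : LabelledGraph O} {t : Γ.H}
    (ht : Γ.att t = Γ.att (Γ.inv t)) : Γ.signedContraction t = 0 := by
  rw [signedContraction, contractCls_of_loop ht, smul_zero]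

theorem signedContraction_of_ne {Γ : LabelledGraph O} {t : Γ.H}
    (ht : Γ.att t ≠ Γ.att (Γ.inv t)) : Γ.signedContraction t =
      (Γ.dir t * (firstSign (Γ.att t) * firstSign (Γ.att (Γ.inv t)) *
        ltSign (Γ.att t) (Γ.att (Γ.inv t)))) • (Γ.contract t ht).cls := by
  rw [signedContraction, contractCls_of_ne ht, smul_smul, frontSign_eq _ ht]

/-- The signed contraction of two edges, one after the other. -/
noncomputable def doubleContraction (Γ : LabelledGraph O) (t h : Γ.H) : GraphComplex O :=
  if ht : Γ.att t ≠ Γ.att (Γ.inv t) then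
    if hh : h ≠ t ∧ h ≠ Γ.inv t then
      (Γ.dir t * Γ.frontSign (Γ.att t) (Γ.att (Γ.inv t))) •
        (Γ.contract t ht).signedContraction ⟨h, hh⟩
    else 0
  else 0

theorem doubleContraction_of_ne {Γ : LabelledGraph O} {t h : Γ.H} (ht : Γ.att t ≠ Γ.att (Γ.inv t))
    (hh : h ≠ t ∧ h ≠ Γ.inv t) : Γ.doubleContraction t h =
      (Γ.dir t * Γ.frontSign (Γ.att t) (Γ.att (Γ.inv t))) •
        (Γ.contract t ht).signedContraction ⟨h, hh⟩ := by
  rw [doubleContraction, dif_pos ht, dif_pos hh]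

theorem doubleContraction_of_loop {Γ : LabelledGraph O} {t h : Γ.H}
    (ht : Γ.att t = Γ.att (Γ.inv t)) : Γ.doubleContraction t h = 0 := by
  rw [doubleContraction, dif_neg (not_not.2 ht)]

theorem doubleContraction_of_eq {Γ : LabelledGraph O} {t h : Γ.H}
    (hh : h = t ∨ h = Γ.inv t) : Γ.doubleContraction t h = 0 := by
  rw [doubleContraction]
  split_ifs with h1 h2
  · tauto
  · rfl
  · rfl

/-- After the first contraction the second edge is a loop, either because it was one or because both
its ends lie at endpoints of the first edge. -/
theorem doubleContraction_of_att_eq {Γ : LabelledGraph O} {t h : Γ.H}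
    (hh : Γ.att h = Γ.att (Γ.inv h) ∨ (Γ.att h = Γ.att t ∨ Γ.att h = Γ.att (Γ.inv t)) ∧
      (Γ.att (Γ.inv h) = Γ.att t ∨ Γ.att (Γ.inv h) = Γ.att (Γ.inv t))) :
    Γ.doubleContraction t h = 0 := by
  rw [doubleContraction]
  split_ifs with h1 h2
  · exact (congrArg _ (signedContraction_of_loop ((Γ.contract_att_eq_iff t h1 _ _).2 hh))).trans
      (smul_zero _)
  · rfl
  · rfl

theorem doubleContraction_inv_right (Γ : LabelledGraph O) (t h : Γ.H) :
    Γ.doubleContraction t (Γ.inv h) = Γ.doubleContraction t h := by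
  by_cases ht : Γ.att t = Γ.att (Γ.inv t)
  · rw [doubleContraction_of_loop ht, doubleContraction_of_loop ht]
  by_cases hh : h ≠ t ∧ h ≠ Γ.inv t
  · rw [doubleContraction_of_ne ht hh, doubleContraction_of_ne ht (inv_other hh.1 hh.2)]
    exact congrArg _ ((Γ.contract t ht).signedContraction_inv ⟨h, hh⟩)
  · rw [not_and_or, not_not, not_not] at hh
    rw [doubleContraction_of_eq hh, doubleContraction_of_eq]
    rcases hh with rfl | rfl
    · exact Or.inr rfl
    · exact Or.inl (Γ.inv_inv t)

theorem doubleContraction_inv_left (Γ : LabelledGraph O) (t h : Γ.H) :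
    Γ.doubleContraction (Γ.inv t) h = Γ.doubleContraction t h := by
  by_cases ht : Γ.att t = Γ.att (Γ.inv t)
  · rw [doubleContraction_of_loop ht, doubleContraction_of_loop (by rw [Γ.inv_inv, ht])]
  by_cases hh : h ≠ t ∧ h ≠ Γ.inv t
  · have ht' : Γ.att (Γ.inv t) ≠ Γ.att (Γ.inv (Γ.inv t)) := by
      rw [Γ.inv_inv]
      exact Ne.symm ht
    have hh' : h ≠ Γ.inv t ∧ h ≠ Γ.inv (Γ.inv t) := by rwa [Γ.inv_inv, and_comm]
    obtain ⟨g, h1, h2⟩ := Γ.exists_iso_contract_inv t ht ht'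
    have h3 : Γ.dir (Γ.inv t) * Γ.frontSign (Γ.att (Γ.inv t)) (Γ.att (Γ.inv (Γ.inv t))) =
        Γ.dir t * Γ.frontSign (Γ.att t) (Γ.att (Γ.inv t)) := by
      rw [Γ.dir_inv, Γ.inv_inv, frontSign_swap Γ ht, neg_mul_neg]
    rw [doubleContraction_of_ne ht hh, doubleContraction_of_ne ht' hh', h3]
    refine congrArg _ ((g.signedContraction_eq _).trans ?_)
    rw [h1, one_smul]
    exact congrArg _ (Subtype.ext (h2 _))
  · rw [not_and_or, not_not, not_not] at hh
    rw [doubleContraction_of_eq hh, doubleContraction_of_eq]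
    rw [Γ.inv_inv]
    exact hh.symm

theorem doubleContraction_eq {Γ : LabelledGraph O} {t h : Γ.H} (ht : Γ.att t ≠ Γ.att (Γ.inv t))
    (h₁ : h ≠ t ∧ h ≠ Γ.inv t) (hh' : (Γ.contract t ht).att ⟨h, h₁⟩ ≠
      (Γ.contract t ht).att ((Γ.contract t ht).inv ⟨h, h₁⟩)) :
    Γ.doubleContraction t h = (Γ.dir t * Γ.dir h * (firstSign (Γ.att t) *
      firstSign (Γ.att (Γ.inv t)) * ltSign (Γ.att t) (Γ.att (Γ.inv t)) *
      (firstSign ((Γ.contract t ht).att ⟨h, h₁⟩) *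
        firstSign ((Γ.contract t ht).att ((Γ.contract t ht).inv ⟨h, h₁⟩)) *
        ltSign ((Γ.contract t ht).att ⟨h, h₁⟩)
          ((Γ.contract t ht).att ((Γ.contract t ht).inv ⟨h, h₁⟩))))) •
      ((Γ.contract t ht).contract ⟨h, h₁⟩ hh').cls := by
  refine (doubleContraction_of_ne ht h₁).trans
    ((congrArg _ (signedContraction_of_ne hh')).trans ?_)
  rw [smul_smul, frontSign_eq _ ht]
  congr 1
  have : (Γ.contract t ht).dir ⟨h, h₁⟩ = Γ.dir h := rfl
  rw [this]
  ring

theorem firstSign_contract_coe (Γ : LabelledGraph O) {t : Γ.H} (ht : Γ.att t ≠ Γ.att (Γ.inv t))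
    {x : Γ.ContractH t} {v : (Γ.contract t ht).V} (hv : (Γ.contract t ht).att x = v)
    (h1 : Γ.att x ≠ Γ.att t) (h2 : Γ.att x ≠ Γ.att (Γ.inv t)) :
    firstSign v = -(firstSign (Γ.att x) * ltSign (Γ.att t) (Γ.att x) *
      ltSign (Γ.att (Γ.inv t)) (Γ.att x)) := by
  obtain rfl : v = ((⟨Γ.att x, h1, h2⟩ : {v // v ≠ Γ.att t ∧ v ≠ Γ.att (Γ.inv t)}) :
      Γ.ContractV t) := hv.symm.trans ((Γ.contractAtt_eq_coe t x _).2 rfl)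
  exact firstSign_coe ht _

/-- The isomorphism of the two results has sign `-1`. The coefficients agree: they differ by the
reversal of four comparisons, one for each endpoint of `t` and each endpoint of `h`. -/
theorem doubleContraction_comm_disjoint (Γ : LabelledGraph O) {t h : Γ.H}
    (ht : Γ.att t ≠ Γ.att (Γ.inv t)) (hh : Γ.att h ≠ Γ.att (Γ.inv h))
    (hd₁ : Γ.att t ≠ Γ.att h) (hd₂ : Γ.att t ≠ Γ.att (Γ.inv h))
    (hd₃ : Γ.att (Γ.inv t) ≠ Γ.att h) (hd₄ : Γ.att (Γ.inv t) ≠ Γ.att (Γ.inv h)) :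
    Γ.doubleContraction t h = -Γ.doubleContraction h t := by
  have h₁ : h ≠ t ∧ h ≠ Γ.inv t := ⟨fun e => hd₁ (by rw [e]), fun e => hd₃ (by rw [e])⟩
  have h₂ : t ≠ h ∧ t ≠ Γ.inv h := ⟨fun e => hd₁ (by rw [e]), fun e => hd₂ (by rw [← e])⟩
  have ht' : (Γ.contract h hh).att ⟨t, h₂⟩ ≠
      (Γ.contract h hh).att ((Γ.contract h hh).inv ⟨t, h₂⟩) := fun e => by
    have := (Γ.contract_att_eq_iff _ _ _ _).1 e
    exact this.elim ht fun h => h.1.elim hd₁ hd₂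
  have hh' : (Γ.contract t ht).att ⟨h, h₁⟩ ≠
      (Γ.contract t ht).att ((Γ.contract t ht).inv ⟨h, h₁⟩) := fun e => by
    have := (Γ.contract_att_eq_iff _ _ _ _).1 e
    exact this.elim hh fun h => h.1.elim hd₁.symm hd₃.symm
  obtain ⟨f, hf⟩ := exists_iso_contract_disjoint Γ ht hh h₁ h₂ hd₁ hd₂ hd₃ hd₄ ht' hh'
  have c₁ : ∀ (t h : Γ.H) (ht : Γ.att t ≠ Γ.att (Γ.inv t)) (h₁ : h ≠ t ∧ h ≠ Γ.inv t),
      Γ.att h ≠ Γ.att t → Γ.att h ≠ Γ.att (Γ.inv t) → Γ.att (Γ.inv h) ≠ Γ.att t →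
      Γ.att (Γ.inv h) ≠ Γ.att (Γ.inv t) → ltSign ((Γ.contract t ht).att ⟨h, h₁⟩)
          ((Γ.contract t ht).att ((Γ.contract t ht).inv ⟨h, h₁⟩)) =
        ltSign (Γ.att h) (Γ.att (Γ.inv h)) := by
    intro t h ht h₁ hd₁ hd₂ hd₃ hd₄
    have e₁ := (Γ.contractAtt_eq_coe t ⟨h, h₁⟩ ⟨_, hd₁, hd₂⟩).2 rfl
    have e₂ := (Γ.contractAtt_eq_coe t ((Γ.contract t ht).inv ⟨h, h₁⟩) ⟨_, hd₃, hd₄⟩).2 rfl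
    change ltSign (Γ.contractAtt t _) (Γ.contractAtt t _) = _
    rw [e₁, e₂]
    exact ltSign_coe_coe _ _
  rw [doubleContraction_eq ht h₁ hh', doubleContraction_eq hh h₂ ht',
    c₁ t h ht h₁ hd₁.symm hd₃.symm hd₂.symm hd₄.symm, c₁ h t hh h₂ hd₁ hd₂ hd₃ hd₄,
    Γ.firstSign_contract_coe ht (x := ⟨h, h₁⟩) rfl hd₁.symm hd₃.symm,
    Γ.firstSign_contract_coe ht (x := (Γ.contract t ht).inv ⟨h, h₁⟩) rfl hd₂.symm hd₄.symm,
    Γ.firstSign_contract_coe hh (x := ⟨t, h₂⟩) rfl hd₁ hd₂,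
    Γ.firstSign_contract_coe hh (x := (Γ.contract h hh).inv ⟨t, h₂⟩) rfl hd₃ hd₄, f.cls_eq, hf,
    neg_one_smul, smul_neg, neg_neg]
  congr 1
  change _ * (_ * (-(firstSign (Γ.att h) * ltSign (Γ.att t) (Γ.att h) * _) *
    -(firstSign (Γ.att (Γ.inv h)) * ltSign (Γ.att t) (Γ.att (Γ.inv h)) *
      ltSign _ (Γ.att (Γ.inv h))) * _)) = _ * (_ * (-(firstSign (Γ.att t) *
      ltSign _ (Γ.att t) * _) * -(firstSign (Γ.att (Γ.inv t)) * ltSign _ (Γ.att (Γ.inv t)) *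
      ltSign (Γ.att (Γ.inv h)) (Γ.att (Γ.inv t))) * _))
  rw [ltSign_swap hd₁, ltSign_swap hd₂, ltSign_swap hd₃, ltSign_swap hd₄]
  ring

/-- The isomorphism of the two results has sign `1`, so the sign must come from the coefficients.
With the path directed from `a` through `b` to `c`, the second edge runs from the new vertex to `c`
in one order and from `a` to the new vertex in the other. As the new vertex is first, `ltSign` is
`-1` in one case and `1` in the other; the two reversed comparisons with `a` cancel. -/
theorem doubleContraction_comm_shared (Γ : LabelledGraph O) {t h : Γ.H}
    (ht : Γ.att t ≠ Γ.att (Γ.inv t)) (hh : Γ.att h ≠ Γ.att (Γ.inv h))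
    (hb : Γ.att (Γ.inv t) = Γ.att h) (hac : Γ.att t ≠ Γ.att (Γ.inv h)) (hth : h ≠ Γ.inv t) :
    Γ.doubleContraction t h = -Γ.doubleContraction h t := by
  have hab : Γ.att t ≠ Γ.att h := fun e => ht (e.trans hb.symm)
  have hbc : Γ.att (Γ.inv t) ≠ Γ.att (Γ.inv h) := fun e => hh (hb.symm.trans e)
  have h₁ : h ≠ t ∧ h ≠ Γ.inv t := ⟨fun e => hab (by rw [e]), hth⟩
  have h₂ : t ≠ h ∧ t ≠ Γ.inv h := ⟨h₁.1.symm, fun e => hth (by rw [e, Γ.inv_inv])⟩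
  have ht' : (Γ.contract h hh).att ⟨t, h₂⟩ ≠
      (Γ.contract h hh).att ((Γ.contract h hh).inv ⟨t, h₂⟩) := fun e => by
    have := (Γ.contract_att_eq_iff _ _ _ _).1 e
    exact this.elim ht fun h => h.1.elim hab hac
  have hh' : (Γ.contract t ht).att ⟨h, h₁⟩ ≠
      (Γ.contract t ht).att ((Γ.contract t ht).inv ⟨h, h₁⟩) := fun e => by
    have := (Γ.contract_att_eq_iff _ _ _ _).1 e
    exact this.elim hh fun h => h.2.elim hac.symm hbc.symm
  obtain ⟨f, hf⟩ := exists_iso_contract_shared Γ ht hh h₁ h₂ hb hac ht' hh'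
  have e₁ : (Γ.contract t ht).att ⟨h, h₁⟩ = (⊥ : Γ.ContractV t) :=
    (Γ.contractAtt_eq_bot _ _).2 (Or.inr hb.symm)
  have e₂ : (Γ.contract h hh).att ((Γ.contract h hh).inv ⟨t, h₂⟩) = (⊥ : Γ.ContractV h) :=
    (Γ.contractAtt_eq_bot _ _).2 (Or.inl hb)
  have e₃ : (Γ.contract t ht).att ((Γ.contract t ht).inv ⟨h, h₁⟩) =
      ((⟨_, hac.symm, hbc.symm⟩ : {v // v ≠ Γ.att t ∧ v ≠ Γ.att (Γ.inv t)}) : Γ.ContractV t) :=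
    (Γ.contractAtt_eq_coe _ _ _).2 rfl
  have e₄ : (Γ.contract h hh).att ⟨t, h₂⟩ =
      ((⟨_, hab, hac⟩ : {v // v ≠ Γ.att h ∧ v ≠ Γ.att (Γ.inv h)}) : Γ.ContractV h) :=
    (Γ.contractAtt_eq_coe _ _ _).2 rfl
  have l₁ : ltSign ((Γ.contract t ht).att ⟨h, h₁⟩)
      ((Γ.contract t ht).att ((Γ.contract t ht).inv ⟨h, h₁⟩)) = -1 :=
    (congrArg₂ ltSign e₁ e₃).trans (ltSign_bot_coe _)
  have l₂ : ltSign ((Γ.contract h hh).att ⟨t, h₂⟩)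
      ((Γ.contract h hh).att ((Γ.contract h hh).inv ⟨t, h₂⟩)) = 1 :=
    (congrArg₂ ltSign e₄ e₂).trans (ltSign_coe_bot _)
  have f₁ : firstSign ((Γ.contract t ht).att ⟨h, h₁⟩) = 1 :=
    (congrArg firstSign e₁).trans firstSign_bot
  have f₂ : firstSign ((Γ.contract h hh).att ((Γ.contract h hh).inv ⟨t, h₂⟩)) = 1 :=
    (congrArg firstSign e₂).trans firstSign_bot
  rw [doubleContraction_eq ht h₁ hh', doubleContraction_eq hh h₂ ht', l₁, l₂, f₁, f₂,
    Γ.firstSign_contract_coe ht (x := (Γ.contract t ht).inv ⟨h, h₁⟩) rfl hac.symm hbc.symm,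
    Γ.firstSign_contract_coe hh (x := ⟨t, h₂⟩) rfl hab hac, f.cls_eq, hf, one_smul, ← neg_smul]
  congr 1
  change _ * (_ * (_ * -(firstSign (Γ.att (Γ.inv h)) * ltSign (Γ.att t) (Γ.att (Γ.inv h)) *
      ltSign _ (Γ.att (Γ.inv h))) * _)) = -(_ * (_ * (-(firstSign (Γ.att t) *
      ltSign _ (Γ.att t) * ltSign (Γ.att (Γ.inv h)) (Γ.att t)) * _ * _)))
  rw [hb, ltSign_swap hab, ltSign_swap hac]
  ring

theorem doubleContraction_comm (Γ : LabelledGraph O) (t h : Γ.H) :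
    Γ.doubleContraction t h = -Γ.doubleContraction h t := by
  by_cases ht : Γ.att t = Γ.att (Γ.inv t)
  · rw [doubleContraction_of_loop ht, doubleContraction_of_att_eq (Or.inl ht), neg_zero]
  by_cases hh : Γ.att h = Γ.att (Γ.inv h)
  · rw [doubleContraction_of_loop hh, doubleContraction_of_att_eq (Or.inl hh), neg_zero]
  -- Parallel edges: whichever is contracted first, the other one becomes a loop.
  by_cases hp : (Γ.att h = Γ.att t ∨ Γ.att h = Γ.att (Γ.inv t)) ∧
      (Γ.att (Γ.inv h) = Γ.att t ∨ Γ.att (Γ.inv h) = Γ.att (Γ.inv t))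
  · have hp' : (Γ.att t = Γ.att h ∨ Γ.att t = Γ.att (Γ.inv h)) ∧
        (Γ.att (Γ.inv t) = Γ.att h ∨ Γ.att (Γ.inv t) = Γ.att (Γ.inv h)) := by
      grind
    rw [doubleContraction_of_att_eq (Or.inr hp), doubleContraction_of_att_eq (Or.inr hp'), neg_zero]
  -- The common vertex can be either end of either edge. Reversing edges reduces all four cases to
  -- the one where the head of `t` is the tail of `h`.
  by_cases hb : Γ.att (Γ.inv t) = Γ.att h
  · refine Γ.doubleContraction_comm_shared ht hh hb (fun e => hp ⟨Or.inr hb.symm, Or.inl e.symm⟩) ?_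
    rintro rfl
    rw [Γ.inv_inv] at hp
    tauto
  by_cases hb₂ : Γ.att (Γ.inv t) = Γ.att (Γ.inv h)
  · rw [← doubleContraction_inv_right, ← doubleContraction_inv_left Γ h]
    refine Γ.doubleContraction_comm_shared ht (by rw [Γ.inv_inv]; exact Ne.symm hh) hb₂
      (fun e => hp ⟨Or.inl (by rw [e, Γ.inv_inv]), Or.inr hb₂.symm⟩) ?_
    intro e
    rw [← Γ.inv_inv h, e, Γ.inv_inv] at hp
    tauto
  by_cases hb₃ : Γ.att t = Γ.att h
  · rw [← doubleContraction_inv_left, ← doubleContraction_inv_right Γ h]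
    refine Γ.doubleContraction_comm_shared (by rw [Γ.inv_inv]; exact Ne.symm ht) hh
      (by rw [Γ.inv_inv, hb₃]) hb₂ ?_
    rw [Γ.inv_inv]
    rintro rfl
    tauto
  by_cases hb₄ : Γ.att t = Γ.att (Γ.inv h)
  · rw [← doubleContraction_inv_left, ← doubleContraction_inv_right Γ h,
      ← doubleContraction_inv_right, ← doubleContraction_inv_left Γ h]
    refine Γ.doubleContraction_comm_shared (by rw [Γ.inv_inv]; exact Ne.symm ht)
      (by rw [Γ.inv_inv]; exact Ne.symm hh) (by rw [Γ.inv_inv, hb₄]) (by rwa [Γ.inv_inv]) ?_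
    rw [Γ.inv_inv]
    rintro rfl
    rw [Γ.inv_inv] at hp
    tauto
  exact Γ.doubleContraction_comm_disjoint ht hh hb₃ hb₄ hb hb₂

end LabelledGraph

/-! ### The square of the boundary operator -/

namespace LabelledGraph

universe u w

variable {k : Type u} [Field k] [CharZero k] {O : CyclicOperad.{u, w} k}

theorem IsBoundary.apply_signedContraction {d : GraphComplex O →ₗ[k] GraphComplex O}
    (hd : IsBoundary O d) (Γ : LabelledGraph O) (t : Γ.H) :
    d (Γ.signedContraction t) = (1 / 2 : k) • ∑ h, Γ.doubleContraction t h := by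
  by_cases ht : Γ.att t = Γ.att (Γ.inv t)
  · rw [signedContraction, contractCls_of_loop ht, smul_zero, map_zero,
      Finset.sum_eq_zero fun h _ => doubleContraction_of_loop ht, smul_zero]
  rw [signedContraction, contractCls_of_ne ht, smul_smul, map_zsmul, IsBoundary.apply_cls hd,
    smul_comm]
  congr 1
  rw [Finset.smul_sum, ← Finset.sum_subset (Finset.subset_univ
    (Finset.univ.filter fun h => h ≠ t ∧ h ≠ Γ.inv t)),
    Finset.sum_subtype (p := fun h => h ≠ t ∧ h ≠ Γ.inv t) _ (by simp)]
  · exact Fintype.sum_congr _ _ fun h => (doubleContraction_of_ne ht h.2).symm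
  · intro h _ hh
    refine doubleContraction_of_eq ?_
    simp only [Finset.mem_filter, Finset.mem_univ, true_and] at hh
    tauto

/-- The boundary operator has square zero. -/
theorem IsBoundary.comp_self {d : GraphComplex O →ₗ[k] GraphComplex O} (hd : IsBoundary O d) :
    d ∘ₗ d = 0 := by
  refine ext_cls fun Γ => ?_
  rw [LinearMap.comp_apply, IsBoundary.apply_cls hd, map_smul, map_sum,
    Finset.sum_congr rfl fun t _ => IsBoundary.apply_signedContraction hd Γ t, ← Finset.smul_sum]
  -- An antisymmetric double sum equals its negative, so it vanishes as two is invertible.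
  have h : ∑ t, ∑ h, Γ.doubleContraction t h = -∑ t, ∑ h, Γ.doubleContraction t h := by
    conv_lhs => rw [Finset.sum_comm]
    simp_rw [← Finset.sum_neg_distrib]
    exact Finset.sum_congr rfl fun t _ => Finset.sum_congr rfl fun h _ =>
      Γ.doubleContraction_comm h t
  have h2 : ∑ t, ∑ h, Γ.doubleContraction t h = 0 := by
    have h3 : (2 : k) • ∑ t, ∑ h, Γ.doubleContraction t h = 0 := by
      rw [two_smul]
      nth_rw 1 [h]
      exact neg_add_cancel _
    exact (smul_eq_zero.1 h3).resolve_left two_ne_zero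
  rw [h2, smul_zero, smul_zero]
  rfl

end LabelledGraph

/-! ### Graded symmetric powers -/

/-- Multilinear maps which agree on spanning sets are equal. -/
theorem MultilinearMap.eq_of_mem_span {k ι M N : Type*} [CommSemiring k] [Finite ι]
    [AddCommMonoid M] [AddCommMonoid N] [Module k M] [Module k N]
    {f g : MultilinearMap k (fun _ : ι => M) N} (s : ι → Set M)
    (h : ∀ x, (∀ l, x l ∈ s l) → f x = g x) (x : ι → M)
    (hx : ∀ l, x l ∈ Submodule.span k (s l)) : f x = g x := by
  classical
  have := Fintype.ofFinite ι
  -- Induction on the set `T` of places where the argument may be in the span; elsewhere it is in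
  -- the spanning set.
  have key : ∀ (T : Finset ι) (x : ι → M), (∀ l ∈ T, x l ∈ Submodule.span k (s l)) →
      (∀ l, l ∉ T → x l ∈ s l) → f x = g x := by
    intro T
    induction T using Finset.induction_on with
    | empty => exact fun x _ hx => h x fun l => hx l (Finset.notMem_empty l)
    | insert a T ha ih =>
      intro x h1 h2
      have h3 : ∀ y ∈ Submodule.span k (s a),
          f (Function.update x a y) = g (Function.update x a y) := by
        intro y hy
        induction hy using Submodule.span_induction with
        | mem y hy =>
          refine ih _ (fun l hl => ?_) (fun l hl => ?_)
          · rw [Function.update_of_ne (by rintro rfl; exact ha hl)]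
            exact h1 l (Finset.mem_insert_of_mem hl)
          · by_cases hla : l = a
            · subst hla
              rwa [Function.update_self]
            · rw [Function.update_of_ne hla]
              exact h2 l (by simp [hla, hl])
        | zero => rw [f.map_update_zero, g.map_update_zero]
        | add y z _ _ hy hz => rw [f.map_update_add, g.map_update_add, hy, hz]
        | smul c y _ hy => rw [f.map_update_smul, g.map_update_smul, hy]
      have := h3 (x a) (h1 a (Finset.mem_insert_self a T))
      rwa [Function.update_eq_self] at this
  exact key Finset.univ x (fun l _ => hx l) fun l hl => absurd (Finset.mem_univ l) hl

section SymPower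

variable {k : Type*} [CommRing k] {M N : Type*} [AddCommGroup M] [Module k M] [AddCommGroup N]
  [Module k N] (A : ℕ → Submodule k M) {n : ℕ}

/-- The graded symmetric tensor as a multilinear map. -/
noncomputable def symMultilinear (n : ℕ) :
    MultilinearMap k (fun _ : Fin n => M) (SymPower A n) :=
  (symRel A n).mkQ.compMultilinearMap (PiTensorProduct.tprod k)

theorem symMultilinear_apply (x : Fin n → M) : symMultilinear A n x = symTensor A x := rfl

theorem symTensor_swap (x : Fin n → M) (deg : Fin n → ℕ) (hx : ∀ l, x l ∈ A (deg l)) {i j : Fin n}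
    (hij : (j : ℕ) = i + 1) :
    symTensor A x = (-1 : ℤ) ^ (deg i * deg j) • symTensor A (x ∘ Equiv.swap i j) := by
  rw [symTensor, symTensor, ← map_zsmul, ← sub_eq_zero, ← map_sub]
  exact (Submodule.Quotient.mk_eq_zero _).2
    (Submodule.subset_span ⟨x, deg, i, j, hx, hij, rfl⟩)

variable {A}

theorem exists_symPower_lift (F : MultilinearMap k (fun _ : Fin n => M) N)
    (hF : ∀ (x : Fin n → M) (deg : Fin n → ℕ), (∀ l, x l ∈ A (deg l)) → ∀ i j : Fin n,
      (j : ℕ) = i + 1 → F x = (-1 : ℤ) ^ (deg i * deg j) • F (x ∘ Equiv.swap i j)) :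
    ∃ φ : SymPower A n →ₗ[k] N, ∀ x, φ (symTensor A x) = F x := by
  have h : symRel A n ≤ LinearMap.ker (PiTensorProduct.lift F) := by
    refine Submodule.span_le.2 ?_
    rintro _ ⟨x, deg, i, j, hx, hij, rfl⟩
    rw [SetLike.mem_coe, LinearMap.mem_ker, map_sub, map_zsmul, PiTensorProduct.lift.tprod,
      PiTensorProduct.lift.tprod, sub_eq_zero]
    exact hF x deg hx i j hij
  refine ⟨(symRel A n).liftQ (PiTensorProduct.lift F) h, fun x => ?_⟩
  rw [symTensor, Submodule.mkQ_apply, Submodule.liftQ_apply, PiTensorProduct.lift.tprod]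

theorem symPower_ext {f g : SymPower A n →ₗ[k] N} (s : Set M) (hs : Submodule.span k s = ⊤)
    (h : ∀ x : Fin n → M, (∀ l, x l ∈ s) → f (symTensor A x) = g (symTensor A x)) : f = g := by
  refine Submodule.linearMap_qext _ (PiTensorProduct.ext (MultilinearMap.ext fun x => ?_))
  exact MultilinearMap.eq_of_mem_span (f := f.compMultilinearMap (symMultilinear A n))
    (g := g.compMultilinearMap (symMultilinear A n)) (fun _ => s) h x fun l => by
    rw [hs]
    trivial

theorem symTensor_eq_zsmul {x y : Fin n → M} (l : Fin n) (c : ℤ) (h : x l = c • y l)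
    (h' : ∀ j, j ≠ l → x j = y j) : symTensor A x = c • symTensor A y := by
  have h1 : x = Function.update y l ((c : k) • y l) := by
    funext j
    by_cases hj : j = l
    · subst hj
      rw [Function.update_self, h, Int.cast_smul_eq_zsmul]
    · rw [Function.update_of_ne hj, h' j hj]
  rw [h1, ← symMultilinear_apply, MultilinearMap.map_update_smul, Function.update_eq_self,
    Int.cast_smul_eq_zsmul]
  rfl

/-- The operator which is `ε` on the factors before the `i`-th one, and `d` on the `i`-th one. -/
def derivationTerm (d ε : M →ₗ[k] M) (i j : Fin n) : M →ₗ[k] M :=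
  if j < i then ε else if j = i then d else LinearMap.id

theorem derivationTerm_self (d ε : M →ₗ[k] M) (i : Fin n) : derivationTerm d ε i i = d := by
  simp [derivationTerm]

theorem derivationTerm_of_lt (d ε : M →ₗ[k] M) {i j : Fin n} (h : j < i) :
    derivationTerm d ε i j = ε := if_pos h

theorem derivationTerm_of_gt (d ε : M →ₗ[k] M) {i j : Fin n} (h : i < j) :
    derivationTerm d ε i j = LinearMap.id := by
  simp [derivationTerm, h.not_gt, h.ne']

variable {d ε : M →ₗ[k] M}

/-- The involution `ε` produces the Koszul sign, so that each term of the derivation is a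
multilinear map defined without reference to degrees. -/
theorem symTensor_derivationTerm (hε : ∀ v, ∀ x ∈ A v, ε x = (-1 : ℤ) ^ v • x) (x : Fin n → M)
    (deg : Fin n → ℕ) (hx : ∀ l, x l ∈ A (deg l)) (i : Fin n) :
    symTensor A (fun j => derivationTerm d ε i j (x j)) =
      (-1 : ℤ) ^ (∑ j ∈ Finset.Iio i, deg j) • symTensor A (Function.update x i (d (x i))) := by
  have h1 : (fun j => derivationTerm d ε i j (x j)) = fun j =>
      (if j < i then (-1 : k) ^ deg j else 1) • Function.update x i (d (x i)) j := by
    funext j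
    rcases lt_trichotomy j i with h | rfl | h
    · rw [derivationTerm_of_lt d ε h, hε _ _ (hx j), if_pos h, Function.update_of_ne h.ne,
        ← Int.cast_smul_eq_zsmul k]
      simp
    · simp [derivationTerm_self]
    · simp [derivationTerm_of_gt d ε h, h.not_gt, h.ne']
  rw [h1, ← symMultilinear_apply, MultilinearMap.map_smul_univ, symMultilinear_apply,
    ← Int.cast_smul_eq_zsmul k]
  congr 1
  rw [Finset.prod_ite, Finset.prod_const_one, mul_one, Finset.prod_pow_eq_pow_sum]
  push_cast
  congr 2
  ext j
  simp

/-- The sum of the derivation terms must respect the exchange of neighbouring factors `i` and `j`.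
The exchange interchanges the terms with `d` in the places `i` and `j` and preserves each of the
others. Only the parity of the degree of `d x` matters, so `hd` asks for no more than that. -/
theorem exists_derivation (hε : ∀ v, ∀ x ∈ A v, ε x = (-1 : ℤ) ^ v • x)
    (hd : ∀ v, ∀ x ∈ A v, ∃ e, d x ∈ A e ∧ (-1 : ℤ) ^ e = -(-1) ^ v) :
    ∃ D : SymPower A n →ₗ[k] SymPower A n, ∀ x,
      D (symTensor A x) = ∑ i, symTensor A fun j => derivationTerm d ε i j (x j) := by
  obtain ⟨D, hD⟩ := exists_symPower_lift (A := A)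
    (∑ i, (symMultilinear A n).compLinearMap (derivationTerm d ε i)) fun x deg hx i j hij => by
    have hij' : i < j := Fin.lt_def.2 (by omega)
    simp only [sum_apply, MultilinearMap.compLinearMap_apply, symMultilinear_apply]
    rw [← Equiv.sum_comp (Equiv.swap i j)]
    refine Eq.trans ?_ (map_sum (zsmulAddGroupHom ((-1 : ℤ) ^ (deg i * deg j)) :
      SymPower A n →+ SymPower A n) _ _).symm
    refine Finset.sum_congr rfl fun m _ => ?_
    change _ = (-1 : ℤ) ^ (deg i * deg j) • symTensor A _
    choose e he hse using fun l => hd _ _ (hx l)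
    have hmem : ∀ m l, derivationTerm d ε m l (x l) ∈ A (Function.update deg m (e m) l) := by
      intro m l
      rcases lt_trichotomy l m with h | rfl | h
      · rw [derivationTerm_of_lt d ε h, Function.update_of_ne h.ne, hε _ _ (hx l)]
        exact zsmul_mem (hx l) _
      · rw [derivationTerm_self, Function.update_self]
        exact he l
      · rw [derivationTerm_of_gt d ε h, Function.update_of_ne h.ne']
        exact hx l
    rw [symTensor_swap A _ _ (hmem _) hij]
    have hfar : ∀ m, (∀ l, derivationTerm d ε m (Equiv.swap i j l) = derivationTerm d ε m l) →
        (fun l => derivationTerm d ε m l (x l)) ∘ Equiv.swap i j =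
          fun l => derivationTerm d ε m l ((x ∘ Equiv.swap i j) l) := fun m h => by
      funext l
      rw [Function.comp_apply, h]
      rfl
    have hlt : ∀ l, l ≠ i → l ≠ j → (l < i ↔ l < j) := fun l h1 h2 => by
      simp only [Fin.lt_def, ne_eq, Fin.ext_iff] at *
      omega
    have hother : ∀ l, l ≠ i → l ≠ j → derivationTerm d ε i l = derivationTerm d ε j l :=
      fun l h1 h2 => by simp only [derivationTerm, h1, h2, hlt l h1 h2]
    -- Since `d` changes the parity of its factor, the exchange sign changes by `(-1)^p`, where `p`
    -- is the degree of the other factor. This is the effect of `ε` on that factor, which is before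
    -- `d` on one side of the exchange only.
    have hsign : ∀ p l, (-1 : ℤ) ^ (e l * p) * (-1) ^ p = (-1) ^ (deg l * p) := fun p l => by
      rw [pow_mul, hse, ← mul_pow, neg_mul, ← pow_succ, pow_succ, mul_neg_one, neg_neg, pow_mul]
    by_cases hmi : m = i
    · subst hmi
      rw [Equiv.swap_apply_left, Function.update_self, Function.update_of_ne hij'.ne,
        symTensor_eq_zsmul (A := A) j ((-1) ^ deg m) (y := fun l =>
          derivationTerm d ε m l ((x ∘ Equiv.swap m j) l)), smul_smul, mul_comm (deg m),
        mul_comm (deg m), hsign]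
      · simp only [Function.comp_apply, Equiv.swap_apply_right]
        rw [derivationTerm_of_lt d ε hij', derivationTerm_of_gt d ε hij', hε _ _ (hx m)]
        rfl
      · intro l hl
        by_cases hlm : l = m
        · subst hlm
          simp only [Function.comp_apply, Equiv.swap_apply_left, derivationTerm_self]
        · simp only [Function.comp_apply, Equiv.swap_apply_of_ne_of_ne hlm hl, hother l hlm hl]
    by_cases hmj : m = j
    · subst hmj
      rw [Equiv.swap_apply_right, Function.update_self, Function.update_of_ne hij'.ne']
      have h1 := symTensor_eq_zsmul (A := A) i ((-1) ^ deg m) (x := fun l =>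
          derivationTerm d ε m l ((x ∘ Equiv.swap i m) l))
          (y := (fun l => derivationTerm d ε i l (x l)) ∘ Equiv.swap i m) ?_ ?_
      · rw [h1, smul_smul, ← hsign, mul_assoc, ← mul_pow]
        simp
      · simp only [Function.comp_apply, Equiv.swap_apply_left]
        rw [derivationTerm_of_lt d ε hij', derivationTerm_of_gt d ε hij', hε _ _ (hx m)]
        rfl
      · intro l hl
        by_cases hlm : l = m
        · subst hlm
          simp only [Function.comp_apply, Equiv.swap_apply_right, derivationTerm_self]
        · simp only [Function.comp_apply, Equiv.swap_apply_of_ne_of_ne hl hlm, hother l hl hlm]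
    · rw [Equiv.swap_apply_of_ne_of_ne hmi hmj, Function.update_of_ne (Ne.symm hmi),
        Function.update_of_ne (Ne.symm hmj), hfar m]
      intro l
      have hmi' := Fin.val_ne_of_ne hmi
      have hmj' := Fin.val_ne_of_ne hmj
      have : (Equiv.swap i j l < m ↔ l < m) ∧ (Equiv.swap i j l = m ↔ l = m) := by
        rcases eq_or_ne l i with rfl | h1
        · rw [Equiv.swap_apply_left]
          simp only [Fin.lt_def, Fin.ext_iff]
          omega
        rcases eq_or_ne l j with rfl | h2
        · rw [Equiv.swap_apply_right]
          simp only [Fin.lt_def, Fin.ext_iff]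
          omega
        · rw [Equiv.swap_apply_of_ne_of_ne h1 h2]
          exact ⟨Iff.rfl, Iff.rfl⟩
      simp only [derivationTerm, this]
  exact ⟨D, fun x => (hD x).trans (by
    simp only [sum_apply, MultilinearMap.compLinearMap_apply, symMultilinear_apply])⟩

theorem anticommute_of_mem (hA : ⨆ v, A v = ⊤) (hε : ∀ v, ∀ x ∈ A v, ε x = (-1 : ℤ) ^ v • x)
    (hd : ∀ v, ∀ x ∈ A v, ∃ e, d x ∈ A e ∧ (-1 : ℤ) ^ e = -(-1) ^ v) (x : M) :
    ε (d x) = -d (ε x) := by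
  have hx : x ∈ ⨆ v, A v := hA ▸ Submodule.mem_top
  induction hx using Submodule.iSup_induction' with
  | mem v x hx =>
    obtain ⟨e, he, hse⟩ := hd v x hx
    rw [hε e _ he, hε v x hx, hse, map_zsmul, neg_smul]
  | zero => simp
  | add x y _ _ hx hy => rw [map_add, map_add, map_add, map_add, hx, hy, neg_add]

/-- The condition on homogeneous elements determines the map on all symmetric tensors, because both
sides are multilinear and the homogeneous elements span. -/
theorem isDerivationExtension_iff_of_mem (hA : ⨆ v, A v = ⊤)
    (hε : ∀ v, ∀ x ∈ A v, ε x = (-1 : ℤ) ^ v • x) (D : SymPower A n →ₗ[k] SymPower A n) :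
    IsDerivationExtension A d D ↔ ∀ x,
      D (symTensor A x) = ∑ i, symTensor A fun j => derivationTerm d ε i j (x j) := by
  have key : ∀ (x : Fin n → M) (deg : Fin n → ℕ), (∀ l, x l ∈ A (deg l)) →
      ∑ i, symTensor A (fun j => derivationTerm d ε i j (x j)) =
        ∑ i : Fin n, (-1 : ℤ) ^ (∑ j ∈ Finset.Iio i, deg j) •
          symTensor A (Function.update x i (d (x i))) := fun x deg hx =>
    Finset.sum_congr rfl fun i _ => symTensor_derivationTerm hε x deg hx i
  refine ⟨fun h x => ?_, fun h x deg hx => (h x).trans (key x deg hx)⟩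
  have h1 := MultilinearMap.eq_of_mem_span (f := D.compMultilinearMap (symMultilinear A n))
    (g := ∑ i, (symMultilinear A n).compLinearMap (derivationTerm d ε i))
    (fun _ => ⋃ v, (A v : Set M)) (fun x hx => ?_) x fun l => ?_
  · simpa only [sum_apply, MultilinearMap.compLinearMap_apply, symMultilinear_apply,
      LinearMap.compMultilinearMap_apply] using h1
  · choose deg hdeg using fun l => Set.mem_iUnion.1 (hx l)
    have h2 := (h x deg hdeg).trans (key x deg hdeg).symm
    simpa only [sum_apply, MultilinearMap.compLinearMap_apply, symMultilinear_apply,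
      LinearMap.compMultilinearMap_apply] using h2
  · rw [Submodule.span_iUnion]
    simp [hA]

theorem existsUnique_isDerivationExtension (hA : ⨆ v, A v = ⊤)
    (hε : ∀ v, ∀ x ∈ A v, ε x = (-1 : ℤ) ^ v • x)
    (hd : ∀ v, ∀ x ∈ A v, ∃ e, d x ∈ A e ∧ (-1 : ℤ) ^ e = -(-1) ^ v) :
    ∃! D : SymPower A n →ₗ[k] SymPower A n, IsDerivationExtension A d D := by
  obtain ⟨D, hD⟩ := exists_derivation (n := n) hε hd
  refine ⟨D, (isDerivationExtension_iff_of_mem hA hε D).2 hD, fun D' hD' => ?_⟩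
  refine symPower_ext Set.univ Submodule.span_univ fun x _ => ?_
  rw [hD, (isDerivationExtension_iff_of_mem hA hε D').1 hD']

end SymPower

section

variable {k : Type*} [Field k] [CharZero k] {M : Type*} [AddCommGroup M] [Module k M]
  {A : ℕ → Submodule k M} {n : ℕ} {d ε : M →ₗ[k] M}

/-- For `i < m`, the two orders of applying `d` in the places `i` and `m` differ only in place `i`,
where they give `ε (d x)` and `d (ε x)`. These are opposite, since `d` is odd. The diagonal terms
vanish by `d² = 0`. -/
theorem IsDerivationExtension.comp_self (hA : ⨆ v, A v = ⊤)
    (hε : ∀ v, ∀ x ∈ A v, ε x = (-1 : ℤ) ^ v • x)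
    (hd : ∀ v, ∀ x ∈ A v, ∃ e, d x ∈ A e ∧ (-1 : ℤ) ^ e = -(-1) ^ v) (hdd : ∀ x, d (d x) = 0)
    {D : SymPower A n →ₗ[k] SymPower A n} (hD : IsDerivationExtension A d D) : D ∘ₗ D = 0 := by
  refine symPower_ext Set.univ Submodule.span_univ fun x _ => ?_
  have hD' := (isDerivationExtension_iff_of_mem hA hε D).1 hD
  let a : Fin n → Fin n → SymPower A n := fun i m =>
    symTensor A fun j => derivationTerm d ε m j (derivationTerm d ε i j (x j))
  have ha : ∀ i m, i < m → a i m = -a m i := fun i m h => by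
    rw [← neg_one_zsmul]
    refine symTensor_eq_zsmul i (-1) ?_ fun j hj => ?_
    · simp only [derivationTerm_self, derivationTerm_of_lt d ε h, neg_one_zsmul,
        anticommute_of_mem hA hε hd]
    · rcases lt_or_gt_of_ne hj with h1 | h1
      · simp only [derivationTerm_of_lt d ε h1, derivationTerm_of_lt d ε (h1.trans h)]
      · simp only [derivationTerm_of_gt d ε h1, LinearMap.id_apply]
  have ha' : ∀ i m, a i m = -a m i := fun i m => by
    rcases lt_trichotomy i m with h | rfl | h
    · exact ha i m h
    · have : a i i = 0 := (symMultilinear A n).map_coord_zero i (by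
        simp only [derivationTerm_self, hdd])
      rw [this, neg_zero]
    · rw [ha m i h, neg_neg]
  have h1 : ∑ i, ∑ m, a i m = -∑ i, ∑ m, a i m := by
    conv_lhs => rw [Finset.sum_comm]
    simp_rw [← Finset.sum_neg_distrib]
    exact Finset.sum_congr rfl fun m _ => Finset.sum_congr rfl fun i _ => ha' i m
  have h2 : (2 : k) • ∑ i, ∑ m, a i m = 0 := by
    rw [two_smul]
    nth_rw 1 [h1]
    exact neg_add_cancel _
  rw [LinearMap.comp_apply, hD', map_sum, Finset.sum_congr rfl fun i _ => hD' _]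
  exact (smul_eq_zero.1 h2).resolve_left two_ne_zero

end

/-! ### The grading by the number of vertices -/

namespace LabelledGraph

universe u w

section

variable {k : Type u} [CommRing k] {O : CyclicOperad.{u, w} k}

theorem cls_mem_graphDegree (Γ : LabelledGraph O) : Γ.cls ∈ graphDegree O (Fintype.card Γ.V) :=
  Submodule.subset_span ⟨Γ, rfl, rfl⟩

theorem iSup_graphDegree : ⨆ v, graphDegree O v = ⊤ := by
  rw [eq_top_iff, ← span_cls, Submodule.span_le]
  rintro _ ⟨Γ, rfl⟩
  exact Submodule.mem_iSup_of_mem _ Γ.cls_mem_graphDegree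

theorem exists_grading (O : CyclicOperad.{u, w} k) : ∃ ε : GraphComplex O →ₗ[k] GraphComplex O,
    ∀ v, ∀ x ∈ graphDegree O v, ε x = (-1 : ℤ) ^ v • x := by
  obtain ⟨ε, hε⟩ := exists_linearMap (O := O)
    (fun Γ => (-1 : ℤ) ^ Fintype.card Γ.V • Γ.cls)
    (fun Γ Δ f => by rw [f.cls_eq, Fintype.card_congr f.vert, smul_comm])
    fun Γ v => ⟨(-1 : ℤ) ^ Fintype.card Γ.V • Γ.clsMultilinear.toLinearMap Γ.lab v, fun x => rfl⟩
  refine ⟨ε, fun v x hx => ?_⟩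
  induction hx using Submodule.span_induction with
  | mem x hx =>
    obtain ⟨Γ, rfl, rfl⟩ := hx
    exact hε Γ
  | zero => simp
  | add x y _ _ hx hy => rw [map_add, hx, hy, smul_add]
  | smul c x _ hx => rw [map_smul, hx, smul_comm]

theorem card_contract (Γ : LabelledGraph O) (t : Γ.H) (ht : Γ.att t ≠ Γ.att (Γ.inv t)) :
    Fintype.card (Γ.contract t ht).V + 1 = Fintype.card Γ.V := by
  have h1 : Fintype.card (Γ.contract t ht).V =
      Fintype.card {v // v ≠ Γ.att t ∧ v ≠ Γ.att (Γ.inv t)} + 1 :=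
    Fintype.card_option
  have h2 := Fintype.card_subtype_compl fun v => v = Γ.att t ∨ v = Γ.att (Γ.inv t)
  have h3 : Fintype.card {v // v = Γ.att t ∨ v = Γ.att (Γ.inv t)} = 2 := by
    rw [Fintype.card_subtype, ← Finset.card_pair ht]
    congr 1
    ext v
    simp
  have h4 : Fintype.card {v // v = Γ.att t ∨ v = Γ.att (Γ.inv t)} ≤ Fintype.card Γ.V :=
    Fintype.card_subtype_le _
  simp only [not_or] at h2
  have h5 : Fintype.card {v // v ≠ Γ.att t ∧ v ≠ Γ.att (Γ.inv t)} =
    Fintype.card Γ.V - Fintype.card {v // v = Γ.att t ∨ v = Γ.att (Γ.inv t)} := h2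
  omega

end

variable {k : Type u} [Field k] [CharZero k] {O : CyclicOperad.{u, w} k}

theorem IsBoundary.map_mem {d : GraphComplex O →ₗ[k] GraphComplex O} (hd : IsBoundary O d) (v : ℕ)
    (x : GraphComplex O) (hx : x ∈ graphDegree O v) :
    ∃ e, d x ∈ graphDegree O e ∧ (-1 : ℤ) ^ e = -(-1) ^ v := by
  have hloop : ∀ Γ : LabelledGraph O, Fintype.card Γ.V = v → ∀ t : Γ.H,
      Γ.signedContraction t = 0 ∨ ∃ e, v = e + 1 ∧ Γ.signedContraction t ∈ graphDegree O e := by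
    intro Γ hv t
    by_cases ht : Γ.att t = Γ.att (Γ.inv t)
    · exact Or.inl (signedContraction_of_loop ht)
    · refine Or.inr ⟨_, (hv.symm.trans (Γ.card_contract t ht).symm), ?_⟩
      rw [signedContraction_of_ne ht]
      exact zsmul_mem (cls_mem_graphDegree _) _
  obtain ⟨e, he, hse⟩ : ∃ e, (∀ f, v = f + 1 → e = f) ∧ (-1 : ℤ) ^ e = -(-1) ^ v := by
    cases v with
    -- Without vertices there is nothing to contract and the boundary is zero, which lies in every
    -- degree; any odd degree will do.
    | zero => exact ⟨1, by simp, by simp⟩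
    | succ v => exact ⟨v, by simp, by rw [pow_succ]; ring⟩
  refine ⟨e, ?_, hse⟩
  induction hx using Submodule.span_induction with
  | mem x hx =>
    obtain ⟨Γ, hv, rfl⟩ := hx
    rw [IsBoundary.apply_cls hd]
    refine Submodule.smul_mem _ _ (Submodule.sum_mem _ fun t _ => ?_)
    rcases hloop Γ hv t with h | ⟨f, hf, h⟩
    · rw [h]
      exact zero_mem _
    · rw [he f hf]
      exact h
  | zero => simp
  | add x y _ _ hx hy => rw [map_add]; exact add_mem hx hy
  | smul c x _ hx => rw [map_smul]; exact Submodule.smul_mem _ _ hx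

end LabelledGraph

/-! ### Multilinear maps on the graph complex -/

/-- A multilinear map which vanishes if one of its arguments is in `R` only depends on the classes
modulo `R`. -/
theorem MultilinearMap.eq_of_sub_mem {k ι M N : Type*} [CommRing k] [Finite ι]
    [AddCommGroup M] [AddCommGroup N] [Module k M] [Module k N]
    (f : MultilinearMap k (fun _ : ι => M) N) (R : Submodule k M)
    (hf : ∀ x i, x i ∈ R → f x = 0) {x y : ι → M} (hxy : ∀ i, x i - y i ∈ R) : f x = f y := by
  classical
  have := Fintype.ofFinite ι
  have key : ∀ T : Finset ι, f (T.piecewise x y) = f y := by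
    intro T
    induction T using Finset.induction_on with
    | empty => simp
    | insert a T ha ih =>
      rw [Finset.piecewise_insert, ← sub_add_cancel (x a) (y a), f.map_update_add,
        hf _ a (by simpa using hxy a), zero_add, ← ih]
      congr 1
      refine Function.update_eq_self_iff.2 ?_
      simp [ha]
  simpa using key Finset.univ

namespace LabelledGraph

universe u w

variable {k : Type u} [Field k] {O : CyclicOperad.{u, w} k} {n : ℕ}
  {N : Type*} [AddCommGroup N] [Module k N]

/-- `G` is compatible with the relations of the graph complex in each argument. -/
structure IsMultiCompatible (G : (Fin n → LabelledGraph O) → N) : Prop where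
  iso : ∀ (Γ : Fin n → LabelledGraph O) (i : Fin n) (A B : LabelledGraph O) (f : Iso A B),
    G (Function.update Γ i A) = f.sign • G (Function.update Γ i B)
  lab : ∀ (Γ : Fin n → LabelledGraph O) (i : Fin n),
    IsLinearInLabels fun A => G (Function.update Γ i A)

/-- `G` is extended from the basis of graphs to a multilinear map on the free module, which vanishes
if one argument is a relation. Composing with a linear section of the quotient map, which exists
over a field, gives the map on the graph complex; by `eq_of_sub_mem` its values on graphs do not
depend on the section. -/
theorem IsMultiCompatible.exists_multilinearMap {G : (Fin n → LabelledGraph O) → N}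
    (hG : IsMultiCompatible G) :
    ∃ F : MultilinearMap k (fun _ : Fin n => GraphComplex O) N,
      ∀ Γ, F (fun i => (Γ i).cls) = G Γ := by
  let F₀ : MultilinearMap k (fun _ : Fin n => LabelledGraph O →₀ k) N :=
    ((Basis.piTensorProduct (R := k)
      fun _ : Fin n => Finsupp.basisSingleOne (R := k) (ι := LabelledGraph O)).constr k
      G).compMultilinearMap (PiTensorProduct.tprod k)
  have hF₀ : ∀ Γ, F₀ (fun i => Finsupp.single (Γ i) 1) = G Γ := fun Γ => by
    have h := (Basis.piTensorProduct (R := k) fun _ : Fin n =>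
      Finsupp.basisSingleOne (R := k) (ι := LabelledGraph O)).constr_basis k G Γ
    rw [Basis.piTensorProduct_apply] at h
    simpa [F₀] using h
  have hupd : ∀ (Γ : Fin n → LabelledGraph O) (i : Fin n) (A : LabelledGraph O),
      F₀ (Function.update (fun j => Finsupp.single (Γ j) 1) i (Finsupp.single A 1)) =
        G (Function.update Γ i A) := fun Γ i A => by
    rw [← hF₀]
    congr 1
    funext j
    exact (Function.apply_update (fun _ Γ => Finsupp.single Γ (1 : k)) Γ i A j).symm
  have hspan : Submodule.span k (Set.range fun Γ : LabelledGraph O => Finsupp.single Γ (1 : k)) =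
      ⊤ := by
    rw [← Finsupp.coe_basisSingleOne]
    exact Module.Basis.span_eq _
  have hzero : ∀ (Γ : Fin n → LabelledGraph O) (i : Fin n), ∀ z ∈ graphRel O,
      F₀ (Function.update (fun j => Finsupp.single (Γ j) 1) i z) = 0 := by
    intro Γ i
    have h : graphRel O ≤ LinearMap.ker (F₀.toLinearMap (fun j => Finsupp.single (Γ j) 1) i) := by
      refine Submodule.span_le.2 ?_
      rintro _ ((⟨A, B, f, rfl⟩ | ⟨A, v, x, y, rfl⟩) | ⟨A, v, c, x, rfl⟩)
      · rw [SetLike.mem_coe, LinearMap.mem_ker, map_sub, map_zsmul,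
          MultilinearMap.toLinearMap_apply,
          MultilinearMap.toLinearMap_apply, hupd, hupd, hG.iso Γ i A B f, sub_self]
      · obtain ⟨T, hT⟩ := hG.lab Γ i A v
        dsimp only at hT
        rw [SetLike.mem_coe, LinearMap.mem_ker, map_sub, map_add, MultilinearMap.toLinearMap_apply,
          MultilinearMap.toLinearMap_apply, MultilinearMap.toLinearMap_apply, hupd, hupd, hupd,
          hT, hT, hT, map_add, sub_self]
      · obtain ⟨T, hT⟩ := hG.lab Γ i A v
        dsimp only at hT
        rw [SetLike.mem_coe, LinearMap.mem_ker, map_sub, map_smul, MultilinearMap.toLinearMap_apply,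
          MultilinearMap.toLinearMap_apply, hupd, hupd, hT, hT, map_smul, sub_self]
    exact fun z hz => h hz
  have hrel : ∀ x i, x i ∈ graphRel O → F₀ x = 0 := by
    intro x i hx
    refine MultilinearMap.eq_of_mem_span (f := F₀) (g := 0) (Function.update (fun _ =>
      Set.range fun Γ : LabelledGraph O => Finsupp.single Γ (1 : k)) i (graphRel O)) ?_ x ?_
    · intro y hy
      have h1 : ∀ j, j ≠ i → ∃ Γ : LabelledGraph O, Finsupp.single Γ (1 : k) = y j :=
        fun j hj => by simpa [hj] using hy j
      -- The graph `Γ₀` is a dummy in place `i`, where the argument is a relation and not a graph.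
      rcases isEmpty_or_nonempty (LabelledGraph O) with h0 | ⟨⟨Γ₀⟩⟩
      · exact F₀.map_coord_zero i (Subsingleton.elim _ _)
      · have h2 : ∀ j, ∃ Γ : LabelledGraph O, j ≠ i → Finsupp.single Γ (1 : k) = y j := fun j => by
          by_cases hj : j = i
          · exact ⟨Γ₀, fun h => absurd hj h⟩
          · exact (h1 j hj).imp fun Γ h _ => h
        choose Γ hΓ using h2
        have h3 := hzero Γ i (y i) (by simpa using hy i)
        rwa [show Function.update (fun j => Finsupp.single (Γ j) 1) i (y i) = y from ?_] at h3
        funext j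
        by_cases hj : j = i
        · subst hj
          simp
        · simp [hj, hΓ j hj]
    · intro j
      by_cases hj : j = i
      · subst hj
        simpa using hx
      · simp [hj, hspan]
  obtain ⟨σ, hσ⟩ := LinearMap.exists_rightInverse_of_surjective (graphRel O).mkQ
    (LinearMap.range_eq_top.2 (Submodule.mkQ_surjective _))
  refine ⟨F₀.compLinearMap fun _ => σ, fun Γ => ?_⟩
  rw [← hF₀]
  refine F₀.eq_of_sub_mem (graphRel O) hrel fun i => ?_
  rw [← Submodule.Quotient.mk_eq_zero, ← Submodule.mkQ_apply, map_sub, sub_eq_zero]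
  exact congrArg (fun f => f (Γ i).cls) hσ

theorem exists_graphSym_lift {G : (Fin n → LabelledGraph O) → N} (hG : IsMultiCompatible G)
    (hswap : ∀ (Γ : Fin n → LabelledGraph O) (i j : Fin n), (j : ℕ) = i + 1 →
      G Γ = (-1 : ℤ) ^ (Fintype.card (Γ i).V * Fintype.card (Γ j).V) • G (Γ ∘ Equiv.swap i j)) :
    ∃ φ : GraphSym O n →ₗ[k] N,
      ∀ Γ, φ (symTensor (graphDegree O) fun i => (Γ i).cls) = G Γ := by
  obtain ⟨F, hF⟩ := hG.exists_multilinearMap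
  obtain ⟨φ, hφ⟩ := exists_symPower_lift (A := graphDegree O) F fun x deg hx i j hij => by
    have h := MultilinearMap.eq_of_mem_span (f := F)
      (g := (-1 : ℤ) ^ (deg i * deg j) • F.domDomCongr (Equiv.swap i j))
      (fun l => {x | ∃ Γ : LabelledGraph O, Fintype.card Γ.V = deg l ∧ x = Γ.cls})
      (fun y hy => ?_) x hx
    · exact h
    · choose Γ hΓ hy using hy
      obtain rfl : y = fun l => (Γ l).cls := funext hy
      rw [hF, hswap Γ i j hij, hΓ, hΓ, ← hF]
      rfl
  exact ⟨φ, fun Γ => (hφ _).trans (hF Γ)⟩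

theorem graphSym_ext {f g : GraphSym O n →ₗ[k] N} (h : ∀ Γ : Fin n → LabelledGraph O,
    f (symTensor (graphDegree O) fun i => (Γ i).cls) =
      g (symTensor (graphDegree O) fun i => (Γ i).cls)) : f = g := by
  refine symPower_ext _ span_cls fun x hx => ?_
  choose Γ hΓ using hx
  obtain rfl : (fun l => (Γ l).cls) = x := funext hΓ
  exact h Γ

end LabelledGraph

/-! ### Orders on disjoint unions -/

theorem Fintype.prod_lex_sigma {M : Type*} [CommMonoid M] {ι : Type*} {V : ι → Type*} [Fintype ι]
    [∀ i, Fintype (V i)] [inst : Fintype (Lex (Σ i, V i))] (g : Lex (Σ i, V i) → M) :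
    ∏ v, g v = ∏ i, ∏ u : V i, g (toLex ⟨i, u⟩) := by
  rw [← Fintype.prod_sigma', ← Equiv.prod_comp toLex]

theorem update_lex_sigma {ι : Type*} {V : ι → Type*} {α : ∀ i, V i → Type*}
    {β : Lex (Σ i, V i) → Type*} [DecidableEq ι] [∀ i, DecidableEq (V i)]
    [DecidableEq (Lex (Σ i, V i))] (m : ∀ w : Lex (Σ i, V i), α (ofLex w).1 (ofLex w).2 → β w)
    (ℓ : ∀ i v, α i v) (i : ι) (v : V i) (x : α i v) :
    (fun w => m w (Function.update ℓ i (Function.update (ℓ i) v x) (ofLex w).1 (ofLex w).2)) =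
      Function.update (fun w => m w (ℓ (ofLex w).1 (ofLex w).2)) (toLex ⟨i, v⟩)
        (m (toLex ⟨i, v⟩) x) := by
  funext w
  obtain ⟨⟨j, z⟩, rfl⟩ := toLex.surjective w
  dsimp only [ofLex_toLex]
  by_cases hj : j = i
  · subst hj
    rw [Function.update_self]
    by_cases hz : z = v
    · subst hz
      rw [Function.update_self, Function.update_self]
    · rw [Function.update_of_ne hz, Function.update_of_ne]
      · rfl
      exact fun h => hz (eq_of_heq (Sigma.mk.inj (toLex.injective h)).2)
  · rw [Function.update_of_ne hj, Function.update_of_ne]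
    · rfl
    exact fun h => hj (Sigma.mk.inj (toLex.injective h)).1

section LexSigma

variable {ι : Type*} [LinearOrder ι] {V W : ι → Type*} [∀ i, LinearOrder (V i)]
  [∀ i, LinearOrder (W i)]

local instance : LinearOrder (Lex (Σ i, V i)) := Sigma.Lex.linearOrder

theorem toLex_sigma_lt_iff {i j : ι} {u : V i} {v : V j} :
    (toLex (⟨i, u⟩ : Σ i, V i)) < toLex ⟨j, v⟩ ↔ i < j ∨ ∃ h : i = j, h ▸ u < v := by
  rw [Sigma.Lex.lt_def]
  exact Iff.rfl

theorem toLex_sigma_lt_iff_of_ne {i j : ι} (h : i ≠ j) {u : V i} {v : V j} :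
    (toLex (⟨i, u⟩ : Σ i, V i)) < toLex ⟨j, v⟩ ↔ i < j := by
  rw [toLex_sigma_lt_iff]
  simp [h]

theorem toLex_sigma_lt_iff_same {i : ι} {u v : V i} :
    (toLex (⟨i, u⟩ : Σ i, V i)) < toLex ⟨i, v⟩ ↔ u < v := by
  rw [toLex_sigma_lt_iff]
  simp

/-- Elements of different blocks keep their order, so all inversions are inside the blocks. -/
theorem orderSign_lex_sigma [Fintype ι] [∀ i, Fintype (V i)] [Fintype (Lex (Σ i, V i))]
    {p : Lex (Σ i, V i) → Lex (Σ i, W i)} {q : ∀ i, V i → W i}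
    (h : ∀ i u, p (toLex ⟨i, u⟩) = toLex ⟨i, q i u⟩) : orderSign p = ∏ i, orderSign (q i) := by
  rw [orderSign, Fintype.prod_lex_sigma]
  refine Finset.prod_congr rfl fun i _ => Finset.prod_congr rfl fun u _ => ?_
  rw [Fintype.prod_lex_sigma, Fintype.prod_eq_single i]
  · refine Finset.prod_congr rfl fun v _ => ?_
    simp only [invSign, h, toLex_sigma_lt_iff_same]
  · intro j hj
    refine Finset.prod_eq_one fun v _ => if_neg ?_
    rw [h, h, toLex_sigma_lt_iff_of_ne hj.symm, toLex_sigma_lt_iff_of_ne hj]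
    exact fun h => h.1.not_gt h.2

end LexSigma

/-! ### Existence of the gluing maps -/

namespace LabelledGraph

universe u w

variable {k : Type u} [CommRing k] {O : CyclicOperad.{u, w} k} {n : ℕ}

theorem dirSign_eq (Γ : Fin n → LabelledGraph O) (t : ∀ i, (Γ i).H) :
    dirSign Γ t = ∏ i, (Γ i).dir (t i) := rfl

theorem dirSign_mul_self (Γ : Fin n → LabelledGraph O) (t : ∀ i, (Γ i).H) :
    dirSign Γ t * dirSign Γ t = 1 := by
  rw [dirSign_eq, ← Finset.prod_mul_distrib]
  exact Finset.prod_eq_one fun i _ => dir_mul_self _ _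

theorem glueOut_tail (Γ : Fin n → LabelledGraph O) (t : ∀ i, (Γ i).H) (i : Fin n) :
    glueOut Γ t ⟨i, t i⟩ = true := if_pos rfl

theorem glueOut_head (Γ : Fin n → LabelledGraph O) (t : ∀ i, (Γ i).H) (i : Fin n) :
    glueOut Γ t ⟨i, (Γ i).inv (t i)⟩ = false := by
  rw [glueOut, if_neg ((Γ i).inv_ne _), if_pos rfl]

theorem glueOut_other (Γ : Fin n → LabelledGraph O) (t : ∀ i, (Γ i).H) {i : Fin n} {h : (Γ i).H}
    (h1 : h ≠ t i) (h2 : h ≠ (Γ i).inv (t i)) : glueOut Γ t ⟨i, h⟩ = (Γ i).out h := by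
  rw [glueOut, if_neg h1, if_neg h2]

theorem glueInv_map {Γ Δ : Fin n → LabelledGraph O} {f : ∀ i, (Γ i).H → (Δ i).H}
    (hf : ∀ i, (f i).Injective) (hinv : ∀ i h, (Δ i).inv (f i h) = f i ((Γ i).inv h))
    (t : ∀ i, (Γ i).H) (c : Equiv.Perm (Fin n)) (x : Σ i, (Γ i).H) :
    glueInv Δ (fun i => f i (t i)) c ⟨x.1, f x.1 x.2⟩ =
      ⟨(glueInv Γ t c x).1, f (glueInv Γ t c x).1 (glueInv Γ t c x).2⟩ := by
  obtain ⟨i, h⟩ := x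
  by_cases h1 : h = t i
  · subst h1
    dsimp only
    rw [glueInv_tail Γ, glueInv_tail Δ (fun i => f i (t i)), hinv]
  by_cases h2 : h = (Γ i).inv (t i)
  · subst h2
    rw [glueInv_head]
    dsimp only
    rw [← hinv, glueInv_head Δ (fun i => f i (t i))]
  · rw [glueInv_other Γ t c i h h1 h2, glueInv_other, hinv]
    · exact (hf i).ne h1
    · rw [hinv]
      exact (hf i).ne h2

theorem glueOut_map {Γ Δ : Fin n → LabelledGraph O} {f : ∀ i, (Γ i).H → (Δ i).H}
    (hf : ∀ i, (f i).Injective) (hinv : ∀ i h, (Δ i).inv (f i h) = f i ((Γ i).inv h))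
    (hout : ∀ i h, (Δ i).out (f i h) = (Γ i).out h) (t : ∀ i, (Γ i).H) (x : Σ i, (Γ i).H) :
    glueOut Δ (fun i => f i (t i)) ⟨x.1, f x.1 x.2⟩ = glueOut Γ t x := by
  obtain ⟨i, h⟩ := x
  simp only [glueOut, (hf i).eq_iff, hinv, hout]

section

variable {Γ Δ : Fin n → LabelledGraph O} (f : ∀ i, Iso (Γ i) (Δ i)) (t : ∀ i, (Γ i).H)
  (c : Equiv.Perm (Fin n))

/-- The edges used for gluing are replaced by new edges with standard directions, so whether the `f
i` reverse them plays no role for `g`. The factors `dirSign` remove their contribution from the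
product of the signs. -/
theorem Iso.exists_glue : ∃ g : Iso (glue Γ t c) (glue Δ (fun i => (f i).half (t i)) c),
    g.sign = (∏ i, (f i).sign) * (dirSign Γ t * dirSign Δ fun i => (f i).half (t i)) := by
  let half : (glue Γ t c).H ≃ (glue Δ (fun i => (f i).half (t i)) c).H :=
    Equiv.sigmaCongrRight fun i => (f i).half
  let vert : (glue Γ t c).V → (glue Δ (fun i => (f i).half (t i)) c).V := fun v =>
    toLex ⟨(ofLex v).1, (f _).vert (ofLex v).2⟩
  let g : Iso (glue Γ t c) (glue Δ (fun i => (f i).half (t i)) c) := Iso.ofInjective half vert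
    (fun v w h => by
      obtain ⟨i, v⟩ := v
      obtain ⟨j, w⟩ := w
      obtain rfl : i = j := congrArg Sigma.fst h
      exact congrArg (fun v => toLex (⟨i, v⟩ : Σ i, (Γ i).V))
        ((f i).vert.injective (eq_of_heq (Sigma.mk.inj h).2)))
    (fun x => congrArg (fun v => toLex (⟨x.1, v⟩ : Σ i, (Δ i).V)) ((f x.1).att_half x.2))
    (glueInv_map (fun i => (f i).half.injective) (fun i => (f i).inv_half) t c) (fun v e he => by
      obtain ⟨i, u⟩ := v
      refine (congrArg _ ((f i).lab_vert u)).trans ((CyclicOperad.Dec.map_map _ _ _).trans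
        (.trans ?_ (CyclicOperad.Dec.map_map _ _ _).symm))
      exact congrArg (fun e => CyclicOperad.Dec.map e ((Γ i).lab u))
        (Equiv.ext fun x => Subtype.ext (he (unionHalves Γ (toLex ⟨i, u⟩) x)).symm))
  refine ⟨g, ?_⟩
  rw [g.sign_eq]
  have h1 : orderSign g.vert = ∏ i, orderSign (f i).vert :=
    orderSign_lex_sigma (p := g.vert) fun i u => rfl
  have h2 : ∏ h, edgeSign (glue Γ t c) (glue Δ (fun i => (f i).half (t i)) c) g.half h =
      ∏ i, ∏ h : (Γ i).H, edgeSign (glue Γ t c) (glue Δ (fun i => (f i).half (t i)) c) g.half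
        (⟨i, h⟩ : Σ i, (Γ i).H) := Fintype.prod_sigma _
  have h3 : ∀ i, ∏ h : (Γ i).H, edgeSign (glue Γ t c) (glue Δ (fun i => (f i).half (t i)) c) g.half
        (⟨i, h⟩ : Σ i, (Γ i).H) = (Γ i).dir (t i) * (Δ i).dir ((f i).half (t i)) *
          ∏ h, edgeSign (Γ i) (Δ i) (f i).half h := by
    intro i
    rw [contract_edgeSign (f i).half (t i) ((f i).inv_half _),
      prod_eq_mul_mul_prod_subtype ((Γ i).inv_ne (t i)).symm]
    have e1 : edgeSign (glue Γ t c) (glue Δ (fun i => (f i).half (t i)) c) g.half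
        (⟨i, t i⟩ : Σ i, (Γ i).H) = 1 := if_neg fun h => by
      have := (glueOut_tail Δ (fun i => (f i).half (t i)) i).symm.trans h.2
      cases this
    have e2 : edgeSign (glue Γ t c) (glue Δ (fun i => (f i).half (t i)) c) g.half
        (⟨i, (Γ i).inv (t i)⟩ : Σ i, (Γ i).H) = 1 := if_neg fun h => by
      have := (glueOut_head Γ t i).symm.trans h.1
      cases this
    have e3 : ∀ h : (Γ i).ContractH (t i), edgeSign (glue Γ t c)
        (glue Δ (fun i => (f i).half (t i)) c) g.half (⟨i, h⟩ : Σ i, (Γ i).H) =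
        edgeSign (Γ i) (Δ i) (f i).half h := fun h => by
      unfold edgeSign
      change (if glueOut Γ t ⟨i, h⟩ = true ∧ glueOut Δ (fun i => (f i).half (t i))
        ⟨i, (f i).half h⟩ = false then _ else _) = _
      rw [glueOut_other Γ t h.2.1 h.2.2, glueOut_other]
      · exact (f i).half.injective.ne h.2.1
      · rw [(f i).inv_half]
        exact (f i).half.injective.ne h.2.2
    rw [e1, e2, Finset.prod_congr rfl fun h _ => e3 h]
    have d1 := (Γ i).dir_mul_self (t i)
    have d2 := (Δ i).dir_mul_self ((f i).half (t i))
    generalize ∏ h : (Γ i).ContractH (t i), edgeSign (Γ i) (Δ i) (f i).half h = E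
    linear_combination -(E * d1) - (Γ i).dir (t i) * (Γ i).dir (t i) * E * d2
  rw [h1, h2, Finset.prod_congr rfl fun i _ => h3 i, dirSign_eq, dirSign_eq,
    Finset.prod_congr rfl fun i _ => (f i).sign_eq]
  simp only [Finset.prod_mul_distrib]
  ring

end

/-- The sum of all gluings of a polygon, in which each gluing is counted `2n` times. -/
noncomputable def gluingSum (Γ : Fin n → LabelledGraph O) : GraphComplex O :=
  ∑ s : Equiv.Perm (Fin n), ∑ t : (∀ i, (Γ i).H), dirSign Γ t • (glue Γ t (cyclicOrder s)).cls

theorem gluingSum_eq_of_iso {Γ Δ : Fin n → LabelledGraph O} (f : ∀ i, Iso (Γ i) (Δ i)) :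
    gluingSum Γ = (∏ i, (f i).sign) • gluingSum Δ := by
  rw [gluingSum, gluingSum, Finset.smul_sum]
  refine Finset.sum_congr rfl fun s _ => ?_
  rw [Finset.smul_sum]
  refine Fintype.sum_equiv (Equiv.piCongrRight fun i => (f i).half) _ _ fun t => ?_
  obtain ⟨g, hg⟩ := Iso.exists_glue f t (cyclicOrder s)
  rw [g.cls_eq, hg, smul_smul, smul_smul]
  congr 1
  have h := dirSign_mul_self Γ t
  change _ = (∏ i, (f i).sign) * dirSign Δ fun i => (f i).half (t i)
  linear_combination ((∏ i, (f i).sign) * dirSign Δ fun i => (f i).half (t i)) * h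

theorem Iso.exists_refl (Γ : LabelledGraph O) : ∃ f : Iso Γ Γ, f.sign = 1 := by
  let f : Iso Γ Γ := ⟨Equiv.refl _, Equiv.refl _, fun _ => rfl, fun _ => rfl, fun v =>
    (CyclicOperad.Dec.map_refl _).symm⟩
  exact ⟨f, (f.sign_of_out_eq fun _ => rfl).trans (orderSign_of_strictMono strictMono_id)⟩

theorem gluingSum_update_of_iso (Γ : Fin n → LabelledGraph O) (i : Fin n) {A B : LabelledGraph O}
    (f : Iso A B) :
    gluingSum (Function.update Γ i A) = f.sign • gluingSum (Function.update Γ i B) := by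
  have h : ∀ j, ∃ g : Iso (Function.update Γ i A j) (Function.update Γ i B j),
      g.sign = if j = i then f.sign else 1 := by
    intro j
    by_cases hj : j = i
    · subst hj
      rw [Function.update_self, Function.update_self, if_pos rfl]
      exact ⟨f, rfl⟩
    · rw [Function.update_of_ne hj, Function.update_of_ne hj, if_neg hj]
      exact Iso.exists_refl _
  choose g hg using h
  rw [gluingSum_eq_of_iso g, Finset.prod_congr rfl fun j _ => hg j]
  simp

theorem gluingSum_update_linear (Γ : Fin n → LabelledGraph O) (i : Fin n) :
    IsLinearInLabels fun A => gluingSum (Function.update Γ i A) := by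
  intro A v
  dsimp only
  generalize hΓ : Function.update Γ i A = Γ'
  have hA : A = Γ' i := by rw [← hΓ, Function.update_self]
  subst hA
  -- The family is rewritten with fixed underlying graphs and varying labels, so that the index sets
  -- of the sums do not depend on `x`.
  have hup : ∀ x, Function.update Γ i ((Γ' i).setLab v x) = fun j => (Γ' j).withLab
      (Function.update (fun j => (Γ' j).lab) i (Function.update (Γ' i).lab v x) j) := by
    intro x
    funext j
    by_cases hj : j = i
    · subst hj
      rw [Function.update_self, Function.update_self]
      rfl
    · rw [Function.update_of_ne hj, Function.update_of_ne hj, ← hΓ, Function.update_of_ne hj]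
      rfl
  let L : (∀ j v, O.Dec {h // (Γ' j).att h = v}) → ∀ v : Lex (Σ j, (Γ' j).V),
      O.Dec {h : Σ j, (Γ' j).H // toLex (⟨h.1, (Γ' h.1).att h.2⟩ : Σ j, (Γ' j).V) = v} :=
    fun ℓ v => CyclicOperad.Dec.map (unionHalves Γ' v) (ℓ (ofLex v).1 (ofLex v).2)
  let T : Equiv.Perm (Fin n) → (∀ j, (Γ' j).H) →
      O.Dec {h : (Γ' i).H // (Γ' i).att h = v} →ₗ[k] GraphComplex O := fun s t => dirSign Γ' t •
    (glue Γ' t (cyclicOrder s)).clsMultilinear.toLinearMap (L fun j => (Γ' j).lab) (toLex ⟨i, v⟩) ∘ₗ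
      CyclicOperad.Dec.map (unionHalves Γ' (toLex ⟨i, v⟩))
  refine ⟨∑ s, ∑ t, T s t, fun x => ?_⟩
  have hsum : ∀ T : Equiv.Perm (Fin n) → (∀ j, (Γ' j).H) →
      O.Dec {h : (Γ' i).H // (Γ' i).att h = v} →ₗ[k] GraphComplex O,
      (∑ s, ∑ t, T s t) x = ∑ s, ∑ t, T s t x := fun T => by
    simp only [LinearMap.sum_apply]
  rw [hup]
  refine Eq.trans ?_ (hsum T).symm
  refine Finset.sum_congr rfl fun s _ => Finset.sum_congr rfl fun t _ => ?_
  exact congrArg (fun ℓ => dirSign Γ' t • (glue Γ' t (cyclicOrder s)).clsMultilinear ℓ)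
    (update_lex_sigma (α := fun j v => O.Dec {h // (Γ' j).att h = v}) (β := fun w =>
      O.Dec {h : Σ j, (Γ' j).H // toLex (⟨h.1, (Γ' h.1).att h.2⟩ : Σ j, (Γ' j).V) = w})
      (fun w => CyclicOperad.Dec.map (unionHalves Γ' w)) (fun j => (Γ' j).lab) i v x)

end LabelledGraph

section

variable {n : ℕ} {V : Fin n → Type*} [∀ i, LinearOrder (V i)]

local instance : LinearOrder (Lex (Σ i, V i)) := Sigma.Lex.linearOrder

theorem swap_lt_swap_iff {i j : Fin n} (hij : (j : ℕ) = i + 1) {l m : Fin n} (h : l < m) :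
    Equiv.swap i j m < Equiv.swap i j l ↔ l = i ∧ m = j := by
  simp only [Equiv.swap_apply_def, Fin.lt_def, Fin.ext_iff] at *
  split_ifs <;> omega

/-- The sign of the exchange of two neighbouring blocks. -/
theorem orderSign_lex_swap [∀ i, Fintype (V i)] {i j : Fin n} (hij : (j : ℕ) = i + 1)
    [Fintype (Lex (Σ l, V (Equiv.swap i j l)))]
    {p : Lex (Σ l, V (Equiv.swap i j l)) → Lex (Σ l, V l)}
    (hp : ∀ l u, p (toLex ⟨l, u⟩) = toLex ⟨Equiv.swap i j l, u⟩) :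
    orderSign p = (-1) ^ (Fintype.card (V i) * Fintype.card (V j)) := by
  have hinv : ∀ l m u w, invSign p (toLex ⟨l, u⟩) (toLex ⟨m, w⟩) =
      if l = i ∧ m = j then -1 else 1 := by
    intro l m u w
    have hij' : i ≠ j := fun h => by
      rw [h] at hij
      omega
    unfold invSign
    rw [hp, hp]
    rcases lt_trichotomy l m with h | rfl | h
    · have hne := (Equiv.swap i j).injective.ne h.ne'
      simp only [toLex_sigma_lt_iff_of_ne hne, toLex_sigma_lt_iff_of_ne h.ne,
        swap_lt_swap_iff hij h, h, true_and]
    · have : ¬ (l = i ∧ l = j) := fun h => hij' (h.1.symm.trans h.2)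
      rw [if_neg this, if_neg]
      rw [toLex_sigma_lt_iff_same, toLex_sigma_lt_iff_same]
      exact fun h => h.1.not_gt h.2
    · have : ¬ (l = i ∧ m = j) := by
        rintro ⟨rfl, rfl⟩
        rw [Fin.lt_def] at h
        omega
      rw [if_neg this, if_neg]
      rw [toLex_sigma_lt_iff_of_ne h.ne']
      exact fun h1 => h.not_gt h1.1
  rw [orderSign, Fintype.prod_lex_sigma, Fintype.prod_eq_single i]
  · have h1 : ∀ u, ∏ y, invSign p (toLex ⟨i, u⟩) y = (-1) ^ Fintype.card (V i) := fun u => by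
      rw [Fintype.prod_lex_sigma, Fintype.prod_eq_single j]
      · simp only [hinv, and_self, if_true]
        simp
      · intro m hm
        simp [hinv, hm]
    rw [Finset.prod_congr rfl fun u _ => h1 u]
    simp [← pow_mul]
  · intro l hl
    refine Finset.prod_eq_one fun u _ => ?_
    rw [Fintype.prod_lex_sigma]
    simp [hinv, hl]

end

namespace LabelledGraph

universe u w

section

variable {k : Type u} [CommRing k] {O : CyclicOperad.{u, w} k} {n : ℕ}

theorem glueInv_comp (Γ : Fin n → LabelledGraph O) (t : ∀ i, (Γ i).H) (π c : Equiv.Perm (Fin n))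
    (x : Σ i, (Γ (π i)).H) :
    glueInv Γ t c ⟨π x.1, x.2⟩ =
      ⟨π (glueInv (Γ ∘ π) (fun i => t (π i)) (π⁻¹ * c * π) x).1,
        (glueInv (Γ ∘ π) (fun i => t (π i)) (π⁻¹ * c * π) x).2⟩ := by
  obtain ⟨i, h⟩ := x
  by_cases h1 : h = t (π i)
  · subst h1
    have e := glueInv_tail (Γ ∘ π) (fun i => t (π i)) (π⁻¹ * c * π) i
    rw [e]
    refine (glueInv_tail Γ t c (π i)).trans ?_
    refine congrArg (fun j => (⟨j, (Γ j).inv (t j)⟩ : Σ j, (Γ j).H)) ?_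
    change c⁻¹ (π i) = π ((π⁻¹ * c * π)⁻¹ i)
    simp [mul_inv_rev]
  by_cases h2 : h = (Γ (π i)).inv (t (π i))
  · subst h2
    have e := glueInv_head (Γ ∘ π) (fun i => t (π i)) (π⁻¹ * c * π) i
    refine (glueInv_head Γ t c (π i)).trans
      (.trans ?_ (congrArg (fun x : Σ i, (Γ (π i)).H => (⟨π x.1, x.2⟩ : Σ i, (Γ i).H)) e.symm))
    refine congrArg (fun j => (⟨j, t j⟩ : Σ j, (Γ j).H)) ?_
    simp
  · have e := glueInv_other (Γ ∘ π) (fun i => t (π i)) (π⁻¹ * c * π) i h h1 h2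
    rw [e]
    exact glueInv_other Γ t c (π i) h h1 h2

theorem exists_iso_glue_swap (Γ : Fin n → LabelledGraph O) (t : ∀ i, (Γ i).H)
    (c : Equiv.Perm (Fin n)) {i j : Fin n} (hij : (j : ℕ) = i + 1) :
    ∃ g : Iso (glue (Γ ∘ Equiv.swap i j) (fun l => t (Equiv.swap i j l))
        ((Equiv.swap i j)⁻¹ * c * Equiv.swap i j)) (glue Γ t c),
      g.sign = (-1) ^ (Fintype.card (Γ i).V * Fintype.card (Γ j).V) := by
  let π := Equiv.swap i j
  let half : (glue (Γ ∘ π) (fun l => t (π l)) (π⁻¹ * c * π)).H ≃ (glue Γ t c).H :=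
    Equiv.sigmaCongrLeft (β := fun l => (Γ l).H) π
  let vert : (glue (Γ ∘ π) (fun l => t (π l)) (π⁻¹ * c * π)).V → (glue Γ t c).V :=
    fun v => toLex ⟨π (ofLex v).1, (ofLex v).2⟩
  let g : Iso (glue (Γ ∘ π) (fun l => t (π l)) (π⁻¹ * c * π)) (glue Γ t c) :=
    Iso.ofInjective half vert
      (fun v w h => by
        obtain ⟨l, v⟩ := v
        obtain ⟨m, w⟩ := w
        obtain rfl : l = m := π.injective (congrArg Sigma.fst h)
        exact congrArg (fun v => toLex (⟨l, v⟩ : Σ i, (Γ (π i)).V)) (eq_of_heq (Sigma.mk.inj h).2))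
      (fun x => rfl) (fun x => glueInv_comp Γ t π c x) (fun v e he => by
        obtain ⟨l, u⟩ := v
        refine .trans ?_ (CyclicOperad.Dec.map_map _ _ _).symm
        exact congrArg (fun e => CyclicOperad.Dec.map e ((Γ (π l)).lab u)) (Equiv.ext fun x =>
          Subtype.ext (he (unionHalves (Γ ∘ π) (toLex ⟨l, u⟩) x)).symm))
  refine ⟨g, ?_⟩
  rw [g.sign_of_out_eq fun _ => rfl]
  exact orderSign_lex_swap (V := fun l => (Γ l).V) (p := g.vert) hij fun l u => rfl

/-- Reordering the graphs conjugates the cyclic order, which is undone by reindexing the sum over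
`s`. What is left is the sign of exchanging two blocks of vertices. -/
theorem gluingSum_swap (Γ : Fin n → LabelledGraph O) {i j : Fin n} (hij : (j : ℕ) = i + 1) :
    gluingSum Γ = (-1 : ℤ) ^ (Fintype.card (Γ i).V * Fintype.card (Γ j).V) •
      gluingSum (Γ ∘ Equiv.swap i j) := by
  rw [gluingSum, gluingSum, Finset.smul_sum]
  refine Fintype.sum_equiv (Equiv.mulLeft (Equiv.swap i j)⁻¹) _ _ fun s => ?_
  rw [Finset.smul_sum]
  refine Fintype.sum_equiv (Equiv.piCongrLeft (fun i => (Γ i).H) (Equiv.swap i j)).symm _ _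
    fun t => ?_
  obtain ⟨g, hg⟩ := exists_iso_glue_swap Γ t (cyclicOrder s) hij
  have h1 : cyclicOrder ((Equiv.swap i j)⁻¹ * s) =
      (Equiv.swap i j)⁻¹ * cyclicOrder s * Equiv.swap i j := by
    rw [cyclicOrder, cyclicOrder]
    group
  have h2 : dirSign (Γ ∘ Equiv.swap i j) (fun l => t (Equiv.swap i j l)) = dirSign Γ t :=
    Equiv.prod_comp (Equiv.swap i j) fun l => (Γ l).dir (t l)
  change _ = _ • dirSign (Γ ∘ Equiv.swap i j) (fun l => t (Equiv.swap i j l)) •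
    (glue (Γ ∘ Equiv.swap i j) (fun l => t (Equiv.swap i j l))
      (cyclicOrder ((Equiv.swap i j)⁻¹ * s))).cls
  rw [h1, h2, g.cls_eq, hg, smul_comm, smul_smul, smul_smul, mul_assoc, ← mul_pow]
  simp

end

variable {k : Type u} [Field k] {O : CyclicOperad.{u, w} k} {n : ℕ}

theorem exists_isGluing (O : CyclicOperad.{u, w} k) (n : ℕ) : ∃ μ, IsGluing O n μ := by
  obtain ⟨μ, hμ⟩ := exists_graphSym_lift (O := O) (n := n) (G := gluingSum)
    ⟨fun Γ i A B f => gluingSum_update_of_iso Γ i f, gluingSum_update_linear⟩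
    fun Γ i j hij => gluingSum_swap Γ hij
  refine ⟨(1 / (2 * n) : k) • μ, fun Γ => ?_⟩
  rw [LinearMap.smul_apply, hμ]
  rfl

end LabelledGraph

/-! ### Contraction of an old edge commutes with gluing -/

section

variable {V : Type*} [LinearOrder V] [Fintype V]

/-- The sign of moving one element to the first place. -/
theorem orderSign_of_first {R : Type*} [LinearOrder R] {p : V → WithBot R} (y₀ : V)
    (h₀ : p y₀ = ⊥) (h₁ : ∀ x, x ≠ y₀ → ⊥ < p x)
    (h₂ : ∀ x y, x ≠ y₀ → y ≠ y₀ → x < y → p x < p y) : orderSign p = firstSign y₀ := by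
  refine Finset.prod_congr rfl fun x _ => ?_
  by_cases hx : x = y₀
  · subst hx
    rw [ltSign_self]
    refine Finset.prod_eq_one fun y _ => if_neg fun h => ?_
    rw [h₀] at h
    exact WithBot.not_lt_bot _ h.2
  · rw [Fintype.prod_eq_single y₀]
    · simp only [invSign, ltSign, h₀, h₁ x hx, and_true]
    · intro y hy
      refine if_neg fun h => ?_
      exact (h₂ x y hx hy h.1).not_gt h.2

end

section

variable {n : ℕ} {V : Fin n → Type*} [∀ i, LinearOrder (V i)]

local instance : LinearOrder (Lex (Σ i, V i)) := Sigma.Lex.linearOrder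

theorem ltSign_lex_sigma {i : Fin n} (a b : V i) :
    ltSign (toLex (⟨i, a⟩ : Σ i, V i)) (toLex ⟨i, b⟩) = ltSign a b := by
  simp only [ltSign, toLex_sigma_lt_iff_same]

/-- On its way to the first place, the vertex passes all earlier blocks and the smaller vertices of
its own. -/
theorem firstSign_lex_sigma [∀ i, Fintype (V i)] [Fintype (Lex (Σ i, V i))] (i : Fin n) (a : V i) :
    firstSign (toLex (⟨i, a⟩ : Σ i, V i)) =
      (-1) ^ (∑ j ∈ Finset.Iio i, Fintype.card (V j)) * firstSign a := by
  have h1 : ∀ j, ∏ v : V j, ltSign (toLex (⟨j, v⟩ : Σ i, V i)) (toLex ⟨i, a⟩) =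
      (if j < i then (-1) ^ Fintype.card (V j) else 1) * if j = i then firstSign a else 1 := by
    intro j
    by_cases hj : j = i
    · subst hj
      simp only [ltSign_lex_sigma, lt_irrefl, if_false, one_mul, if_true]
      rfl
    · simp only [ltSign, toLex_sigma_lt_iff_of_ne hj, hj, if_false, mul_one]
      split_ifs <;> simp
  rw [firstSign, Fintype.prod_lex_sigma, Finset.prod_congr rfl fun j _ => h1 j,
    Finset.prod_mul_distrib, Finset.prod_ite, Finset.prod_const_one, mul_one,
    Finset.prod_pow_eq_pow_sum, Finset.prod_ite_eq' Finset.univ i, if_pos (Finset.mem_univ i)]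
  congr 2
  refine Finset.sum_congr ?_ fun _ _ => rfl
  ext j
  simp

end

namespace LabelledGraph

universe u w

variable {k : Type u} [CommRing k] {O : CyclicOperad.{u, w} k} {n : ℕ}

/-- `Δ` is obtained from `Γ` by the contraction of the edges with a half-edge in `S`, which
consists of at most one element. -/
structure IsContractionOf (Γ Δ : LabelledGraph O) (S : Γ.H → Prop) (ι : Δ.H → Γ.H)
    (κ : Δ.V → WithBot Γ.V) : Prop where
  inj : ι.Injective
  ne : ∀ h t, S t → ι h ≠ t ∧ ι h ≠ Γ.inv t
  surj : ∀ h, (∀ t, S t → h ≠ t ∧ h ≠ Γ.inv t) → ∃ h', ι h' = h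
  inv : ∀ h, ι (Δ.inv h) = Γ.inv (ι h)
  out : ∀ h, Δ.out h = Γ.out (ι h)
  mono : StrictMono κ
  ne_coe : ∀ v (w : Γ.V), κ v = ↑w → ∀ t, S t → w ≠ Γ.att t ∧ w ≠ Γ.att (Γ.inv t)
  exists_of_bot : ∀ v, κ v = ⊥ → ∃ t, S t
  att_coe : ∀ h (w : Γ.V), κ (Δ.att h) = ↑w → Γ.att (ι h) = w
  att_bot : ∀ h, κ (Δ.att h) = ⊥ → ∀ t, S t → Γ.att (ι h) = Γ.att t ∨ Γ.att (ι h) = Γ.att (Γ.inv t)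
  lab_coe : ∀ v (w : Γ.V), κ v = ↑w → ∀ e : {h // Γ.att h = w} ≃ {h // Δ.att h = v},
    (∀ x, ι (e x) = x) → Δ.lab v = CyclicOperad.Dec.map e (Γ.lab w)
  lab_bot : ∀ v, κ v = ⊥ → ∀ t, S t → ∀ e : {x : {h : Γ.H // Γ.att h = Γ.att t} // x ≠ ⟨t, rfl⟩} ⊕
    {y : {h : Γ.H // Γ.att h = Γ.att (Γ.inv t)} // y ≠ ⟨Γ.inv t, rfl⟩} ≃ {h // Δ.att h = v},
    (∀ x, ι (e (Sum.inl x)) = x) → (∀ y, ι (e (Sum.inr y)) = y) →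
    Δ.lab v = CyclicOperad.graft _ _ (Γ.two_le_card _) e (Γ.lab (Γ.att t)) (Γ.lab (Γ.att (Γ.inv t)))

theorem isContractionOf_self (Γ : LabelledGraph O) :
    IsContractionOf Γ Γ (fun _ => False) id (fun v => (v : WithBot Γ.V)) where
  inj := Function.injective_id
  ne _ _ h := h.elim
  surj h _ := ⟨h, rfl⟩
  inv _ := rfl
  out _ := rfl
  mono := WithBot.coe_strictMono
  ne_coe _ _ _ _ h := h.elim
  exists_of_bot _ h := (WithBot.coe_ne_bot h).elim
  att_coe _ _ h := WithBot.coe_injective h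
  att_bot _ h := (WithBot.coe_ne_bot h).elim
  lab_coe _ _ _ e he := Γ.lab_congr e he
  lab_bot _ h := (WithBot.coe_ne_bot h).elim

theorem isContractionOf_contract (Γ : LabelledGraph O) {t : Γ.H} (ht : Γ.att t ≠ Γ.att (Γ.inv t)) :
    IsContractionOf Γ (Γ.contract t ht) (fun h => h = t) (fun h : Γ.ContractH t => h.1)
      (fun v : Γ.ContractV t => v.map Subtype.val) where
  inj := Subtype.val_injective
  ne h _ e := e ▸ h.2
  surj h hh := ⟨⟨h, hh t rfl⟩, rfl⟩
  inv _ := rfl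
  out _ := rfl
  mono := WithBot.strictMono_map_iff.2 (Subtype.strictMono_coe _)
  ne_coe v w h t' ht' := by
    subst ht'
    cases v using WithBot.recBotCoe with
    | bot => cases h
    | coe v =>
      obtain rfl : v.1 = w := WithBot.coe_injective h
      exact v.2
  exists_of_bot _ _ := ⟨t, rfl⟩
  att_coe h w hw := by
    change (Γ.contractAtt t h).map Subtype.val = _ at hw
    generalize hz : Γ.contractAtt t h = z at hw
    cases z using WithBot.recBotCoe with
    | bot => cases hw
    | coe v =>
      obtain rfl : v.1 = w := WithBot.coe_injective hw
      exact (Γ.contractAtt_eq_coe t h v).1 hz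
  att_bot h hw t' ht' := by
    subst ht'
    change (Γ.contractAtt t' h).map Subtype.val = _ at hw
    generalize hz : Γ.contractAtt t' h = z at hw
    cases z using WithBot.recBotCoe with
    | bot => exact (Γ.contractAtt_eq_bot t' h).1 hz
    | coe v => cases hw
  lab_coe v w h e he := by
    cases v using WithBot.recBotCoe with
    | bot => cases h
    | coe v =>
      obtain rfl : v.1 = w := WithBot.coe_injective h
      exact Γ.contract_lab_coe t ht v.2.1 v.2.2 e he
  lab_bot v h t' ht' e hl hr := by
    subst ht'
    cases v using WithBot.recBotCoe with
    | bot => exact Γ.contract_lab_bot t' ht rfl e hl hr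
    | coe v => cases h

/-- One description for all components: the predicate selects `t` if `j = i` and nothing otherwise.
Later arguments can treat all `j` alike, without transport along `j = i`. -/
theorem exists_isContractionOf (Γ : Fin n → LabelledGraph O) (i : Fin n) {t : (Γ i).H}
    (ht : (Γ i).att t ≠ (Γ i).att ((Γ i).inv t)) (j : Fin n) :
    ∃ ι κ, IsContractionOf (Γ j) (Function.update Γ i ((Γ i).contract t ht) j)
      (fun h => (⟨j, h⟩ : Σ j, (Γ j).H) = ⟨i, t⟩) ι κ := by
  by_cases hj : j = i
  · subst hj
    rw [Function.update_self]
    have h : (fun h => (⟨j, h⟩ : Σ j, (Γ j).H) = ⟨j, t⟩) = fun h => h = t :=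
      funext fun h => propext ⟨fun e => eq_of_heq (Sigma.mk.inj e).2, fun e => by rw [e]⟩
    rw [h]
    exact ⟨_, _, (Γ j).isContractionOf_contract ht⟩
  · rw [Function.update_of_ne hj]
    have h : (fun h => (⟨j, h⟩ : Σ j, (Γ j).H) = ⟨i, t⟩) = fun _ => False :=
      funext fun h => propext ⟨fun e => hj (Sigma.mk.inj e).1, False.elim⟩
    rw [h]
    exact ⟨_, _, (Γ j).isContractionOf_self⟩

end LabelledGraph

namespace LabelledGraph

universe u w

variable {k : Type u} [CommRing k] {O : CyclicOperad.{u, w} k} {n : ℕ}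

section

variable {Γ Δ : Fin n → LabelledGraph O} {i : Fin n} {u : (Γ i).H} {ι : ∀ j, (Δ j).H → (Γ j).H}
  {κ : ∀ j, (Δ j).V → WithBot (Γ j).V}

/-- The vertex of a disjoint union after the contraction of an edge. -/
def unionVert (κ : ∀ j, (Δ j).V → WithBot (Γ j).V) (v : Lex (Σ j, (Δ j).V)) :
    WithBot (Lex (Σ j, (Γ j).V)) :=
  (κ (ofLex v).1 (ofLex v).2).map fun w => toLex ⟨(ofLex v).1, w⟩

theorem unionVert_eq_bot {v : Lex (Σ j, (Δ j).V)} :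
    unionVert κ v = ⊥ ↔ κ (ofLex v).1 (ofLex v).2 = ⊥ :=
  WithBot.map_eq_bot_iff

theorem unionVert_eq_coe {v : Lex (Σ j, (Δ j).V)} {w : Lex (Σ j, (Γ j).V)}
    (h : unionVert κ v = (w : WithBot (Lex (Σ j, (Γ j).V)))) : ∃ w',
      κ (ofLex v).1 (ofLex v).2 = ((w' : (Γ (ofLex v).1).V) : WithBot (Γ (ofLex v).1).V) ∧
        w = toLex ⟨(ofLex v).1, w'⟩ := by
  obtain ⟨w', h1, h2⟩ := WithBot.map_eq_some_iff.1 h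
  exact ⟨w', h1, h2.symm⟩

theorem unionVert_bot_fst (hC : ∀ j, IsContractionOf (Γ j) (Δ j)
      (fun h => (⟨j, h⟩ : Σ j, (Γ j).H) = ⟨i, u⟩) (ι j) (κ j)) {v : Lex (Σ j, (Δ j).V)}
    (hv : unionVert κ v = ⊥) : (ofLex v).1 = i := by
  obtain ⟨h, hh⟩ := (hC _).exists_of_bot _ (unionVert_eq_bot.1 hv)
  exact congrArg Sigma.fst hh

theorem unionVert_injective (hC : ∀ j, IsContractionOf (Γ j) (Δ j)
      (fun h => (⟨j, h⟩ : Σ j, (Γ j).H) = ⟨i, u⟩) (ι j) (κ j)) : (unionVert κ).Injective := by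
  have same : ∀ (j : Fin n) (a b : (Δ j).V), κ j a = κ j b →
      (toLex ⟨j, a⟩ : Lex (Σ j, (Δ j).V)) = toLex ⟨j, b⟩ :=
    fun j a b h => congrArg (fun a => toLex (⟨j, a⟩ : Σ j, (Δ j).V)) ((hC j).mono.injective h)
  intro v w h
  generalize hz : unionVert κ w = z at h
  cases z using WithBot.recBotCoe with
  | bot =>
    have h1 := unionVert_bot_fst hC h
    have h2 := unionVert_bot_fst hC hz
    have h3 := unionVert_eq_bot.1 h
    have h4 := unionVert_eq_bot.1 hz
    obtain ⟨⟨j, a⟩, rfl⟩ := toLex.surjective v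
    obtain ⟨⟨l, b⟩, rfl⟩ := toLex.surjective w
    obtain rfl : j = l := h1.trans h2.symm
    exact same j a b (h3.trans h4.symm)
  | coe z =>
    obtain ⟨v', h1, h2⟩ := unionVert_eq_coe h
    obtain ⟨w', h3, h4⟩ := unionVert_eq_coe hz
    obtain ⟨⟨j, a⟩, rfl⟩ := toLex.surjective v
    obtain ⟨⟨l, b⟩, rfl⟩ := toLex.surjective w
    have h5 := toLex.injective (h2.symm.trans h4)
    obtain rfl : j = l := congrArg Sigma.fst h5
    obtain rfl : v' = w' := eq_of_heq (Sigma.mk.inj h5).2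
    exact same j a b (h1.trans h3.symm)

theorem unionVert_lt (hC : ∀ j, IsContractionOf (Γ j) (Δ j)
      (fun h => (⟨j, h⟩ : Σ j, (Γ j).H) = ⟨i, u⟩) (ι j) (κ j)) {v w : Lex (Σ j, (Δ j).V)}
    (hv : unionVert κ v ≠ ⊥) (hw : unionVert κ w ≠ ⊥)
    (h : (@LT.lt _ Sigma.Lex.linearOrder.toLT v w)) :
    let _ : LinearOrder (Lex (Σ j, (Γ j).V)) := Sigma.Lex.linearOrder
    unionVert κ v < unionVert κ w := by
  let _ : LinearOrder (Lex (Σ j, (Γ j).V)) := Sigma.Lex.linearOrder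
  obtain ⟨v₁, hv₁⟩ := WithBot.ne_bot_iff_exists.1 hv
  obtain ⟨w₁, hw₁⟩ := WithBot.ne_bot_iff_exists.1 hw
  obtain ⟨v', h1, h2⟩ := unionVert_eq_coe hv₁.symm
  obtain ⟨w', h3, h4⟩ := unionVert_eq_coe hw₁.symm
  rw [← hv₁, ← hw₁, WithBot.coe_lt_coe]
  obtain ⟨⟨j, a⟩, rfl⟩ := toLex.surjective v
  obtain ⟨⟨l, b⟩, rfl⟩ := toLex.surjective w
  subst h2 h4
  by_cases hjl : j = l
  · subst hjl
    replace h := (hC j).mono ((toLex_sigma_lt_iff_same (V := fun j => (Δ j).V)).1 h)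
    refine (toLex_sigma_lt_iff_same (V := fun j => (Γ j).V)).2 ?_
    exact WithBot.coe_lt_coe.1 (h1.symm.trans_lt (h.trans_eq h3))
  · exact (toLex_sigma_lt_iff_of_ne (V := fun j => (Γ j).V) hjl).2
      ((toLex_sigma_lt_iff_of_ne (V := fun j => (Δ j).V) hjl).1 h)

end

section

variable {Γ Δ : Fin n → LabelledGraph O} {i : Fin n} {u : (Γ i).H} {ι : ∀ j, (Δ j).H → (Γ j).H}
  {κ : ∀ j, (Δ j).V → WithBot (Γ j).V}

theorem unionHalves_symm_eq {v : Lex (Σ j, (Γ j).V)}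
    (h : {h : Σ j, (Γ j).H // toLex (⟨h.1, (Γ h.1).att h.2⟩ : Σ j, (Γ j).V) = v}) :
    (⟨(ofLex v).1, ((unionHalves Γ v).symm h).1⟩ : Σ j, (Γ j).H) = h.1 :=
  congrArg Subtype.val ((unionHalves Γ v).apply_symm_apply h)

theorem glue_lab_of_coe (hC : ∀ j, IsContractionOf (Γ j) (Δ j)
      (fun h => (⟨j, h⟩ : Σ j, (Γ j).H) = ⟨i, u⟩) (ι j) (κ j)) (t : ∀ j, (Γ j).H)
    (t' : ∀ j, (Δ j).H) (c : Equiv.Perm (Fin n)) {j : Fin n} {a : (Δ j).V} {w : (Γ j).V}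
    (h : κ j a = (w : WithBot (Γ j).V))
    (e : {h // (glue Γ t c).att h = toLex (⟨j, w⟩ : Σ j, (Γ j).V)} ≃
      {h // (glue Δ t' c).att h = toLex (⟨j, a⟩ : Σ j, (Δ j).V)})
    (he : ∀ y, (⟨(e y).1.1, ι _ (e y).1.2⟩ : Σ j, (Γ j).H) = y.1) :
    (glue Δ t' c).lab (toLex (⟨j, a⟩ : Σ j, (Δ j).V)) =
      CyclicOperad.Dec.map e ((glue Γ t c).lab (toLex (⟨j, w⟩ : Σ j, (Γ j).V))) := by
  let e₀ : {h // (Γ j).att h = w} ≃ {h // (Δ j).att h = a} :=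
    (unionHalves Γ (toLex ⟨j, w⟩)).trans (e.trans (unionHalves Δ (toLex ⟨j, a⟩)).symm)
  have h₀ : ∀ y, ι j (e₀ y) = y := by
    intro y
    have h1 : (⟨j, (e₀ y).1⟩ : Σ j, (Δ j).H) = (e (unionHalves Γ (toLex ⟨j, w⟩) y)).1 :=
      unionHalves_symm_eq (v := toLex ⟨j, a⟩) _
    have h2 := he (unionHalves Γ (toLex ⟨j, w⟩) y)
    rw [← h1] at h2
    exact eq_of_heq (Sigma.mk.inj h2).2
  have h3 : CyclicOperad.Dec.map (unionHalves Δ (toLex ⟨j, a⟩)) ((Δ j).lab a) =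
      CyclicOperad.Dec.map e (CyclicOperad.Dec.map (unionHalves Γ (toLex ⟨j, w⟩))
        ((Γ j).lab w)) := by
    have := (Γ j).nonempty_halves w
    refine (congrArg _ ((hC j).lab_coe a w h e₀ h₀)).trans
      ((CyclicOperad.Dec.map_map _ _ _).trans (.trans ?_ (CyclicOperad.Dec.map_map _ _ _).symm))
    exact congrArg (fun e => CyclicOperad.Dec.map e ((Γ j).lab w))
      (Equiv.ext fun y => (unionHalves Δ (toLex ⟨j, a⟩)).apply_symm_apply
        (e (unionHalves Γ (toLex ⟨j, w⟩) y)))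
  exact h3

theorem glue_lab_of_bot (hC : ∀ j, IsContractionOf (Γ j) (Δ j)
      (fun h => (⟨j, h⟩ : Σ j, (Γ j).H) = ⟨i, u⟩) (ι j) (κ j)) (t : ∀ j, (Γ j).H)
    (t' : ∀ j, (Δ j).H) (c : Equiv.Perm (Fin n)) {x y : (glue Γ t c).H} (hx : x = ⟨i, u⟩)
    (hy : y = ⟨i, (Γ i).inv u⟩) {b : (Δ i).V} (h : κ i b = ⊥)
    (e : {z : {h // (glue Γ t c).att h = (glue Γ t c).att x} // z ≠ ⟨x, rfl⟩} ⊕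
      {z : {h // (glue Γ t c).att h = (glue Γ t c).att y} // z ≠ ⟨y, rfl⟩} ≃
      {h // (glue Δ t' c).att h = toLex (⟨i, b⟩ : Σ j, (Δ j).V)})
    (hl : ∀ z, (⟨(e (Sum.inl z)).1.1, ι _ (e (Sum.inl z)).1.2⟩ : Σ j, (Γ j).H) = z.1.1)
    (hr : ∀ z, (⟨(e (Sum.inr z)).1.1, ι _ (e (Sum.inr z)).1.2⟩ : Σ j, (Γ j).H) = z.1.1) :
    (glue Δ t' c).lab (toLex (⟨i, b⟩ : Σ j, (Δ j).V)) =
      CyclicOperad.graft _ _ ((glue Γ t c).two_le_card _) e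
        ((glue Γ t c).lab ((glue Γ t c).att x)) ((glue Γ t c).lab ((glue Γ t c).att y)) := by
  subst hx hy
  let a₁ : Lex (Σ j, (Γ j).V) := toLex ⟨i, (Γ i).att u⟩
  let a₂ : Lex (Σ j, (Γ j).V) := toLex ⟨i, (Γ i).att ((Γ i).inv u)⟩
  let U₁ : {h // (Γ i).att h = (Γ i).att u} ≃ {h // (glue Γ t c).att h = a₁} := unionHalves Γ a₁
  let U₂ : {h // (Γ i).att h = (Γ i).att ((Γ i).inv u)} ≃ {h // (glue Γ t c).att h = a₂} :=
    unionHalves Γ a₂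
  let U : {h // (Δ i).att h = b} ≃
      {h // (glue Δ t' c).att h = toLex (⟨i, b⟩ : Σ j, (Δ j).V)} := unionHalves Δ (toLex ⟨i, b⟩)
  obtain ⟨e₁, hl₁, hr₁, hg₁⟩ := CyclicOperad.exists_graft_map_left (O := O) (s := ⟨u, rfl⟩) U₁ rfl
    ((Γ i).two_le_card _) ((glue Γ t c).two_le_card _) e
  obtain ⟨e₂, hl₂, hr₂, hg₂⟩ := CyclicOperad.exists_graft_map_right (O := O)
    (t := ⟨(Γ i).inv u, rfl⟩) U₂ rfl ((Γ i).two_le_card _) e₁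
  have hU : ∀ (w : {h // (glue Δ t' c).att h = toLex (⟨i, b⟩ : Σ j, (Δ j).V)}) (y : (Γ i).H),
      (⟨w.1.1, ι _ w.1.2⟩ : Σ j, (Γ j).H) = ⟨i, y⟩ → ι i (U.symm w).1 = y := by
    intro w y hw
    have h1 : (⟨i, (U.symm w).1⟩ : Σ j, (Δ j).H) = w.1 := unionHalves_symm_eq (v := toLex ⟨i, b⟩) w
    rw [← h1] at hw
    exact eq_of_heq (Sigma.mk.inj hw).2
  have h1 := (hC i).lab_bot b h u rfl (e₂.trans U.symm)
    (fun z => hU _ _ ((congrArg (fun w => (⟨w.1.1, ι _ w.1.2⟩ : Σ j, (Γ j).H))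
      ((hl₂ z).trans (hl₁ z.1 z.2 (U₁.injective.ne z.2)))).trans (hl _)))
    (fun z => hU _ _ ((congrArg (fun w => (⟨w.1.1, ι _ w.1.2⟩ : Σ j, (Γ j).H))
      ((hr₂ z.1 z.2 (U₂.injective.ne z.2)).trans (hr₁ _))).trans (hr _)))
  refine (congrArg (CyclicOperad.Dec.map U) h1).trans ((CyclicOperad.map_graft ..).trans ?_)
  refine .trans ?_ ((hg₁ _ _).trans (hg₂ _ _)).symm
  rw [Equiv.trans_assoc, Equiv.symm_trans_self, Equiv.trans_refl]
  rfl

/-- The contraction of an edge commutes with the gluing of a polygon to other edges. -/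
theorem exists_iso_contract_glue (hC : ∀ j, IsContractionOf (Γ j) (Δ j)
      (fun h => (⟨j, h⟩ : Σ j, (Γ j).H) = ⟨i, u⟩) (ι j) (κ j)) (t' : ∀ j, (Δ j).H)
    (c : Equiv.Perm (Fin n)) {x : (glue Γ (fun j => ι j (t' j)) c).H} (hx : x = ⟨i, u⟩)
    (hx' : (glue Γ (fun j => ι j (t' j)) c).inv x = ⟨i, (Γ i).inv u⟩)
    (ht : (glue Γ (fun j => ι j (t' j)) c).att x ≠ (glue Γ (fun j => ι j (t' j)) c).att
      ((glue Γ (fun j => ι j (t' j)) c).inv x)) :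
    ∃ f : Iso (glue Δ t' c) ((glue Γ (fun j => ι j (t' j)) c).contract x ht),
      f.sign = (-1) ^ ∑ j ∈ Finset.Iio i, Fintype.card (Δ j).V := by
  -- A vertex of the glued `Δ` is either the new vertex or an old one, which by `ne_coe` is not an
  -- endpoint of the contracted edge.
  have hK : ∀ v : (glue Δ t' c).V, ∃ z : (glue Γ (fun j => ι j (t' j)) c).ContractV x,
      z.map Subtype.val = unionVert κ v := by
    intro v
    generalize hz : unionVert κ v = z
    cases z using WithBot.recBotCoe with
    | bot => exact ⟨⊥, rfl⟩
    | coe z =>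
      obtain ⟨w, h1, rfl⟩ := unionVert_eq_coe hz
      have h2 : ∀ a : (Γ i).H, (⟨(ofLex v).1, w⟩ : Σ j, (Γ j).V) = ⟨i, (Γ i).att a⟩ →
          (∃ h, h = u ∧ (a = h ∨ a = (Γ i).inv h)) → False := by
        rintro a ha ⟨_, rfl, h2⟩
        obtain ⟨⟨j, v⟩, rfl⟩ := toLex.surjective v
        obtain rfl : j = i := congrArg Sigma.fst ha
        obtain rfl : w = (Γ j).att a := eq_of_heq (Sigma.mk.inj ha).2
        have h3 := (hC j).ne_coe _ _ h1 _ rfl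
        rcases h2 with rfl | rfl
        exacts [h3.1 rfl, h3.2 rfl]
      let z : {v // v ≠ (glue Γ (fun j => ι j (t' j)) c).att x ∧
          v ≠ (glue Γ (fun j => ι j (t' j)) c).att ((glue Γ (fun j => ι j (t' j)) c).inv x)} :=
        ⟨toLex (⟨_, w⟩ : Σ j, (Γ j).V),
          fun e => h2 u (toLex.injective (e.trans (congrArg _ hx))) ⟨u, rfl, Or.inl rfl⟩,
          fun e => h2 _ (toLex.injective (e.trans (congrArg _ hx'))) ⟨u, rfl, Or.inr rfl⟩⟩
      exact ⟨(z : WithBot _), rfl⟩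
  choose K hK using hK
  have hKinj : K.Injective := fun v w h =>
    unionVert_injective hC ((hK v).symm.trans ((congrArg _ h).trans (hK w)))
  have hbot : ∀ v, K v = ⊥ → unionVert κ v = ⊥ := fun v hv => by rw [← hK, hv]; rfl
  have hcoe : ∀ v (w : {v // v ≠ (glue Γ (fun j => ι j (t' j)) c).att x ∧
      v ≠ (glue Γ (fun j => ι j (t' j)) c).att ((glue Γ (fun j => ι j (t' j)) c).inv x)}),
      K v = (w : WithBot _) → unionVert κ v = WithBot.some (α := Lex (Σ j, (Γ j).V)) w.1 :=
    fun v w hv => by rw [← hK, hv]; rfl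
  obtain ⟨f, hf, hf'⟩ := exists_iso_contract (glue Γ (fun j => ι j (t' j)) c) x ht (glue Δ t' c)
    (fun h => ⟨h.1, ι h.1 h.2⟩)
    (fun h h' e => by
      obtain ⟨j, h⟩ := h
      obtain ⟨j', h'⟩ := h'
      obtain rfl : j = j' := congrArg Sigma.fst e
      exact congrArg (fun h => (⟨j, h⟩ : Σ j, (Δ j).H)) ((hC j).inj (eq_of_heq (Sigma.mk.inj e).2)))
    (fun h => by
      obtain ⟨j, h⟩ := h
      refine ⟨fun e => ((hC j).ne h _ (e.trans hx)).1 rfl, fun e => ?_⟩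
      replace e := e.trans hx'
      obtain rfl : j = i := congrArg Sigma.fst e
      exact ((hC j).ne h u rfl).2 (eq_of_heq (Sigma.mk.inj e).2))
    (fun h h₁ h₂ => by
      obtain ⟨j, a⟩ := h
      obtain ⟨h', rfl⟩ := (hC j).surj a fun b hb => by
        obtain rfl : j = i := congrArg Sigma.fst hb
        obtain rfl : b = u := eq_of_heq (Sigma.mk.inj hb).2
        exact ⟨fun e => h₁ (.trans (by rw [e]) hx.symm), fun e => h₂ (.trans (by rw [e]) hx'.symm)⟩
      exact ⟨⟨j, h'⟩, rfl⟩)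
    (fun h => (glueInv_map (fun j => (hC j).inj) (fun j h => ((hC j).inv h).symm) t' c h).symm)
    K hKinj
    (fun h => by
      generalize hz : K ((glue Δ t' c).att h) = z
      obtain ⟨j, h⟩ := h
      cases z using WithBot.recBotCoe with
      | bot =>
        replace hz := hbot _ hz
        obtain rfl : j = i := unionVert_bot_fst hC hz
        refine (contractAtt_eq_bot _ _ _).2 (((hC j).att_bot h (unionVert_eq_bot.1 hz) u rfl).imp
          (fun e => ?_) fun e => ?_)
        · exact (congrArg (fun a => toLex (⟨j, a⟩ : Σ j, (Γ j).V)) e).trans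
            (congrArg (glue Γ (fun j => ι j (t' j)) c).att hx.symm)
        · exact (congrArg (fun a => toLex (⟨j, a⟩ : Σ j, (Γ j).V)) e).trans
            (congrArg (glue Γ (fun j => ι j (t' j)) c).att hx'.symm)
      | coe w =>
        obtain ⟨w', h1, h2⟩ := unionVert_eq_coe (hcoe _ _ hz)
        refine (contractAtt_eq_coe _ _ _ _).2 (.trans ?_ h2.symm)
        exact congrArg (fun a => toLex (⟨j, a⟩ : Σ j, (Γ j).V)) ((hC j).att_coe h w' h1))
    (fun v w hv e he => by
      obtain ⟨w', h1, h2⟩ := unionVert_eq_coe (hcoe _ _ hv)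
      obtain ⟨w, hw⟩ := w
      dsimp only at h2
      subst h2
      obtain ⟨⟨j, v⟩, rfl⟩ := toLex.surjective v
      exact glue_lab_of_coe hC _ t' c h1 e he)
    (fun v hv e hl hr => by
      obtain ⟨⟨j, v⟩, rfl⟩ := toLex.surjective v
      obtain rfl : j = i := unionVert_bot_fst hC (hbot _ hv)
      exact glue_lab_of_bot hC _ t' c hx hx' (unionVert_eq_bot.1 (hbot _ hv)) e hl hr)
  refine ⟨f, ?_⟩
  rw [f.sign_of_out_eq fun h => ?_]
  -- Here `y₀` is the new vertex. Contracting after gluing puts it first, contracting before gluing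
  -- leaves it in block `i`; the other vertices keep their order.
  · obtain ⟨y₀, hy₀⟩ := f.vert.surjective (⊥ : (glue Γ (fun j => ι j (t' j)) c).ContractV x)
    have h₀ := (hf y₀).symm.trans hy₀
    have hne : ∀ y, y ≠ y₀ → K y ≠ ⊥ := fun y hy e => hy (hKinj (e.trans h₀.symm))
    have hne' : ∀ y, y ≠ y₀ → unionVert κ y ≠ ⊥ := fun y hy e =>
      hy (unionVert_injective hC (e.trans (hbot _ h₀).symm))
    have hs : orderSign f.vert = firstSign y₀ := orderSign_of_first y₀ hy₀
      (fun y hy => bot_lt_iff_ne_bot.2 ((hf y).trans_ne (hne y hy)))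
      (fun y z hy hz hyz => by
        rw [hf, hf]
        refine (WithBot.strictMono_map_iff.2 (Subtype.strictMono_coe _)).lt_iff_lt.1 ?_
        exact ((hK y).trans_lt (unionVert_lt hC (hne' y hy) (hne' z hz) hyz)).trans_eq (hK z).symm)
    have hb := unionVert_eq_bot.1 (hbot _ h₀)
    have hi := unionVert_bot_fst hC (hbot _ h₀)
    obtain ⟨⟨j, b⟩, rfl⟩ := toLex.surjective y₀
    obtain rfl : j = i := hi
    -- Within its own block the new vertex is already first, so only the earlier blocks contribute.
    have hb' : firstSign b = 1 := Finset.prod_eq_one fun v _ => if_neg fun h => by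
      have h1 := (hC j).mono h
      rw [show κ j b = ⊥ from hb] at h1
      exact WithBot.not_lt_bot _ h1
    refine hs.trans ((firstSign_lex_sigma (V := fun j => (Δ j).V) j b).trans ?_)
    rw [hb', mul_one]
  · exact (congrArg (glueOut Γ fun j => ι j (t' j)) (hf' h)).trans (glueOut_map
      (fun j => (hC j).inj) (fun j h => ((hC j).inv h).symm) (fun j h => ((hC j).out h).symm) t' h)

end

theorem glue_inv_of_ne (Γ : Fin n → LabelledGraph O) {t : ∀ i, (Γ i).H} (c : Equiv.Perm (Fin n))
    {i : Fin n} {u : (Γ i).H} (h : u ≠ t i ∧ u ≠ (Γ i).inv (t i)) :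
    (glue Γ t c).inv ⟨i, u⟩ = (⟨i, (Γ i).inv u⟩ : Σ j, (Γ j).H) :=
  glueInv_other Γ t c i u h.1 h.2

theorem glue_att_ne (Γ : Fin n → LabelledGraph O) {t : ∀ i, (Γ i).H} (c : Equiv.Perm (Fin n))
    {i : Fin n} {u : (Γ i).H} (h : u ≠ t i ∧ u ≠ (Γ i).inv (t i)) :
    (glue Γ t c).att ⟨i, u⟩ ≠ (glue Γ t c).att ((glue Γ t c).inv ⟨i, u⟩) ↔
      (Γ i).att u ≠ (Γ i).att ((Γ i).inv u) := by
  rw [glue_inv_of_ne Γ c h]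
  refine not_congr ⟨fun e => ?_, fun e => congrArg (fun a => toLex (⟨i, a⟩ : Σ j, (Γ j).V)) e⟩
  exact eq_of_heq (Sigma.mk.inj (toLex.injective e)).2

/-- Each of the two endpoints passes the earlier blocks on its way to the front, and these signs
cancel. There remains the sign of moving the new vertex, which is the Koszul sign of the derivation.
-/
theorem signedContraction_glue (Γ : Fin n → LabelledGraph O) {i : Fin n} {u : (Γ i).H}
    (hu : (Γ i).att u ≠ (Γ i).att ((Γ i).inv u)) {ι : ∀ j, _ → (Γ j).H}
    {κ : ∀ j, _ → WithBot (Γ j).V}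
    (hC : ∀ j, IsContractionOf (Γ j) (Function.update Γ i ((Γ i).contract u hu) j)
      (fun h => (⟨j, h⟩ : Σ j, (Γ j).H) = ⟨i, u⟩) (ι j) (κ j))
    (t' : ∀ j, (Function.update Γ i ((Γ i).contract u hu) j).H) (c : Equiv.Perm (Fin n)) :
    (glue Γ (fun j => ι j (t' j)) c).signedContraction ⟨i, u⟩ =
      ((-1) ^ (∑ j ∈ Finset.Iio i, Fintype.card (Γ j).V) *
        ((Γ i).dir u * (Γ i).frontSign ((Γ i).att u) ((Γ i).att ((Γ i).inv u)))) •
          (glue (Function.update Γ i ((Γ i).contract u hu)) t' c).cls := by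
  have h1 : u ≠ ι i (t' i) ∧ u ≠ (Γ i).inv (ι i (t' i)) := by
    have h := (hC i).ne (t' i) u rfl
    exact ⟨h.1.symm, fun e => h.2 (by rw [e, (Γ i).inv_inv])⟩
  have ht := (glue_att_ne Γ (t := fun j => ι j (t' j)) c h1).2 hu
  obtain ⟨f, hf⟩ := exists_iso_contract_glue hC t' c rfl (glue_inv_of_ne Γ c h1) ht
  have hcard : ∑ j ∈ Finset.Iio i, Fintype.card (Function.update Γ i ((Γ i).contract u hu) j).V =
      ∑ j ∈ Finset.Iio i, Fintype.card (Γ j).V :=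
    Finset.sum_congr rfl fun j hj => by rw [Function.update_of_ne (Finset.mem_Iio.1 hj).ne]
  rw [hcard] at hf
  have hdir : (glue Γ (fun j => ι j (t' j)) c).dir ⟨i, u⟩ = (Γ i).dir u :=
    congrArg (fun b => if b = true then (1 : ℤ) else -1)
      (glueOut_other Γ (fun j => ι j (t' j)) h1.1 h1.2)
  have hfirst : ∀ (x : (glue Γ (fun j => ι j (t' j)) c).H) (a : (Γ i).H), x = ⟨i, a⟩ →
      firstSign ((glue Γ (fun j => ι j (t' j)) c).att x) =
        (-1) ^ (∑ j ∈ Finset.Iio i, Fintype.card (Γ j).V) * firstSign ((Γ i).att a) := by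
    rintro _ a rfl
    exact firstSign_lex_sigma (V := fun j => (Γ j).V) i _
  have hlt : ∀ x : (glue Γ (fun j => ι j (t' j)) c).H, x = ⟨i, (Γ i).inv u⟩ →
      ltSign ((glue Γ (fun j => ι j (t' j)) c).att ⟨i, u⟩)
        ((glue Γ (fun j => ι j (t' j)) c).att x) =
        ltSign ((Γ i).att u) ((Γ i).att ((Γ i).inv u)) := by
    rintro _ rfl
    exact ltSign_lex_sigma (V := fun j => (Γ j).V) _ _
  rw [signedContraction_of_ne ht, hdir, hfirst _ u rfl, hfirst _ _ (glue_inv_of_ne Γ c h1),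
    hlt _ (glue_inv_of_ne Γ c h1), f.cls_eq, hf, smul_smul, frontSign_eq _ hu]
  congr 1
  ring

/-- The choices of directed edges after the contraction of `u` are the choices for `Γ` which do not
use the edge of `u`. For these the contraction commutes with the gluing, by
`signedContraction_glue`. -/
theorem update_signedContraction_gluingSum (Γ : Fin n → LabelledGraph O)
    {M : MultilinearMap k (fun _ : Fin n => GraphComplex O) (GraphComplex O)} {a : k}
    (hM : ∀ Γ : Fin n → LabelledGraph O, M (fun j => (Γ j).cls) = a • gluingSum Γ)
    (i : Fin n) (u : (Γ i).H) :
    (-1 : ℤ) ^ (∑ j ∈ Finset.Iio i, Fintype.card (Γ j).V) •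
      M (Function.update (fun j => (Γ j).cls) i ((Γ i).signedContraction u)) =
      a • ∑ s : Equiv.Perm (Fin n), ∑ t : (∀ j, (Γ j).H),
        if u ≠ t i ∧ u ≠ (Γ i).inv (t i) then
          dirSign Γ t • (glue Γ t (cyclicOrder s)).signedContraction ⟨i, u⟩ else 0 := by
  by_cases hu : (Γ i).att u = (Γ i).att ((Γ i).inv u)
  · rw [signedContraction_of_loop hu, MultilinearMap.map_update_zero, smul_zero,
      Finset.sum_eq_zero fun s _ => Finset.sum_eq_zero fun t _ => ?_, smul_zero]
    split_ifs with h
    · rw [signedContraction_of_loop (not_not.1 fun h' => (glue_att_ne Γ _ h).1 h' hu), smul_zero]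
    · rfl
  · have hup : Function.update (fun j => (Γ j).cls) i ((Γ i).contract u hu).cls =
        fun j => (Function.update Γ i ((Γ i).contract u hu) j).cls := by
      funext j
      exact (Function.apply_update (fun _ Γ => cls Γ) Γ i _ j).symm
    have hsmul : ∀ (m : ℤ) (x : GraphComplex O),
        M (Function.update (fun j => (Γ j).cls) i (m • x)) =
        m • M (Function.update (fun j => (Γ j).cls) i x) :=
      fun m x => map_zsmul (M.toLinearMap (fun j => (Γ j).cls) i) m x
    choose ι κ hC using exists_isContractionOf Γ i hu
    rw [signedContraction, contractCls_of_ne hu, smul_smul, hsmul, hup, hM,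
      gluingSum, smul_smul, smul_comm, Finset.smul_sum]
    congr 1
    refine Finset.sum_congr rfl fun s _ => ?_
    rw [Finset.smul_sum]
    -- Choices outside the image use the edge of `u` itself, and their terms are zero.
    refine Fintype.sum_of_injective (fun t' j => ι j (t' j))
      (fun t' t'' h => funext fun j => (hC j).inj (congrFun h j)) _ _ (fun t ht => ?_) fun t' => ?_
    · refine if_neg fun h => ht ?_
      have h1 : ∀ j, ∃ h', ι j h' = t j := fun j => (hC j).surj _ fun v hv => by
        obtain rfl : j = i := congrArg Sigma.fst hv
        obtain rfl : v = u := eq_of_heq (Sigma.mk.inj hv).2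
        exact ⟨h.1.symm, fun e => h.2 (by rw [e, (Γ j).inv_inv])⟩
      choose t' ht' using h1
      exact ⟨t', funext ht'⟩
    · have h := (hC i).ne (t' i) u rfl
      have h1 : dirSign (Function.update Γ i ((Γ i).contract u hu)) t' =
          dirSign Γ fun j => ι j (t' j) := by
        rw [dirSign_eq, dirSign_eq]
        refine Finset.prod_congr rfl fun j _ => ?_
        rw [dir, dir, (hC j).out]
      rw [if_pos ⟨h.1.symm, fun e => h.2 (by rw [e, (Γ i).inv_inv])⟩,
        signedContraction_glue Γ hu hC,
        h1, smul_comm]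

end LabelledGraph

/-! ### Contraction of the new edges and the fusion operations -/

theorem exists_commute_finRotate {n : ℕ} (l m : Fin n) :
    ∃ r : Equiv.Perm (Fin n), r l = m ∧ r * finRotate n = finRotate n * r := by
  cases n with
  | zero => exact l.elim0
  | succ n =>
    -- Translations of the cyclic group of order `n + 1` commute with the rotation, which is one of
    -- them.
    refine ⟨Equiv.addRight (m - l), by simp, Equiv.ext fun x => ?_⟩
    simp only [Equiv.Perm.mul_apply, finRotate_apply, Equiv.coe_addRight]
    exact add_right_comm _ _ _

namespace LabelledGraph

universe u w

theorem cyclicOrder_mul {n : ℕ} (s : Equiv.Perm (Fin n)) {r : Equiv.Perm (Fin n)}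
    (hr : r * finRotate n = finRotate n * r) : cyclicOrder (s * r) = cyclicOrder s := by
  rw [cyclicOrder, cyclicOrder, mul_assoc s r, hr]
  group

/-- Each of the edges of a polygon can be chosen as the marked one. -/
theorem sum_sum_cyclicOrder {n : ℕ} {M : Type*} [AddCommMonoid M]
    (F : Equiv.Perm (Fin n) → Fin n → M) (l : Fin n) :
    ∑ s, ∑ j, F (cyclicOrder s) j = n • ∑ s, F (cyclicOrder s) (s l) := by
  have h1 : ∀ s : Equiv.Perm (Fin n), ∑ j, F (cyclicOrder s) j = ∑ m, F (cyclicOrder s) (s m) :=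
    fun s => (Equiv.sum_comp s _).symm
  -- Rotating the enumeration `s` keeps the cyclic order and moves the marked place.
  have h2 : ∀ m, ∑ s, F (cyclicOrder s) (s m) = ∑ s, F (cyclicOrder s) (s l) := by
    intro m
    obtain ⟨r, hr, hr'⟩ := exists_commute_finRotate l m
    refine Fintype.sum_equiv (Equiv.mulRight r) _ _ fun s => ?_
    rw [Equiv.coe_mulRight, cyclicOrder_mul s hr', Equiv.Perm.mul_apply, hr]
  rw [Finset.sum_congr rfl fun s _ => h1 s, Finset.sum_comm, Finset.sum_congr rfl fun m _ => h2 m,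
    Finset.sum_const, Finset.card_univ, Fintype.card_fin]

section

variable {k : Type u} [CommRing k] {O : CyclicOperad.{u, w} k} {n : ℕ}

theorem dir_glue_tail (Γ : Fin n → LabelledGraph O) (t : ∀ i, (Γ i).H) (c : Equiv.Perm (Fin n))
    (j : Fin n) : (glue Γ t c).dir ⟨j, t j⟩ = 1 :=
  if_pos (glueOut_tail Γ t j)

theorem signedContraction_glue_tail (Γ : Fin n → LabelledGraph O) (t : ∀ i, (Γ i).H)
    (c : Equiv.Perm (Fin n)) (j : Fin n) :
    (glue Γ t c).signedContraction ⟨j, t j⟩ = (glue Γ t c).contractCls ⟨j, t j⟩ :=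
  (congrArg (· • _) (dir_glue_tail Γ t c j)).trans (one_smul ℤ _)

theorem signedContraction_glue_head (Γ : Fin n → LabelledGraph O) (t : ∀ i, (Γ i).H)
    (c : Equiv.Perm (Fin n)) (j : Fin n) :
    (glue Γ t c).signedContraction ⟨j, (Γ j).inv (t j)⟩ =
      (glue Γ t c).contractCls ⟨c j, t (c j)⟩ :=
  ((glue Γ t c).signedContraction_inv _).symm.trans
    ((congrArg (glue Γ t c).signedContraction (glueInv_head Γ t c j)).trans
      (signedContraction_glue_tail Γ t c (c j)))

/-- A half-edge of the glued graph is a tail, a head or not used for gluing. Each new edge joins one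
head to one tail and has the same signed contraction at both ends, whence the factor two. -/
theorem sum_signedContraction_glue (Γ : Fin n → LabelledGraph O) (t : ∀ i, (Γ i).H)
    (c : Equiv.Perm (Fin n)) : ∑ x, (glue Γ t c).signedContraction x =
      2 • ∑ j, (glue Γ t c).contractCls ⟨j, t j⟩ +
        ∑ j, ∑ h : (Γ j).H, if h ≠ t j ∧ h ≠ (Γ j).inv (t j) then
          (glue Γ t c).signedContraction ⟨j, h⟩ else 0 := by
  have h1 : ∑ x, (glue Γ t c).signedContraction x =
      ∑ j, ∑ h : (Γ j).H, (glue Γ t c).signedContraction ⟨j, h⟩ := Fintype.sum_sigma _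
  have h2 : ∀ j, ∑ h : (Γ j).H, (glue Γ t c).signedContraction ⟨j, h⟩ =
      (glue Γ t c).contractCls ⟨j, t j⟩ + (glue Γ t c).contractCls ⟨c j, t (c j)⟩ +
        ∑ h : (Γ j).H, if h ≠ t j ∧ h ≠ (Γ j).inv (t j) then
          (glue Γ t c).signedContraction ⟨j, h⟩ else 0 := by
    intro j
    have h3 : ∀ h : (Γ j).H, (glue Γ t c).signedContraction ⟨j, h⟩ =
        (if h = t j then (glue Γ t c).contractCls ⟨j, t j⟩ else 0) +
          (if h = (Γ j).inv (t j) then (glue Γ t c).contractCls ⟨c j, t (c j)⟩ else 0) +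
          if h ≠ t j ∧ h ≠ (Γ j).inv (t j) then (glue Γ t c).signedContraction ⟨j, h⟩ else 0 := by
      intro h
      by_cases h1 : h = t j
      · subst h1
        rw [signedContraction_glue_tail]
        simp [((Γ j).inv_ne _).symm]
      by_cases h2 : h = (Γ j).inv (t j)
      · subst h2
        rw [signedContraction_glue_head]
        simp [(Γ j).inv_ne]
      · simp [h1, h2]
    rw [Finset.sum_congr rfl fun h _ => h3 h, Finset.sum_add_distrib, Finset.sum_add_distrib,
      Finset.sum_ite_eq' Finset.univ (t j), Finset.sum_ite_eq' Finset.univ ((Γ j).inv (t j)),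
      if_pos (Finset.mem_univ _), if_pos (Finset.mem_univ _)]
  have h3 : ∑ j, (glue Γ t c).contractCls ⟨c j, t (c j)⟩ =
      ∑ j, (glue Γ t c).contractCls ⟨j, t j⟩ :=
    Equiv.sum_comp c fun j => (glue Γ t c).contractCls ⟨j, t j⟩
  rw [h1, Finset.sum_congr rfl fun j _ => h2 j, Finset.sum_add_distrib, Finset.sum_add_distrib, h3,
    two_nsmul]

/-- Gluing a `2`-gon replaces an edge by itself, in the chosen direction. -/
theorem exists_iso_glue_one (Γ : Fin 1 → LabelledGraph O) (t : ∀ i, (Γ i).H)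
    (c : Equiv.Perm (Fin 1)) : ∃ f : Iso (Γ 0) (glue Γ t c), f.sign = dirSign Γ t ∧
      ∀ h, f.half h = (⟨0, h⟩ : Σ i, (Γ i).H) := by
  have hc : ∀ i, c i = i := fun i => Subsingleton.elim _ _
  have hc' : ∀ i, c.symm i = i := fun i => Subsingleton.elim _ _
  let half : (Γ 0).H ≃ (glue Γ t c).H := (Equiv.uniqueSigma fun i => (Γ i).H).symm
  let f : Iso (Γ 0) (glue Γ t c) := Iso.ofInjective half
    (fun v => toLex (⟨0, v⟩ : Σ i, (Γ i).V)) (fun v w h => eq_of_heq (Sigma.mk.inj h).2)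
    (fun h => rfl)
    (fun h => by
      change glueInv Γ t c ⟨0, h⟩ = ⟨0, (Γ 0).inv h⟩
      by_cases h1 : h = t 0
      · subst h1
        rw [glueInv_tail, hc']
      by_cases h2 : h = (Γ 0).inv (t 0)
      · subst h2
        rw [glueInv_head, hc, (Γ 0).inv_inv]
      · exact glueInv_other Γ t c 0 h h1 h2)
    (fun v e he => congrArg (fun e => CyclicOperad.Dec.map e ((Γ 0).lab v))
      (Equiv.ext fun x => Subtype.ext (he x).symm))
  refine ⟨f, ?_, fun _ => rfl⟩
  have h1 : orderSign f.vert = 1 := orderSign_of_strictMono fun v w h =>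
    (toLex_sigma_lt_iff_same (V := fun j => (Γ j).V)).2 h
  have h2 : ∀ h : (Γ 0).ContractH (t 0), edgeSign (Γ 0) (glue Γ t c) f.half h = 1 := fun h => by
    have h3 : (glue Γ t c).out (f.half h.1) = (Γ 0).out h.1 := glueOut_other Γ t h.2.1 h.2.2
    rw [edgeSign, h3]
    simp
  rw [f.sign_eq, h1, contract_edgeSign f.half (t 0) (f.inv_half _),
    Finset.prod_congr rfl fun h _ => h2 h,
    dirSign_eq, show (glue Γ t c).dir (f.half (t 0)) = 1 from dir_glue_tail Γ t c 0]
  simp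

end

variable {k : Type u} [Field k] [CharZero k] {O : CyclicOperad.{u, w} k}

/-- For a single graph the directed edges are the half-edges, and the fusion terms are their signed
contractions. Both operators are then half the sum over all half-edges. -/
theorem IsFusion.eq_boundary [NeZero 1] {d : GraphComplex O →ₗ[k] GraphComplex O}
    (hd : IsBoundary O d) {φ : GraphSym O 1 →ₗ[k] GraphComplex O} (hφ : IsFusion O 1 φ)
    (x : GraphComplex O) : φ (symTensor (graphDegree O) fun _ => x) = d x := by
  have h1 : ∀ Γ : LabelledGraph O, φ (symTensor (graphDegree O) fun _ => Γ.cls) = d Γ.cls := by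
    intro Γ
    have h2 : ∀ (s : Equiv.Perm (Fin 1)) (t : Fin 1 → Γ.H), dirSign (fun _ => Γ) t •
        (glue (fun _ => Γ) t (cyclicOrder s)).contractCls
          ⟨s (finRotate 1 0), t (s (finRotate 1 0))⟩ = Γ.signedContraction (t 0) := by
      intro s t
      obtain ⟨f, hf, hf'⟩ := exists_iso_glue_one (fun _ => Γ) t (cyclicOrder s)
      rw [show s (finRotate 1 0) = 0 from Subsingleton.elim _ _]
      refine (f.signedContraction_eq (t 0)).trans ?_ |>.symm
      rw [hf, hf']
      exact congrArg _ (signedContraction_glue_tail (fun _ => Γ) t (cyclicOrder s) 0)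
    refine (hφ fun _ => Γ).trans ?_
    rw [IsBoundary.apply_cls hd,
      Finset.sum_congr rfl fun s _ => Finset.sum_congr rfl fun t _ => h2 s t,
      Finset.sum_const, Finset.card_univ, Fintype.card_perm]
    simp only [Fintype.card_unique, Nat.factorial_one, one_smul]
    congr 1
    exact Fintype.sum_equiv (Equiv.funUnique (Fin 1) Γ.H) _ _ fun t => rfl
  let F : GraphComplex O →ₗ[k] GraphComplex O := φ ∘ₗ
    (symMultilinear (graphDegree O) 1).toLinearMap (fun _ => x) 0
  have hF : ∀ y, F y = φ (symTensor (graphDegree O) fun _ => y) := fun y =>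
    congrArg (fun z => φ (symTensor (graphDegree O) z)) (funext fun i => by
      rw [Subsingleton.elim i 0, Function.update_self])
  rw [← hF, ext_cls (f := F) (g := d) fun Γ => (hF _).trans (h1 Γ)]

/-- The central computation. The boundary of a glued graph splits into old and new edges; the old
ones are also the terms of `μ (D …)`, and the new ones give fusion terms. -/
theorem isFusion_of_boundary {n : ℕ} [NeZero n] {d : GraphComplex O →ₗ[k] GraphComplex O}
    (hd : IsBoundary O d) {D : GraphSym O n →ₗ[k] GraphSym O n}
    (hD : IsDerivationExtension (graphDegree O) d D) {μ : GraphSym O n →ₗ[k] GraphComplex O}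
    (hμ : IsGluing O n μ) : IsFusion O n (d ∘ₗ μ - μ ∘ₗ D) := by
  intro Γ
  set a : k := 1 / (2 * n) with ha
  let M := μ.compMultilinearMap (symMultilinear (graphDegree O) n)
  have hM : ∀ Γ : Fin n → LabelledGraph O, M (fun j => (Γ j).cls) = a • gluingSum Γ := hμ
  let old : Equiv.Perm (Fin n) → (∀ j, (Γ j).H) → ∀ i, (Γ i).H → GraphComplex O :=
    fun s t i u => if u ≠ t i ∧ u ≠ (Γ i).inv (t i) then
      dirSign Γ t • (glue Γ t (cyclicOrder s)).signedContraction ⟨i, u⟩ else 0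
  have h1 : ∀ i, (-1 : ℤ) ^ (∑ j ∈ Finset.Iio i, Fintype.card (Γ j).V) •
      M (Function.update (fun j => (Γ j).cls) i (d (Γ i).cls)) =
        (1 / 2 : k) • a • ∑ s, ∑ t, ∑ u, old s t i u := by
    intro i
    rw [IsBoundary.apply_cls hd, MultilinearMap.map_update_smul, MultilinearMap.map_update_sum,
      smul_comm, Finset.smul_sum,
      Finset.sum_congr rfl fun u _ => update_signedContraction_gluingSum Γ hM i u,
      ← Finset.smul_sum, Finset.sum_comm, Finset.sum_congr rfl fun s _ => Finset.sum_comm]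
  have h2 : μ (D (symTensor (graphDegree O) fun i => (Γ i).cls)) =
      (1 / 2 : k) • a • ∑ s, ∑ t, ∑ i, ∑ u, old s t i u := by
    rw [hD _ _ fun l => cls_mem_graphDegree (Γ l), map_sum]
    refine (Finset.sum_congr rfl fun i _ => (map_zsmul μ _ _).trans (h1 i)).trans ?_
    rw [← Finset.smul_sum, ← Finset.smul_sum, Finset.sum_comm,
      Finset.sum_congr rfl fun s _ => Finset.sum_comm]
  have h3 : d (μ (symTensor (graphDegree O) fun i => (Γ i).cls)) =
      (1 / 2 : k) • a • ∑ s, ∑ t, (2 • (dirSign Γ t • ∑ j,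
        (glue Γ t (cyclicOrder s)).contractCls ⟨j, t j⟩) + ∑ i, ∑ u, old s t i u) := by
    have h : ∀ s t, d (dirSign Γ t • (glue Γ t (cyclicOrder s)).cls) =
        (1 / 2 : k) • (2 • (dirSign Γ t • ∑ j,
          (glue Γ t (cyclicOrder s)).contractCls ⟨j, t j⟩) + ∑ i, ∑ u, old s t i u) := by
      intro s t
      rw [map_zsmul, IsBoundary.apply_cls hd, sum_signedContraction_glue, smul_comm, smul_add,
        smul_comm, Finset.smul_sum]
      simp only [old, Finset.smul_sum, smul_ite, smul_zero]
    rw [hμ, map_smul, map_sum, smul_comm (1 / 2 : k) a]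
    refine congrArg (a • ·) ?_
    rw [Finset.smul_sum]
    refine Finset.sum_congr rfl fun s _ => ?_
    rw [map_sum, Finset.sum_congr rfl fun t _ => h s t, Finset.smul_sum]
  have h4 := sum_sum_cyclicOrder (fun c j => ∑ t : (∀ j, (Γ j).H), dirSign Γ t •
    (glue Γ t c).contractCls ⟨j, t j⟩) (finRotate n 0)
  have h5 : ∑ s, ∑ t : (∀ j, (Γ j).H), dirSign Γ t • ∑ j,
      (glue Γ t (cyclicOrder s)).contractCls ⟨j, t j⟩ = ∑ s : Equiv.Perm (Fin n), ∑ j,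
        ∑ t : (∀ j, (Γ j).H), dirSign Γ t • (glue Γ t (cyclicOrder s)).contractCls ⟨j, t j⟩ := by
    refine Finset.sum_congr rfl fun s _ => ?_
    rw [Finset.sum_comm]
    exact Finset.sum_congr rfl fun t _ => Finset.smul_sum
  rw [LinearMap.sub_apply, LinearMap.comp_apply, LinearMap.comp_apply, h2, h3]
  simp only [Finset.sum_add_distrib, ← Finset.smul_sum]
  -- The old edges cancel, and the sum over the new edges is `n` times the sum with the marked edge
  -- of `IsFusion`.
  rw [smul_add, smul_add, add_sub_cancel_right, h5, h4]
  -- The factors combine to `1 / 2 * (1 / (2 * n)) * 2 * n = 1 / 2`.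
  have hn : (n : k) ≠ 0 := Nat.cast_ne_zero.2 (NeZero.ne n)
  rw [← Nat.cast_smul_eq_nsmul k, ← Nat.cast_smul_eq_nsmul k, smul_smul, smul_smul, smul_smul]
  congr 1
  rw [ha]
  push_cast
  field_simp

end LabelledGraph

/-! ### The proposition -/

theorem mainTheorem6 {k : Type*} [Field k] [CharZero k] (O : CyclicOperad k) (n : ℕ) [NeZero n] :
    (∃! d, IsBoundary O d) ∧ (∃! φ, IsFusion O n φ) ∧ (∃! μ, IsGluing O n μ) ∧
    ∀ d, IsBoundary O d → d ∘ₗ d = 0 ∧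
      (∃! D : GraphSym O n →ₗ[k] GraphSym O n, IsDerivationExtension (graphDegree O) d D) ∧
      ∀ (D : GraphSym O n →ₗ[k] GraphSym O n) (φ μ : GraphSym O n →ₗ[k] GraphComplex O),
        IsDerivationExtension (graphDegree O) d D → IsFusion O n φ → IsGluing O n μ →
        D ∘ₗ D = 0 ∧
        (n = 1 → ∀ x, φ (symTensor (graphDegree O) fun _ => x) = d x) ∧
        d ∘ₗ φ + φ ∘ₗ D = 0 ∧
        φ = d ∘ₗ μ - μ ∘ₗ D ∧
        (∀ x : Fin n → GraphComplex O, (∀ i, d (x i) = 0) →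
          φ (symTensor (graphDegree O) x) = d (μ (symTensor (graphDegree O) x))) ∧
        ∃ (hφ : ∀ z ∈ LinearMap.ker D, φ z ∈ LinearMap.ker d)
          (hB : (LinearMap.range D).submoduleOf (LinearMap.ker D) ≤
            ((LinearMap.range d).submoduleOf (LinearMap.ker d)).comap (φ.restrict hφ)),
          ((Submodule.mapQ _ _ (φ.restrict hφ) hB : Homology D →ₗ[k] Homology d) = 0) := by
  obtain ⟨d₀, hd₀⟩ := LabelledGraph.exists_isBoundary O
  obtain ⟨μ₀, hμ₀⟩ := LabelledGraph.exists_isGluing O n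
  obtain ⟨ε, hε⟩ := LabelledGraph.exists_grading O
  have hA := LabelledGraph.iSup_graphDegree (O := O)
  have hDD : ∀ d, IsBoundary O d →
      ∃! D : GraphSym O n →ₗ[k] GraphSym O n, IsDerivationExtension (graphDegree O) d D :=
    fun d hd => existsUnique_isDerivationExtension hA hε (LabelledGraph.IsBoundary.map_mem hd)
  obtain ⟨D₀, hD₀, -⟩ := hDD d₀ hd₀
  have hφu : ∀ φ ψ : GraphSym O n →ₗ[k] GraphComplex O, IsFusion O n φ → IsFusion O n ψ → φ = ψ :=
    fun φ ψ hφ hψ => LabelledGraph.graphSym_ext fun Γ => (hφ Γ).trans (hψ Γ).symm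
  -- The fusion operation is obtained as `∂ μ - μ ∂`, so no separate check of the relations is
  -- needed for it.
  refine ⟨⟨d₀, hd₀, fun d hd => LabelledGraph.ext_cls fun Γ => (hd Γ).trans (hd₀ Γ).symm⟩,
    ⟨_, LabelledGraph.isFusion_of_boundary hd₀ hD₀ hμ₀, fun φ hφ => hφu _ _ hφ (LabelledGraph.isFusion_of_boundary hd₀ hD₀ hμ₀)⟩,
    ⟨μ₀, hμ₀, fun μ hμ => LabelledGraph.graphSym_ext fun Γ => (hμ Γ).trans (hμ₀ Γ).symm⟩, fun d hd => ?_⟩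
  have hdd : d ∘ₗ d = 0 := LabelledGraph.IsBoundary.comp_self hd
  have hdd' : ∀ x, d (d x) = 0 := LinearMap.congr_fun hdd
  refine ⟨hdd, hDD d hd, fun D φ μ hD hφ hμ => ?_⟩
  have hDD : D ∘ₗ D = 0 := hD.comp_self hA hε (LabelledGraph.IsBoundary.map_mem hd) hdd'
  -- By uniqueness any fusion operation is this difference; the remaining claims are formal.
  obtain rfl : φ = d ∘ₗ μ - μ ∘ₗ D := hφu _ _ hφ (LabelledGraph.isFusion_of_boundary hd hD hμ)
  have hker : ∀ z, D z = 0 → (d ∘ₗ μ - μ ∘ₗ D) z = d (μ z) := fun z hz => by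
    rw [LinearMap.sub_apply, LinearMap.comp_apply, LinearMap.comp_apply, hz, map_zero, sub_zero]
  refine ⟨hDD, ?_, ?_, rfl, fun x hx => hker _ ?_, fun z hz => ?_, ?_, ?_⟩
  · rintro rfl
    exact LabelledGraph.IsFusion.eq_boundary hd hφ
  · rw [LinearMap.comp_sub, LinearMap.sub_comp, ← LinearMap.comp_assoc, hdd, LinearMap.zero_comp,
      LinearMap.comp_assoc D D μ, hDD, LinearMap.comp_zero, LinearMap.comp_assoc]
    abel
  · rw [(isDerivationExtension_iff_of_mem hA hε D).1 hD]
    refine Finset.sum_eq_zero fun i _ => (symMultilinear (graphDegree O) n).map_coord_zero i ?_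
    rw [derivationTerm_self, hx]
  · rw [LinearMap.mem_ker, hker z hz, hdd']
  -- For every cycle `z`, not only for boundaries, the value is the boundary of `μ z`. This gives
  -- both that the map on homology is defined and that it is zero.
  · exact fun z _ => ⟨μ z, (hker z z.2).symm⟩
  · exact Submodule.linearMap_qext _ (LinearMap.ext fun z =>
      (Submodule.Quotient.mk_eq_zero _).2 ⟨μ z, (hker z z.2).symm⟩)
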